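/- Let $m\ge 0$ and $n\ge 2m$ be integers, $V=\mathbb C^n$, and let $\overline{\mathcal O}_\lambda$ be the (reduced) variety of complex $n\times n$ matrices $g$ with $g^2=0$ and $\operatorname{rank} g\le m$; here $\lambda=(2^m,1^{n-2m})$. Let $\mathcal F=\mathcal F(m,n-m,V)$ be the generalized flag variety of pairs of subspaces $U_1\subset U_2\subset V$ with $\dim U_1=m$, $\dim U_2=n-m$, and put $$\widetilde{\mathcal O}_\lambda=\{(g,U_1,U_2)\mid \operatorname{Im} g\subset U_1\subset U_2\subset\ker g\}\subset\overline{\mathcal O}_\lambda\times\mathcal F ,\qquad p(g,U_1,U_2)=g .$$ Let $\mathrm{Taut}=\{(u,U_1,U_2)\mid u\in U_1\}\subset V\times\mathcal F$ be the tautological bundle and $Q^*=\{(v,U_1,U_2)\mid v\in (V/U_2)^*\}\subset V^*\times\mathcal F$ the dual quotient bundle over $\mathcal F$. (1) There is an isomorphism of varieties $\mathrm{Taut}\otimes Q^*\cong\widetilde{\mathcal O}_\lambda$ which commutes with the projections to $\mathcal F$ and is linear on the fibres. (2) The map $p:\widetilde{\mathcal O}_\lambda\to\overline{\mathcal O}_\lambda$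 is a resolution of singularities: $\widetilde{\mathcal O}_\lambda$ is a smooth variety and $p$ is a proper birational morphism (proper in the classical topology; birational meaning that $p$ is an isomorphism over a dense Zariski open subset of $\overline{\mathcal O}_\lambda$ whose preimage is dense). (3) If $m>0$ and $n>2m$, then $p$ differs from the resolutions by cotangent bundles of grassmannians: for $k=m$ and for $k=n-m$, there is no isomorphism over $\overline{\mathcal O}_\lambda$ between $\widetilde{\mathcal O}_\lambda$ and the cotangent bundle $T^*Gr(k,V)=\{(g,U)\mid g\in\overline{\mathcal O}_\lambda,\ U\in Gr(k,V),\ \operatorname{Im} g\subset U\subset\ker g\}$ with its projection $(g,U)\mapsto g$. -/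

import Mathlib

open Filter Topology TensorProduct

noncomputable section

/-! ### Spaces with functions

Classical complex varieties are treated as topological spaces carrying a sheaf of complex valued
functions.  The sheaf is recorded by the predicate `RegAt f x`: the function `f` is regular on
some open neighbourhood of `x` (values of `f` far from `x` are irrelevant). -/

/-- A space with functions over `ℂ`: a topological space (the Zariski topology) together with a
sheaf of `ℂ`-algebras of complex valued functions, in which a regular function that does not
vanish at a point is invertible near that point. -/
structure FunSpace where
  carrier : Type
  top : TopologicalSpace carrier
  RegAt : (carrier → ℂ) → carrier → Prop
  congr : ∀ {f g : carrier → ℂ} {x : carrier}, (∀ᶠ y in 𝓝 x, f y = g y) → RegAt f x → RegAt g x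
  spread : ∀ {f : carrier → ℂ} {x : carrier}, RegAt f x → ∀ᶠ y in 𝓝 x, RegAt f y
  const : ∀ (c : ℂ) (x : carrier), RegAt (fun _ => c) x
  add : ∀ {f g : carrier → ℂ} {x : carrier},
    RegAt f x → RegAt g x → RegAt (fun y => f y + g y) x
  mul : ∀ {f g : carrier → ℂ} {x : carrier},
    RegAt f x → RegAt g x → RegAt (fun y => f y * g y) x
  ne_zero : ∀ {f : carrier → ℂ} {x : carrier}, RegAt f x → f x ≠ 0 → ∀ᶠ y in 𝓝 x, f y ≠ 0
  inv : ∀ {f : carrier → ℂ} {x : carrier}, RegAt f x → f x ≠ 0 → RegAt (fun y => (f y)⁻¹) x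

namespace FunSpace

instance : CoeSort FunSpace Type := ⟨FunSpace.carrier⟩

instance (X : FunSpace) : TopologicalSpace X := X.top

/-- Morphisms: continuous maps that pull regular functions back to regular functions. -/
def IsMorphism (X Y : FunSpace) (φ : X → Y) : Prop :=
  Continuous φ ∧ ∀ (f : Y → ℂ) (x : X), Y.RegAt f (φ x) → X.RegAt (fun y => f (φ y)) x

/-- Isomorphisms: bijections that are morphisms in both directions. -/
def IsIso {X Y : FunSpace} (e : X ≃ Y) : Prop :=
  IsMorphism X Y e ∧ IsMorphism Y X e.symm

/-! ### Constructions -/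

/-- The topology generated by the nonvanishing loci of the functions `a ∈ A i` inside `U i`. -/
@[reducible] def genTop {T I : Type} (U : I → Set T) (A : I → Subalgebra ℂ (T → ℂ)) : TopologicalSpace T :=
  TopologicalSpace.generateFrom {W | ∃ i, ∃ a ∈ A i, W = {x | x ∈ U i ∧ a x ≠ 0}}

theorem genTop_mem {T I : Type} {U : I → Set T} {A : I → Subalgebra ℂ (T → ℂ)} {i : I}
    {a : T → ℂ} (ha : a ∈ A i) {x : T} (hx : x ∈ U i) (hax : a x ≠ 0) :
    ∀ᶠ y in @nhds T (genTop U A) x, y ∈ U i ∧ a y ≠ 0 := by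
  let _ := genTop U A
  exact IsOpen.mem_nhds (TopologicalSpace.isOpen_generateFrom_of_mem ⟨i, a, ha, rfl⟩) ⟨hx, hax⟩

/-- Given sets `U i` covering `T`, stable under intersection, and compatible algebras `A i` of
functions (to be looked at on `U i`), the space whose basic open sets are the nonvanishing loci of
`a ∈ A i` in `U i`, and whose regular functions are locally of the form `a / b` on some `U i`,
with `a b ∈ A i`. -/
def generate {T I : Type} (U : I → Set T) (A : I → Subalgebra ℂ (T → ℂ))
    (cover : ∀ x, ∃ i, x ∈ U i)
    (inter : ∀ i j, ∃ k, U k = U i ∩ U j ∧ A i ≤ A k ∧ A j ≤ A k) : FunSpace where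
  carrier := T
  top := genTop U A
  RegAt f x := ∃ i, x ∈ U i ∧ ∃ a ∈ A i, ∃ b ∈ A i, b x ≠ 0 ∧
    ∀ᶠ y in @nhds T (genTop U A) x, f y = a y / b y
  congr := by
    rintro f g x h ⟨i, hx, a, ha, b, hb, hbx, hf⟩
    refine ⟨i, hx, a, ha, b, hb, hbx, ?_⟩
    filter_upwards [h, hf] with y h1 h2
    rw [← h1, h2]
  spread := by
    rintro f x ⟨i, hx, a, ha, b, hb, hbx, hf⟩
    filter_upwards [genTop_mem hb hx hbx, (@eventually_eventually_nhds T (genTop U A) x _).2 hf]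
      with y h1 h2
    exact ⟨i, h1.1, a, ha, b, hb, h1.2, h2⟩
  const := by
    intro c x
    obtain ⟨i, hi⟩ := cover x
    refine ⟨i, hi, fun _ => c, (A i).algebraMap_mem c, 1, (A i).one_mem, by simp, ?_⟩
    simp
  add := by
    rintro f g x ⟨i, hx, a, ha, b, hb, hbx, hf⟩ ⟨j, hx', a', ha', b', hb', hbx', hg⟩
    obtain ⟨k, hk, hik, hjk⟩ := inter i j
    refine ⟨k, by rw [hk]; exact ⟨hx, hx'⟩, a * b' + a' * b,
      (A k).add_mem ((A k).mul_mem (hik ha) (hjk hb')) ((A k).mul_mem (hjk ha') (hik hb)),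
      b * b', (A k).mul_mem (hik hb) (hjk hb'), mul_ne_zero hbx hbx', ?_⟩
    filter_upwards [hf, hg, genTop_mem hb hx hbx, genTop_mem hb' hx' hbx'] with y h1 h2 h3 h4
    have h3 := h3.2
    have h4 := h4.2
    simp only [Pi.add_apply, Pi.mul_apply, h1, h2]
    field_simp
  mul := by
    rintro f g x ⟨i, hx, a, ha, b, hb, hbx, hf⟩ ⟨j, hx', a', ha', b', hb', hbx', hg⟩
    obtain ⟨k, hk, hik, hjk⟩ := inter i j
    refine ⟨k, by rw [hk]; exact ⟨hx, hx'⟩, a * a', (A k).mul_mem (hik ha) (hjk ha'),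
      b * b', (A k).mul_mem (hik hb) (hjk hb'), mul_ne_zero hbx hbx', ?_⟩
    filter_upwards [hf, hg] with y h1 h2
    simp only [Pi.mul_apply, h1, h2]
    rw [div_mul_div_comm]
  ne_zero := by
    rintro f x ⟨i, hx, a, ha, b, hb, hbx, hf⟩ hfx
    have hax : a x ≠ 0 := by
      intro h
      apply hfx
      rw [@Eventually.self_of_nhds T (genTop U A) x _ hf, h, zero_div]
    filter_upwards [hf, genTop_mem hb hx hbx, genTop_mem ha hx hax] with y h1 h2 h3
    rw [h1]
    exact div_ne_zero h3.2 h2.2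
  inv := by
    rintro f x ⟨i, hx, a, ha, b, hb, hbx, hf⟩ hfx
    have hax : a x ≠ 0 := by
      intro h
      apply hfx
      rw [@Eventually.self_of_nhds T (genTop U A) x _ hf, h, zero_div]
    refine ⟨i, hx, b, hb, a, ha, hax, ?_⟩
    filter_upwards [hf] with y h1
    rw [h1, inv_div]

/-- A finite dimensional complex vector space as an affine variety: polynomial functions are the
algebra generated by the linear functionals, the topology is the Zariski topology, and regular
functions are locally quotients of polynomial functions. -/
def vectorSpace (W : Type) [AddCommGroup W] [Module ℂ W] : FunSpace :=
  generate (T := W) (I := Unit) (fun _ => Set.univ)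
    (fun _ => Algebra.adjoin ℂ {f : W → ℂ | ∃ l : Module.Dual ℂ W, f = fun w => l w})
    (fun _ => ⟨(), trivial⟩) (fun _ _ => ⟨(), by simp, le_rfl, le_rfl⟩)

/-- The functions `∑ i, f i (x) * g i (y)` on `X × Y`, where the `f i` are regular on `U` and the
`g i` are regular on `V`. -/
def prodAlgebra (X Y : FunSpace) (U : Set X) (V : Set Y) :
    Subalgebra ℂ (X.carrier × Y.carrier → ℂ) :=
  Algebra.adjoin ℂ
    ({h | ∃ f : X → ℂ, (∀ x ∈ U, X.RegAt f x) ∧ h = fun z => f z.1} ∪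
     {h | ∃ g : Y → ℂ, (∀ y ∈ V, Y.RegAt g y) ∧ h = fun z => g z.2})

theorem prodAlgebra_mono (X Y : FunSpace) {U U' : Set X} {V V' : Set Y} (hU : U' ⊆ U)
    (hV : V' ⊆ V) : prodAlgebra X Y U V ≤ prodAlgebra X Y U' V' := by
  apply Algebra.adjoin_mono
  rintro h (⟨f, hf, rfl⟩ | ⟨g, hg, rfl⟩)
  · exact Or.inl ⟨f, fun x hx => hf x (hU hx), rfl⟩
  · exact Or.inr ⟨g, fun y hy => hg y (hV hy), rfl⟩

/-- The product of two spaces with functions.  Its topology is the Zariski topology of the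
product, which is finer than the product topology. -/
def prod (X Y : FunSpace) : FunSpace :=
  generate (T := X.carrier × Y.carrier) (I := {U : Set X // IsOpen U} × {V : Set Y // IsOpen V})
    (fun i => {z | z.1 ∈ i.1.1 ∧ z.2 ∈ i.2.1})
    (fun i => prodAlgebra X Y i.1.1 i.2.1)
    (fun _ => ⟨(⟨Set.univ, isOpen_univ⟩, ⟨Set.univ, isOpen_univ⟩), trivial, trivial⟩)
    (fun i j => ⟨(⟨i.1.1 ∩ j.1.1, i.1.2.inter j.1.2⟩, ⟨i.2.1 ∩ j.2.1, i.2.2.inter j.2.2⟩), by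
      ext z
      simp only [Set.mem_inter_iff, Set.mem_ofPred_eq]
      tauto, prodAlgebra_mono X Y Set.inter_subset_left Set.inter_subset_left,
      prodAlgebra_mono X Y Set.inter_subset_right Set.inter_subset_right⟩)

/-- A subset with its induced structure: the subspace topology, and the functions that locally
extend to regular functions on the ambient space.  For a locally closed subset of a variety this
is the reduced subvariety structure. -/
def sub (X : FunSpace) (S : Set X) : FunSpace where
  carrier := S
  top := TopologicalSpace.induced Subtype.val X.top
  RegAt f x := ∃ g : X → ℂ, X.RegAt g x.1 ∧
    ∀ᶠ y in @nhds S (TopologicalSpace.induced Subtype.val X.top) x, f y = g y.1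
  congr := by
    rintro f g x h ⟨k, hk, hf⟩
    refine ⟨k, hk, ?_⟩
    filter_upwards [h, hf] with y h1 h2
    rw [← h1, h2]
  spread := by
    rintro f x ⟨k, hk, hf⟩
    have h1 : ∀ᶠ y : S in 𝓝 x, X.RegAt k y.1 :=
      continuous_subtype_val.continuousAt.eventually (X.spread hk)
    filter_upwards [h1, eventually_eventually_nhds.2 hf] with y h2 h3
    exact ⟨k, h2, h3⟩
  const c x := ⟨fun _ => c, X.const c x.1, by simp⟩
  add := by
    rintro f g x ⟨k, hk, hf⟩ ⟨l, hl, hg⟩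
    refine ⟨_, X.add hk hl, ?_⟩
    filter_upwards [hf, hg] with y h1 h2
    rw [h1, h2]
  mul := by
    rintro f g x ⟨k, hk, hf⟩ ⟨l, hl, hg⟩
    refine ⟨_, X.mul hk hl, ?_⟩
    filter_upwards [hf, hg] with y h1 h2
    rw [h1, h2]
  ne_zero := by
    rintro f x ⟨k, hk, hf⟩ hfx
    have hkx : k x.1 ≠ 0 := by rwa [← hf.self_of_nhds]
    have h1 : ∀ᶠ y : S in 𝓝 x, k y.1 ≠ 0 :=
      continuous_subtype_val.continuousAt.eventually (X.ne_zero hk hkx)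
    filter_upwards [h1, hf] with y h2 h3
    rwa [h3]
  inv := by
    rintro f x ⟨k, hk, hf⟩ hfx
    have hkx : k x.1 ≠ 0 := by rwa [← hf.self_of_nhds]
    refine ⟨_, X.inv hk hkx, ?_⟩
    filter_upwards [hf] with y h1
    rw [h1]

/-- The quotient topology on `T` defined by the maps `π i : P i → T`. -/
@[reducible] def finalTop {T I : Type} (P : I → FunSpace) (π : ∀ i, P i → T) : TopologicalSpace T :=
  ⨆ i, TopologicalSpace.coinduced (π i) (P i).top

theorem finalTop_continuous {T I : Type} (P : I → FunSpace) (π : ∀ i, P i → T) (i : I) :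
    @Continuous _ _ (P i).top (finalTop P π) (π i) :=
  continuous_iff_coinduced_le.2 (le_iSup (fun i => TopologicalSpace.coinduced (π i) (P i).top) i)

/-- The quotient structure on `T` defined by maps `π i : P i → T` from spaces with functions:
a set is open if and only if all its preimages are open, and a function on an open set is regular
if and only if all its pullbacks are regular. -/
def final (T : Type) {I : Type} (P : I → FunSpace) (π : ∀ i, P i → T) : FunSpace where
  carrier := T
  top := finalTop P π
  RegAt f t := ∃ O : Set T, IsOpen[finalTop P π] O ∧ t ∈ O ∧
    ∀ (i : I) (q : P i), π i q ∈ O → (P i).RegAt (fun r => f (π i r)) q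
  congr := by
    rintro f g x h ⟨O, hO, hx, hf⟩
    let _ := finalTop P π
    obtain ⟨O', h1, h2, h3⟩ := eventually_nhds_iff.1 h
    refine ⟨O ∩ O', hO.inter h2, ⟨hx, h3⟩, fun i q hq => (P i).congr ?_ (hf i q hq.1)⟩
    exact (finalTop_continuous P π i).continuousAt.eventually
      (eventually_nhds_iff.2 ⟨O', h1, h2, hq.2⟩)
  spread := by
    rintro f x ⟨O, hO, hx, hf⟩
    let _ := finalTop P π
    filter_upwards [hO.mem_nhds hx] with y hy
    exact ⟨O, hO, hy, hf⟩
  const c x := ⟨Set.univ, @isOpen_univ _ (finalTop P π), trivial, fun i q _ => (P i).const c q⟩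
  add := by
    rintro f g x ⟨O, hO, hx, hf⟩ ⟨O', hO', hx', hg⟩
    let _ := finalTop P π
    exact ⟨O ∩ O', hO.inter hO', ⟨hx, hx'⟩,
      fun i q hq => (P i).add (hf i q hq.1) (hg i q hq.2)⟩
  mul := by
    rintro f g x ⟨O, hO, hx, hf⟩ ⟨O', hO', hx', hg⟩
    let _ := finalTop P π
    exact ⟨O ∩ O', hO.inter hO', ⟨hx, hx'⟩,
      fun i q hq => (P i).mul (hf i q hq.1) (hg i q hq.2)⟩
  ne_zero := by
    rintro f x ⟨O, hO, hx, hf⟩ hfx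
    let _ := finalTop P π
    have key : IsOpen (O ∩ {y | f y ≠ 0}) := by
      refine isOpen_iSup_iff.2 fun i => isOpen_coinduced.2 (isOpen_iff_mem_nhds.2 ?_)
      intro q hq
      filter_upwards [(P i).ne_zero (hf i q hq.1) hq.2,
        (hO.preimage (finalTop_continuous P π i)).mem_nhds hq.1] with r h1 h2
      exact ⟨h2, h1⟩
    filter_upwards [key.mem_nhds ⟨hx, hfx⟩] with y hy
    exact hy.2
  inv := by
    rintro f x ⟨O, hO, hx, hf⟩ hfx
    let _ := finalTop P π
    have key : IsOpen (O ∩ {y | f y ≠ 0}) := by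
      refine isOpen_iSup_iff.2 fun i => isOpen_coinduced.2 (isOpen_iff_mem_nhds.2 ?_)
      intro q hq
      filter_upwards [(P i).ne_zero (hf i q hq.1) hq.2,
        (hO.preimage (finalTop_continuous P π i)).mem_nhds hq.1] with r h1 h2
      exact ⟨h2, h1⟩
    exact ⟨_, key, ⟨hx, hfx⟩, fun i q hq => (P i).inv (hf i q hq.1) hq.2⟩

/-! ### Varieties, smoothness, resolutions -/

/-- Affine varieties: the spaces isomorphic to a Zariski closed subset of some `ℂ ^ N`. -/
def IsAffineVariety (X : FunSpace) : Prop :=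
  ∃ (N : ℕ) (S : Set (vectorSpace (Fin N → ℂ))), IsClosed S ∧
    ∃ e : X ≃ (vectorSpace (Fin N → ℂ)).sub S, IsIso e

/-- Complex algebraic varieties (not necessarily irreducible): quasi-compact, locally affine, and
separated. -/
def IsVariety (X : FunSpace) : Prop :=
  CompactSpace X ∧
  (∀ x : X, ∃ U : Set X, IsOpen U ∧ x ∈ U ∧ IsAffineVariety (X.sub U)) ∧
  IsClosed (X := X.prod X) {z : X.carrier × X.carrier | z.1 = z.2}

/-- The local ring of `X` at `x`: germs at `x` of regular functions. -/
def localRing (X : FunSpace) (x : X) : Subring (Germ (𝓝 x) ℂ) where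
  carrier := {φ | ∃ f : X → ℂ, X.RegAt f x ∧ φ = (f : Germ (𝓝 x) ℂ)}
  mul_mem' := by
    rintro _ _ ⟨f, hf, rfl⟩ ⟨g, hg, rfl⟩
    exact ⟨_, X.mul hf hg, rfl⟩
  one_mem' := ⟨_, X.const 1 x, rfl⟩
  add_mem' := by
    rintro _ _ ⟨f, hf, rfl⟩ ⟨g, hg, rfl⟩
    exact ⟨_, X.add hf hg, rfl⟩
  zero_mem' := ⟨_, X.const 0 x, rfl⟩
  neg_mem' := by
    rintro _ ⟨f, hf, rfl⟩
    refine ⟨_, X.mul (X.const (-1) x) hf, ?_⟩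
    rw [← Germ.coe_neg]
    congr 1
    funext y
    simp

/-- Smoothness: every local ring is a regular local ring. -/
def IsSmooth (X : FunSpace) : Prop :=
  ∀ x : X, IsRegularLocalRing (X.localRing x)

/-- The classical (Euclidean) topology: the coarsest topology in which Zariski open sets are open
and regular functions on them are continuous. -/
@[reducible] def classicalTop (X : FunSpace) : TopologicalSpace X :=
  TopologicalSpace.generateFrom {W | ∃ (U : Set X) (f : X → ℂ) (B : Set ℂ),
    IsOpen U ∧ (∀ x ∈ U, X.RegAt f x) ∧ IsOpen B ∧ W = {x | x ∈ U ∧ f x ∈ B}}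

/-- Proper maps of complex varieties: proper for the classical topologies. -/
def IsProper (X Y : FunSpace) (φ : X → Y) : Prop :=
  @IsProperMap X Y X.classicalTop Y.classicalTop φ

/-- `φ` restricts to an isomorphism of varieties from `φ⁻¹ U` to `U`. -/
def IsIsoOver (X Y : FunSpace) (φ : X → Y) (U : Set Y) : Prop :=
  ∃ e : X.sub (φ ⁻¹' U) ≃ Y.sub U, IsIso e ∧
    ∀ (x : X) (hx : x ∈ φ ⁻¹' U), Subtype.val (p := (· ∈ U)) (e ⟨x, hx⟩) = φ x

/-- `φ` is birational: it is an isomorphism over some dense open set whose preimage is dense. -/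
def IsBirational (X Y : FunSpace) (φ : X → Y) : Prop :=
  ∃ U : Set Y, IsOpen U ∧ Dense U ∧ Dense (φ ⁻¹' U) ∧ IsIsoOver X Y φ U

/-- Resolutions of singularities: proper birational morphisms from smooth varieties. -/
structure IsResolution (X Y : FunSpace) (φ : X → Y) : Prop where
  source : IsVariety X
  target : IsVariety Y
  smooth : IsSmooth X
  morphism : IsMorphism X Y φ
  proper : IsProper X Y φ
  birational : IsBirational X Y φ

/-! ### Tensor products of vector bundles

The vector bundles below are given as families of subspaces `E x ⊆ W`, that is, as subbundles
`{(w, x) | w ∈ E x}` of the trivial bundle `W × X`. -/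

/-- A regular local frame of the bundle `E`: a family of bases of the spaces `E x`, for `x` in an
open set, whose members are regular sections. -/
structure LocalFrame (X : FunSpace) {W : Type} [AddCommGroup W] [Module ℂ W]
    (E : X → Submodule ℂ W) where
  dom : Set X
  isOpen_dom : IsOpen dom
  rank : ℕ
  basis : ∀ x : dom, Module.Basis (Fin rank) ℂ (E x)
  regular : ∀ i : Fin rank,
    IsMorphism (X.sub dom) (vectorSpace W) (fun x : dom => (basis x i : W))

/-- The points of the total space of `E ⊗ E'`. -/
def TensorPoint {X : FunSpace} {W W' : Type} [AddCommGroup W] [Module ℂ W] [AddCommGroup W']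
    [Module ℂ W'] (E : X → Submodule ℂ W) (E' : X → Submodule ℂ W') : Type :=
  Σ x : X, (E x) ⊗[ℂ] (E' x)

/-- The map `(x, c) ↦ ∑ i j, c i j • (e i x ⊗ e' j x)` attached to local frames `e` of `E` and `e'`
of `E'`, where `x` runs over the common domain of the frames. -/
def tensorChart {X : FunSpace} {W W' : Type} [AddCommGroup W] [Module ℂ W] [AddCommGroup W']
    [Module ℂ W'] {E : X → Submodule ℂ W} {E' : X → Submodule ℂ W'}
    (e : LocalFrame X E) (e' : LocalFrame X E')
    (z : ↥(e.dom ∩ e'.dom) × (Fin e.rank × Fin e'.rank → ℂ)) : TensorPoint E E' :=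
  ⟨z.1.1, ∑ i : Fin e.rank, ∑ j : Fin e'.rank,
    z.2 (i, j) • (e.basis ⟨z.1.1, z.1.2.1⟩ i ⊗ₜ[ℂ] e'.basis ⟨z.1.1, z.1.2.2⟩ j)⟩

/-- The total space of the tensor product of the vector bundles `E` and `E'` over `X`.  Its
structure of variety is the one for which all `tensorChart`s are local trivializations. -/
def tensorBundle {X : FunSpace} {W W' : Type} [AddCommGroup W] [Module ℂ W] [AddCommGroup W']
    [Module ℂ W'] (E : X → Submodule ℂ W) (E' : X → Submodule ℂ W') : FunSpace :=
  final (TensorPoint E E') (I := LocalFrame X E × LocalFrame X E')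
    (fun i => (X.sub (i.1.dom ∩ i.2.dom)).prod (vectorSpace (Fin i.1.rank × Fin i.2.rank → ℂ)))
    (fun i => tensorChart i.1 i.2)

end FunSpace

/-! ### Flags in `V = ℂ ^ n` -/

namespace TwoColumn

open FunSpace

/-- The space `gl(V)` of complex `n × n` matrices. -/
def matrixSpace (n : ℕ) : FunSpace := vectorSpace (Matrix (Fin n) (Fin n) ℂ)

/-- The general linear group, as an open subvariety of the space of matrices. -/
def generalLinear (n : ℕ) : FunSpace :=
  (matrixSpace n).sub {A : Matrix (Fin n) (Fin n) ℂ | IsUnit A.det}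

/-- The span of the first `k` columns of a matrix. -/
def colSpan {n : ℕ} (A : Matrix (Fin n) (Fin n) ℂ) (k : ℕ) : Submodule ℂ (Fin n → ℂ) :=
  Submodule.span ℂ (A.col '' {j : Fin n | j.val < k})

theorem colSpan_mono {n : ℕ} (A : Matrix (Fin n) (Fin n) ℂ) {k l : ℕ} (h : k ≤ l) :
    colSpan A k ≤ colSpan A l :=
  Submodule.span_mono (Set.image_mono fun _ hj => lt_of_lt_of_le hj h)

theorem finrank_colSpan {n : ℕ} {A : Matrix (Fin n) (Fin n) ℂ} (hA : IsUnit A.det) {k : ℕ}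
    (h : k ≤ n) : Module.finrank ℂ (colSpan A k) = k := by
  have hli : LinearIndependent ℂ A.col :=
    Matrix.linearIndependent_cols_iff_isUnit.2 ((Matrix.isUnit_iff_isUnit_det A).2 hA)
  have h2 : LinearIndepOn ℂ A.col {j : Fin n | j.val < k} := hli.linearIndepOn _
  have h3 := finrank_span_eq_card h2
  rw [colSpan, Set.image_eq_range]
  refine h3.trans ?_
  rw [Fintype.card_subtype]
  exact (Fin.card_filter_val_lt).trans (min_eq_right h)

/-- Points of `F(a, b, V)`: pairs `U₁ ⊆ U₂` of subspaces with `dim U₁ = a`, `dim U₂ = b`. -/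
structure Flag (n a b : ℕ) where
  U₁ : Submodule ℂ (Fin n → ℂ)
  U₂ : Submodule ℂ (Fin n → ℂ)
  le : U₁ ≤ U₂
  dim₁ : Module.finrank ℂ U₁ = a
  dim₂ : Module.finrank ℂ U₂ = b

/-- The flag spanned by the first `a`, respectively `b`, columns of an invertible matrix. -/
def flagOf {n a b : ℕ} (hab : a ≤ b) (hbn : b ≤ n)
    (A : {A : Matrix (Fin n) (Fin n) ℂ | IsUnit A.det}) : Flag n a b where
  U₁ := colSpan A.1 a
  U₂ := colSpan A.1 b
  le := colSpan_mono _ hab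
  dim₁ := finrank_colSpan A.2 (hab.trans hbn)
  dim₂ := finrank_colSpan A.2 hbn

/-- The generalized flag variety `F(a, b, V)`, as a quotient of `GL(V)` by a parabolic subgroup. -/
def flagVariety {n a b : ℕ} (hab : a ≤ b) (hbn : b ≤ n) : FunSpace :=
  final (Flag n a b) (I := Unit) (fun _ => generalLinear n) (fun _ => flagOf hab hbn)

/-- Points of the grassmannian `Gr(k, V)`: subspaces of dimension `k`. -/
structure GrPoint (n k : ℕ) where
  U : Submodule ℂ (Fin n → ℂ)
  dim : Module.finrank ℂ U = k

/-- The subspace spanned by the first `k` columns of an invertible matrix. -/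
def grOf {n k : ℕ} (hk : k ≤ n) (A : {A : Matrix (Fin n) (Fin n) ℂ | IsUnit A.det}) :
    GrPoint n k where
  U := colSpan A.1 k
  dim := finrank_colSpan A.2 hk

/-- The grassmannian `Gr(k, V)`, as a quotient of `GL(V)` by a parabolic subgroup. -/
def grassmannian {n k : ℕ} (hk : k ≤ n) : FunSpace :=
  final (GrPoint n k) (I := Unit) (fun _ => generalLinear n) (fun _ => grOf hk)

/-! ### The orbit closure and its resolutions -/

/-- The matrices of square zero and rank at most `m`. -/
def orbitClosureSet (n m : ℕ) : Set (Matrix (Fin n) (Fin n) ℂ) := {g | g * g = 0 ∧ g.rank ≤ m}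

/-- The closure of the conjugacy class of nilpotent matrices of type `(2 ^ m, 1 ^ (n - 2 m))`. -/
def orbitClosure (n m : ℕ) : FunSpace := (matrixSpace n).sub (orbitClosureSet n m)

/-- The image of a matrix acting on column vectors. -/
abbrev im {n : ℕ} (g : Matrix (Fin n) (Fin n) ℂ) : Submodule ℂ (Fin n → ℂ) :=
  LinearMap.range g.mulVecLin

/-- The kernel of a matrix acting on column vectors. -/
abbrev ker {n : ℕ} (g : Matrix (Fin n) (Fin n) ℂ) : Submodule ℂ (Fin n → ℂ) :=
  LinearMap.ker g.mulVecLin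

section flags

variable {n m : ℕ} (h : 2 * m ≤ n)

/-- The flag variety `F(m, n - m, V)`. -/
def flagBase : FunSpace :=
  flagVariety (n := n) (a := m) (b := n - m) (by omega) (Nat.sub_le n m)

/-- The triples `(g, U₁, U₂)` with `im g ⊆ U₁ ⊆ U₂ ⊆ ker g`. -/
def tripleSet (n m : ℕ) : Set (orbitClosureSet n m × Flag n m (n - m)) :=
  {z | im z.1.1 ≤ z.2.U₁ ∧ z.2.U₂ ≤ ker z.1.1}

/-- The variety of triples, as a subvariety of the product of the orbit closure with the flag
variety. -/
def tripleVariety : FunSpace := ((orbitClosure n m).prod (flagBase h)).sub (tripleSet n m)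

/-- The projection `p (g, U₁, U₂) = g`. -/
def tripleProj : tripleVariety h → orbitClosure n m := fun z : tripleSet n m => z.1.1

/-- The projection `(g, U₁, U₂) ↦ (U₁, U₂)`. -/
def tripleToFlag : tripleVariety h → flagBase h := fun z : tripleSet n m => z.1.2

/-- The matrix `g` of a triple `(g, U₁, U₂)`. -/
def tripleMatrix : tripleVariety h → Matrix (Fin n) (Fin n) ℂ := fun z : tripleSet n m => z.1.1.1

/-- The tautological bundle, with fibre `U₁ ⊆ V`. -/
def taut : flagBase h → Submodule ℂ (Fin n → ℂ) := fun x : Flag n m (n - m) => x.U₁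

/-- The dual quotient bundle, with fibre `(V / U₂)^* ⊆ V^*`, the functionals vanishing on `U₂`. -/
def dualQuot : flagBase h → Submodule ℂ (Module.Dual ℂ (Fin n → ℂ)) :=
  fun x : Flag n m (n - m) => x.U₂.dualAnnihilator

end flags

section cotangent

variable {n : ℕ} (m : ℕ) {k : ℕ} (hk : k ≤ n)

/-- The pairs `(g, U)` with `im g ⊆ U ⊆ ker g`. -/
def pairSet (n m k : ℕ) : Set (orbitClosureSet n m × GrPoint n k) :=
  {z | im z.1.1 ≤ z.2.U ∧ z.2.U ≤ ker z.1.1}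

/-- The variety of pairs `(g, U)` with `im g ⊆ U ⊆ ker g` and `U ∈ Gr(k, V)`.  For `k = m` and for
`k = n - m` its fibre over `U` is `Hom(V / U, U)`, the cotangent space of the grassmannian at `U`,
and it is the cotangent bundle of `Gr(k, V)`. -/
def cotangentVariety : FunSpace := ((orbitClosure n m).prod (grassmannian hk)).sub (pairSet n m k)

/-- The projection `(g, U) ↦ g`. -/
def cotangentProj : cotangentVariety m hk → orbitClosure n m := fun z : pairSet n m k => z.1.1

end cotangent

end TwoColumn

end

/-! The idea is to trade flags for frames. Every flag `U₁ ⊆ U₂` is spanned by initial columns of an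
invertible matrix `A` (`exists_colSpan_eq`). Conjugation by `A` turns `im g ⊆ U₁ ⊆ U₂ ⊆ ker g` into
the linear condition that `A⁻¹ * g * A` lives in the upper right block (`fibreSpace`). Subspaces
thus become matrix identities in the idempotents `proj n k`. A map to the flag variety is regular as
soon as it lifts locally to regular invertible matrices.

Smoothness: on the cell of flags transversal to a fixed opposite flag, the quotient map from the
general linear group has a rational section, `cellSection`. The triples over this cell form a copy
of the vector space `cellSpace × fibreSpace` (`tripleChart`). Local rings are therefore
localizations of polynomial rings (`isRegularLocalRing_of_chart`).

Properness: by Gram–Schmidt, unitary frames suffice, so the triples are the image of a closed subset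
of (compact group) × (matrices), whose projection to matrices is proper.

Birationality: when `g` has rank `m`, dimensions force `U₁ = im g` and `U₂ = ker g`. The inverse `g
↦ (g, im g, ker g)` is regular because a generalized inverse of a block of `g` produces a frame
(`morphAt_flagOfMatrix`). Every triple lies on an affine line in its fibre that meets the rank `m`
locus, so that locus is dense.

Tensor bundle: the isomorphism is the contraction `U₁ ⊗ (V / U₂)^* ⊆ V ⊗ V^* ≅ End V`. In the frames
coming from `cellSection` its coordinates are the entries of the upper right block (`contract_sum`).

Comparison with cotangent bundles: over matrices of rank `m`, a morphism over the orbit closure must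
send `(g, U₁, U₂)` to `(g, U₁)` or to `(g, U₂)`, according to `k`. Points of the grassmannian are
closed and lines are irreducible, so the same holds over `g = 0` (`cotangent_subspace_eq`). There
the other subspace can still vary, which contradicts injectivity. -/

noncomputable section

namespace FunSpace

/-! ### Regular functions -/

section regular

variable {X : FunSpace} {x : X}

theorem RegAt.neg {f : X → ℂ} (hf : X.RegAt f x) : X.RegAt (fun y => -f y) x := by
  refine X.congr (.of_forall fun y => ?_) (X.mul (X.const (-1) x) hf)
  simp

theorem RegAt.sub {f g : X → ℂ} (hf : X.RegAt f x) (hg : X.RegAt g x) :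
    X.RegAt (fun y => f y - g y) x := by
  refine X.congr (.of_forall fun y => ?_) (X.add hf (RegAt.neg hg))
  ring

theorem regAt_sum {ι : Type*} (s : Finset ι) {f : ι → X → ℂ} (hf : ∀ i ∈ s, X.RegAt (f i) x) :
    X.RegAt (fun y => ∑ i ∈ s, f i y) x := by
  classical
  induction s using Finset.induction_on with
  | empty => simpa using X.const 0 x
  | insert a s ha ih =>
    simp only [Finset.sum_insert ha]
    exact X.add (hf _ (Finset.mem_insert_self _ _))
      (ih fun i hi => hf i (Finset.mem_insert_of_mem hi))

theorem regAt_prod {ι : Type*} (s : Finset ι) {f : ι → X → ℂ} (hf : ∀ i ∈ s, X.RegAt (f i) x) :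
    X.RegAt (fun y => ∏ i ∈ s, f i y) x := by
  classical
  induction s using Finset.induction_on with
  | empty => simpa using X.const 1 x
  | insert a s ha ih =>
    simp only [Finset.prod_insert ha]
    exact X.mul (hf _ (Finset.mem_insert_self _ _))
      (ih fun i hi => hf i (Finset.mem_insert_of_mem hi))

/-- Every function in the algebra generated by regular functions is regular. -/
theorem regAt_of_mem_adjoin {T : Type} {s : Set (T → ℂ)} {φ : X → T}
    (hs : ∀ f ∈ s, X.RegAt (fun y => f (φ y)) x) {a : T → ℂ} (ha : a ∈ Algebra.adjoin ℂ s) :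
    X.RegAt (fun y => a (φ y)) x := by
  induction ha using Algebra.adjoin_induction with
  | mem f hf => exact hs f hf
  | algebraMap r => exact X.const r x
  | add f g _ _ hf hg => exact X.add hf hg
  | mul f g _ _ hf hg => exact X.mul hf hg

end regular

/-! ### Morphisms at a point -/

/-- The map `φ` is a morphism near the point `x`. -/
def MorphAt (X Y : FunSpace) (φ : X → Y) (x : X) : Prop :=
  ContinuousAt φ x ∧ ∀ f : Y → ℂ, Y.RegAt f (φ x) → X.RegAt (fun y => f (φ y)) x

theorem isMorphism_iff {X Y : FunSpace} {φ : X → Y} :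
    IsMorphism X Y φ ↔ ∀ x, MorphAt X Y φ x :=
  ⟨fun h x => ⟨h.1.continuousAt, fun f hf => h.2 f x hf⟩,
    fun h => ⟨continuous_iff_continuousAt.2 fun x => (h x).1, fun f x hf => (h x).2 f hf⟩⟩

theorem IsMorphism.morphAt {X Y : FunSpace} {φ : X → Y} (h : IsMorphism X Y φ) (x : X) :
    MorphAt X Y φ x := isMorphism_iff.1 h x

theorem MorphAt.id {X : FunSpace} {x : X} : MorphAt X X (fun y => y) x :=
  ⟨continuousAt_id, fun _ h => h⟩

theorem MorphAt.comp {X Y Z : FunSpace} {φ : X → Y} {ψ : Y → Z} {x : X}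
    (hψ : MorphAt Y Z ψ (φ x)) (hφ : MorphAt X Y φ x) : MorphAt X Z (fun y => ψ (φ y)) x :=
  ⟨ContinuousAt.comp (g := ψ) hψ.1 hφ.1, fun f hf => hφ.2 _ (hψ.2 f hf)⟩

theorem MorphAt.congr {X Y : FunSpace} {φ ψ : X → Y} {x : X} (h : MorphAt X Y φ x)
    (e : ∀ᶠ y in 𝓝 x, φ y = ψ y) : MorphAt X Y ψ x := by
  refine ⟨h.1.congr e, fun f hf => X.congr ?_ (h.2 f (by rwa [e.self_of_nhds]))⟩
  filter_upwards [e] with y hy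
  rw [hy]

theorem IsMorphism.comp {X Y Z : FunSpace} {φ : X → Y} {ψ : Y → Z}
    (hψ : IsMorphism Y Z ψ) (hφ : IsMorphism X Y φ) : IsMorphism X Z (fun y => ψ (φ y)) :=
  isMorphism_iff.2 fun x => (hψ.morphAt _).comp (hφ.morphAt x)

theorem IsIso.trans {X Y Z : FunSpace} {e : X ≃ Y} {e' : Y ≃ Z} (h : IsIso e) (h' : IsIso e') :
    IsIso (e.trans e') := ⟨h'.1.comp h.1, h.2.comp h'.2⟩

theorem IsIso.symm {X Y : FunSpace} {e : X ≃ Y} (h : IsIso e) : IsIso e.symm := ⟨h.2, h.1⟩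

/-! ### Subspaces -/

theorem isMorphism_val (X : FunSpace) (S : Set X) :
    IsMorphism (X.sub S) X (fun y : S => y.1) :=
  ⟨continuous_subtype_val, fun f _ hf => ⟨f, hf, .of_forall fun _ => rfl⟩⟩

theorem morphAt_sub_iff {X Y : FunSpace} {S : Set Y} {φ : X → S} {x : X} :
    MorphAt X (Y.sub S) φ x ↔ MorphAt X Y (fun y => (φ y).1) x := by
  refine ⟨fun h => ((isMorphism_val Y S).morphAt _).comp h, fun h => ?_⟩
  have hc : ContinuousAt (Y := Y.sub S) φ x :=
    (Topology.IsInducing.continuousAt_iff (f := φ) (g := fun z : S => z.1) ⟨rfl⟩).2 h.1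
  refine ⟨hc, ?_⟩
  rintro f ⟨g, hg, hfg⟩
  refine X.congr ?_ (h.2 g hg)
  filter_upwards [hc.eventually hfg] with y hy
  rw [hy]

theorem isMorphism_sub_iff {X Y : FunSpace} {S : Set Y} {φ : X → S} :
    IsMorphism X (Y.sub S) φ ↔ IsMorphism X Y (fun y => (φ y).1) := by
  exact isMorphism_iff.trans ((forall_congr' fun x => morphAt_sub_iff).trans isMorphism_iff.symm)

/-- Being a morphism near a point may be tested on a neighbourhood. -/
theorem morphAt_of_sub {X Y : FunSpace} {U : Set X} (hU : IsOpen U) {φ : X → Y} {x : X}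
    (hx : x ∈ U) (h : MorphAt (X.sub U) Y (fun y : U => φ y.1) (⟨x, hx⟩ : U)) :
    MorphAt X Y φ x := by
  have hmap : Filter.map (Subtype.val : U → X) (𝓝 (⟨x, hx⟩ : U)) = 𝓝 x :=
    hU.isOpenEmbedding_subtypeVal.map_nhds_eq _
  refine ⟨?_, fun f hf => ?_⟩
  · have := h.1
    rw [ContinuousAt, ← hmap, tendsto_map'_iff]
    exact this
  · obtain ⟨g, hg, hfg⟩ := h.2 f hf
    refine X.congr ?_ hg
    rw [← hmap, eventually_map]
    filter_upwards [hfg] with y hy using hy.symm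

theorem regAt_sub_of_regAt {X : FunSpace} {S : Set X} {f : X → ℂ} {x : X.sub S}
    (h : X.RegAt f (x : S).1) : (X.sub S).RegAt (fun y : S => f y.1) x :=
  ⟨f, h, .of_forall fun _ => rfl⟩

theorem morphAt_restrict {X Y : FunSpace} {S : Set X} {φ : X → Y} {x : X.sub S}
    (h : MorphAt X Y φ (x : S).1) : MorphAt (X.sub S) Y (fun y : S => φ y.1) x :=
  MorphAt.comp h ((isMorphism_val X S).morphAt x)

/-! ### Morphisms to generated spaces, products and vector spaces -/

/-- Only the generating algebras need testing: nonvanishing loci pull back to open sets by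
`ne_zero`, and quotients `a / b` pull back by `mul` and `inv`. -/
theorem morphAt_generate {X : FunSpace} {T I : Type} {U : I → Set T}
    {A : I → Subalgebra ℂ (T → ℂ)} {cover : ∀ x, ∃ i, x ∈ U i}
    {inter : ∀ i j, ∃ k, U k = U i ∩ U j ∧ A i ≤ A k ∧ A j ≤ A k}
    {φ : X → generate U A cover inter} {x : X}
    (h : ∀ i, φ x ∈ U i → (∀ᶠ y in 𝓝 x, φ y ∈ U i) ∧
      ∀ a ∈ A i, X.RegAt (fun y => a (φ y)) x) :
    MorphAt X (generate U A cover inter) φ x := by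
  have hc : ContinuousAt φ x := by
    refine TopologicalSpace.tendsto_nhds_generateFrom_iff.2 ?_
    rintro _ ⟨i, a, ha, rfl⟩ hx
    obtain ⟨h1, h2⟩ := h i hx.1
    filter_upwards [h1, X.ne_zero (h2 a ha) hx.2] with y h3 h4 using ⟨h3, h4⟩
  refine ⟨hc, ?_⟩
  rintro f ⟨i, hi, a, ha, b, hb, hbx, hf⟩
  obtain ⟨-, h2⟩ := h i hi
  refine X.congr ?_ (X.mul (h2 a ha) (X.inv (h2 b hb) hbx))
  filter_upwards [hc.eventually hf] with y hy
  rw [hy, div_eq_mul_inv]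

theorem exists_open_regAt {X : FunSpace} {f : X → ℂ} {x : X} (h : X.RegAt f x) :
    ∃ U : Set X, IsOpen U ∧ x ∈ U ∧ ∀ y ∈ U, X.RegAt f y := by
  obtain ⟨U, h1, h2, h3⟩ := eventually_nhds_iff.1 (X.spread h)
  exact ⟨U, h2, h3, h1⟩

theorem regAt_generate {T I : Type} {U : I → Set T}
    {A : I → Subalgebra ℂ (T → ℂ)} {cover : ∀ x, ∃ i, x ∈ U i}
    {inter : ∀ i j, ∃ k, U k = U i ∩ U j ∧ A i ≤ A k ∧ A j ≤ A k} {x : T} {i : I} (hx : x ∈ U i)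
    {a : T → ℂ} (ha : a ∈ A i) : (generate U A cover inter).RegAt a x :=
  ⟨i, hx, a, ha, 1, (A i).one_mem, by simp, by simp⟩

theorem regAt_prod_of_mem {X Y : FunSpace} {U : Set X} {V : Set Y} (hU : IsOpen U)
    (hV : IsOpen V) {a : X.carrier × Y.carrier → ℂ} (ha : a ∈ prodAlgebra X Y U V)
    {z : X.prod Y} (h1 : Prod.fst z ∈ U) (h2 : Prod.snd z ∈ V) : (X.prod Y).RegAt a z :=
  ⟨(⟨U, hU⟩, ⟨V, hV⟩), ⟨h1, h2⟩, a, ha, 1, Subalgebra.one_mem _,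
    one_ne_zero (α := ℂ), by simp⟩

theorem isMorphism_fst (X Y : FunSpace) : IsMorphism (X.prod Y) X Prod.fst := by
  refine isMorphism_iff.2 fun z => ⟨?_, fun f hf => ?_⟩
  · refine tendsto_nhds.2 fun U hU hz => ?_
    filter_upwards [genTop_mem (U := fun i : {U : Set X // IsOpen U} × {V : Set Y // IsOpen V} =>
      {z : X.carrier × Y.carrier | z.1 ∈ i.1.1 ∧ z.2 ∈ i.2.1})
      (A := fun i => prodAlgebra X Y i.1.1 i.2.1) (i := (⟨U, hU⟩, ⟨Set.univ, isOpen_univ⟩))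
      (Subalgebra.one_mem _) (x := z) ⟨hz, trivial⟩ one_ne_zero] with y hy
    exact hy.1.1
  · obtain ⟨U, hU, hz, hf⟩ := exists_open_regAt hf
    exact regAt_prod_of_mem hU isOpen_univ (Algebra.subset_adjoin (Or.inl ⟨f, hf, rfl⟩)) hz trivial

theorem isMorphism_snd (X Y : FunSpace) : IsMorphism (X.prod Y) Y Prod.snd := by
  refine isMorphism_iff.2 fun z => ⟨?_, fun f hf => ?_⟩
  · refine tendsto_nhds.2 fun U hU hz => ?_
    filter_upwards [genTop_mem (U := fun i : {U : Set X // IsOpen U} × {V : Set Y // IsOpen V} =>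
      {z : X.carrier × Y.carrier | z.1 ∈ i.1.1 ∧ z.2 ∈ i.2.1})
      (A := fun i => prodAlgebra X Y i.1.1 i.2.1) (i := (⟨Set.univ, isOpen_univ⟩, ⟨U, hU⟩))
      (Subalgebra.one_mem _) (x := z) ⟨trivial, hz⟩ one_ne_zero] with y hy
    exact hy.1.2
  · obtain ⟨U, hU, hz, hf⟩ := exists_open_regAt hf
    exact regAt_prod_of_mem isOpen_univ hU (Algebra.subset_adjoin (Or.inr ⟨f, hf, rfl⟩)) trivial hz

/-- The universal property of the product survives its finer topology, because the generators of
`prodAlgebra` each depend on one factor only. -/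
theorem MorphAt.prodMk {X Y Z : FunSpace} {φ : X → Y} {ψ : X → Z} {x : X}
    (hφ : MorphAt X Y φ x) (hψ : MorphAt X Z ψ x) :
    MorphAt X (Y.prod Z) (fun y => (φ y, ψ y)) x := by
  refine morphAt_generate fun i hi => ⟨?_, fun a ha => ?_⟩
  · filter_upwards [hφ.1 (i.1.2.mem_nhds hi.1), hψ.1 (i.2.2.mem_nhds hi.2)] with y h1 h2
      using ⟨h1, h2⟩
  · refine regAt_of_mem_adjoin (φ := fun y => (φ y, ψ y)) ?_ ha
    rintro _ (⟨f, hf, rfl⟩ | ⟨g, hg, rfl⟩)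
    · exact hφ.2 f (hf _ hi.1)
    · exact hψ.2 g (hg _ hi.2)

section vectorSpace

variable {W W' : Type} [AddCommGroup W] [Module ℂ W] [AddCommGroup W'] [Module ℂ W']

theorem regAt_linear (l : W →ₗ[ℂ] ℂ) (w : vectorSpace W) :
    (vectorSpace W).RegAt (fun v : W => l v) w :=
  regAt_generate (i := ()) (Set.mem_univ w) (Algebra.subset_adjoin ⟨l, rfl⟩)

theorem morphAt_vectorSpace_iff {X : FunSpace} {φ : X → W} {x : X} :
    MorphAt X (vectorSpace W) φ x ↔ ∀ l : W →ₗ[ℂ] ℂ, X.RegAt (fun y => l (φ y)) x := by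
  refine ⟨fun h l => h.2 _ (regAt_linear l _), fun h => morphAt_generate fun i _ =>
    ⟨.of_forall fun _ => trivial, fun a ha => regAt_of_mem_adjoin ?_ ha⟩⟩
  rintro _ ⟨l, rfl⟩
  exact h l

theorem isMorphism_linear (L : W →ₗ[ℂ] W') :
    IsMorphism (vectorSpace W) (vectorSpace W') (fun w : W => L w) :=
  isMorphism_iff.2 fun w => morphAt_vectorSpace_iff.2 fun l => regAt_linear (l ∘ₗ L) w

theorem isIso_linearEquiv (L : W ≃ₗ[ℂ] W') :
    IsIso (X := vectorSpace W) (Y := vectorSpace W') L.toEquiv :=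
  ⟨isMorphism_linear L.toLinearMap, isMorphism_linear L.symm.toLinearMap⟩

theorem morphAt_submodule_iff {X : FunSpace} {S : Submodule ℂ W} {φ : X → S} {x : X} :
    MorphAt X (vectorSpace S) φ x ↔ MorphAt X (vectorSpace W) (fun y => (φ y).1) x := by
  rw [morphAt_vectorSpace_iff, morphAt_vectorSpace_iff]
  refine ⟨fun h l => h (l ∘ₗ S.subtype), fun h l => ?_⟩
  obtain ⟨l', hl'⟩ := LinearMap.exists_extend l
  subst hl'
  exact h l'

theorem morphAt_prodSpace_iff {X : FunSpace} {φ : X → W × W'} {x : X} :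
    MorphAt X (vectorSpace (W × W')) φ x ↔
      MorphAt X (vectorSpace W) (fun y => (φ y).1) x ∧
      MorphAt X (vectorSpace W') (fun y => (φ y).2) x := by
  rw [morphAt_vectorSpace_iff, morphAt_vectorSpace_iff, morphAt_vectorSpace_iff]
  refine ⟨fun h => ⟨fun l => h (l ∘ₗ LinearMap.fst ℂ W W'),
    fun l => h (l ∘ₗ LinearMap.snd ℂ W W')⟩, fun h l => ?_⟩
  refine X.congr (.of_forall fun y => ?_)
    (X.add (h.1 (l ∘ₗ LinearMap.inl ℂ W W')) (h.2 (l ∘ₗ LinearMap.inr ℂ W W')))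
  simp [← map_add]

theorem morphAt_basis_iff {X : FunSpace} {ι : Type*} [Fintype ι] (b : Module.Basis ι ℂ W)
    {φ : X → W} {x : X} :
    MorphAt X (vectorSpace W) φ x ↔ ∀ i, X.RegAt (fun y => b.repr (φ y) i) x := by
  rw [morphAt_vectorSpace_iff]
  refine ⟨fun h i => h (b.coord i), fun h l => ?_⟩
  refine X.congr (.of_forall fun y => ?_)
    (regAt_sum Finset.univ fun i _ => X.mul (h i) (X.const (l (b i)) x))
  conv_rhs => rw [← b.sum_repr (φ y), map_sum]
  simp only [map_smul, smul_eq_mul]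

theorem morphAt_pi_iff {X : FunSpace} {ι : Type} [Fintype ι] {φ : X → ι → ℂ}
    {x : X} : MorphAt X (vectorSpace (ι → ℂ)) φ x ↔
      ∀ i, X.RegAt (fun y => φ y i) x := by
  rw [morphAt_basis_iff (Pi.basisFun ℂ ι)]
  rfl

theorem morphAt_matrix_iff {X : FunSpace} {ι κ : Type} [Fintype ι] [Fintype κ]
    {φ : X → Matrix ι κ ℂ} {x : X} :
    MorphAt X (vectorSpace (Matrix ι κ ℂ)) φ x ↔
      ∀ i j, X.RegAt (fun y => φ y i j) x := by
  classical
  rw [morphAt_basis_iff (Matrix.stdBasis ℂ ι κ)]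
  exact ⟨fun h i j => h (i, j), fun h ij => h ij.1 ij.2⟩

end vectorSpace

/-! ### Matrices of regular functions -/

/-- The entries of the matrix valued function `φ` are regular at `x`. -/
def RegMat {X : FunSpace} {ι κ : Type} (φ : X → Matrix ι κ ℂ) (x : X) : Prop :=
  ∀ i j, X.RegAt (fun y => φ y i j) x

namespace RegMat

variable {X : FunSpace} {ι κ μ : Type} {x : X}

theorem const (A : Matrix ι κ ℂ) : RegMat (X := X) (fun _ => A) x := fun i j => X.const (A i j) x

theorem add {φ ψ : X → Matrix ι κ ℂ} (hφ : RegMat φ x) (hψ : RegMat ψ x) :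
    RegMat (fun y => φ y + ψ y) x := fun i j => X.add (hφ i j) (hψ i j)

theorem sub {φ ψ : X → Matrix ι κ ℂ} (hφ : RegMat φ x) (hψ : RegMat ψ x) :
    RegMat (fun y => φ y - ψ y) x := fun i j => RegAt.sub (hφ i j) (hψ i j)

theorem mul [Fintype κ] {φ : X → Matrix ι κ ℂ} {ψ : X → Matrix κ μ ℂ} (hφ : RegMat φ x)
    (hψ : RegMat ψ x) : RegMat (fun y => φ y * ψ y) x := fun i j => by
  simp only [Matrix.mul_apply]
  exact regAt_sum _ fun k _ => X.mul (hφ i k) (hψ k j)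

theorem det [Fintype ι] [DecidableEq ι] {φ : X → Matrix ι ι ℂ} (hφ : RegMat φ x) :
    X.RegAt (fun y => (φ y).det) x := by
  simp only [Matrix.det_apply']
  exact regAt_sum _ fun σ _ => X.mul (X.const _ x) (regAt_prod _ fun i _ => hφ _ _)

/-- Cramer's rule: the entries are cofactors divided by the determinant. -/
theorem inv [Fintype ι] [DecidableEq ι] {φ : X → Matrix ι ι ℂ} (hφ : RegMat φ x)
    (h : IsUnit (φ x).det) : RegMat (fun y => (φ y)⁻¹) x := fun i j => by
  simp only [Matrix.inv_def, Matrix.smul_apply, smul_eq_mul, Ring.inverse_eq_inv',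
    Matrix.adjugate_apply]
  refine X.mul (X.inv hφ.det h.ne_zero) (det fun k l => ?_)
  by_cases hk : k = j
  · subst hk
    simpa using X.const _ x
  · simpa [Matrix.updateRow_ne hk] using hφ k l

theorem of_morphAt [Fintype ι] [Fintype κ] {φ : X → Matrix ι κ ℂ}
    (h : MorphAt X (vectorSpace (Matrix ι κ ℂ)) φ x) :
    RegMat φ x := morphAt_matrix_iff.1 h

theorem eventually_isUnit [Fintype ι] [DecidableEq ι] {φ : X → Matrix ι ι ℂ} (hφ : RegMat φ x)
    (h : IsUnit (φ x).det) : ∀ᶠ y in 𝓝 x, IsUnit (φ y).det := by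
  filter_upwards [X.ne_zero hφ.det h.ne_zero] with y hy using hy.isUnit

theorem comp {Y : FunSpace} {φ : Y → Matrix ι κ ℂ} {ψ : X → Y} (hφ : RegMat φ (ψ x))
    (hψ : MorphAt X Y ψ x) : RegMat (fun y => φ (ψ y)) x := fun i j => hψ.2 _ (hφ i j)

theorem congr {φ ψ : X → Matrix ι κ ℂ} (hφ : RegMat φ x) (h : ∀ᶠ y in 𝓝 x, φ y = ψ y) :
    RegMat ψ x := fun i j => X.congr (by filter_upwards [h] with y hy; rw [hy]) (hφ i j)

end RegMat

/-! ### Final structures -/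

theorem isMorphism_final {T : Type} {I : Type} (P : I → FunSpace) (π : ∀ i, P i → T) (i : I) :
    IsMorphism (P i) (final T P π) (π i) :=
  ⟨finalTop_continuous P π i, fun _ q ⟨_, _, hq, hf⟩ => hf i q hq⟩

theorem regAt_final {T : Type} {I : Type} {P : I → FunSpace} {π : ∀ i, P i → T} {f : T → ℂ}
    {O : Set T} (hO : ∀ i, IsOpen (π i ⁻¹' O))
    (hf : ∀ (i : I) (q : P i), π i q ∈ O → (P i).RegAt (fun r => f (π i r)) q) {t : T}
    (ht : t ∈ O) : (final T P π).RegAt f t :=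
  ⟨O, isOpen_iSup_iff.2 fun i => isOpen_coinduced.2 (hO i), ht, hf⟩

theorem isOpen_final {T : Type} {I : Type} {P : I → FunSpace} {π : ∀ i, P i → T}
    {O : Set (final T P π)} (hO : ∀ i, IsOpen (π i ⁻¹' O)) : IsOpen O :=
  isOpen_iSup_iff.2 fun i => isOpen_coinduced.2 (hO i)

/-- The universal property of the quotient structure, used for maps out of the tensor bundle. -/
theorem isMorphism_of_final {T : Type} {I : Type} {P : I → FunSpace} {π : ∀ i, P i → T}
    {Y : FunSpace} {φ : final T P π → Y} (h : ∀ i, IsMorphism (P i) Y (fun q => φ (π i q))) :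
    IsMorphism (final T P π) Y φ := by
  have hc : Continuous φ :=
    continuous_iSup_dom.2 fun i => continuous_coinduced_dom.2 (h i).1
  refine ⟨hc, fun f x hf => ?_⟩
  obtain ⟨O, hO, hx, hf⟩ := exists_open_regAt hf
  refine regAt_final (O := φ ⁻¹' O) (fun i => hO.preimage (h i).1) (fun i q hq => ?_) hx
  exact (h i).2 f q (hf _ hq)

end FunSpace

end

noncomputable section

namespace FunSpace

/-! ### The Zariski topology of a vector space -/

section zariski

variable {W : Type} [AddCommGroup W] [Module ℂ W]

/-- Polynomial functions come from polynomials in the coordinates of a basis. -/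
theorem exists_mvPolynomial {ι : Type*} [Fintype ι] (b : Module.Basis ι ℂ W) {a : W → ℂ}
    (ha : a ∈ Algebra.adjoin ℂ {f : W → ℂ | ∃ l : Module.Dual ℂ W, f = fun w => l w}) :
    ∃ p : MvPolynomial ι ℂ, ∀ w, a w = MvPolynomial.eval (b.repr w) p := by
  induction ha using Algebra.adjoin_induction with
  | mem f hf =>
    obtain ⟨l, rfl⟩ := hf
    refine ⟨∑ i, MvPolynomial.X i * MvPolynomial.C (l (b i)), fun w => ?_⟩
    refine (congrArg l (b.sum_repr w)).symm.trans ?_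
    rw [map_sum]
    simp
  | algebraMap r => exact ⟨MvPolynomial.C r, fun w => by simp⟩
  | add f g _ _ hf hg =>
    obtain ⟨p, hp⟩ := hf
    obtain ⟨q, hq⟩ := hg
    exact ⟨p + q, fun w => by simp [hp, hq]⟩
  | mul f g _ _ hf hg =>
    obtain ⟨p, hp⟩ := hf
    obtain ⟨q, hq⟩ := hg
    exact ⟨p * q, fun w => by simp [hp, hq]⟩

theorem mvPolynomial_mem_adjoin {ι : Type*} (b : Module.Basis ι ℂ W) (p : MvPolynomial ι ℂ) :
    (fun w => MvPolynomial.eval (b.repr w) p) ∈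
      Algebra.adjoin ℂ {f : W → ℂ | ∃ l : Module.Dual ℂ W, f = fun w => l w} := by
  induction p using MvPolynomial.induction_on with
  | C r =>
    simp only [MvPolynomial.eval_C]
    exact Subalgebra.algebraMap_mem _ r
  | add p q hp hq =>
    simp only [map_add]
    exact add_mem hp hq
  | mul_X p i hp =>
    simp only [map_mul, MvPolynomial.eval_X]
    exact mul_mem hp (Algebra.subset_adjoin ⟨b.coord i, rfl⟩)

/-- The nonvanishing loci of polynomial functions form a basis of the Zariski topology. -/
theorem exists_basic_open {O : Set (vectorSpace W)} (hO : IsOpen O) {w : W} (hw : w ∈ O) :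
    ∃ a ∈ Algebra.adjoin ℂ {f : W → ℂ | ∃ l : Module.Dual ℂ W, f = fun w => l w},
      a w ≠ 0 ∧ ∀ v, a v ≠ 0 → v ∈ O := by
  induction hO generalizing w with
  | basic s hs =>
    obtain ⟨i, a, ha, rfl⟩ := hs
    exact ⟨a, ha, hw.2, fun v hv => ⟨trivial, hv⟩⟩
  | univ => exact ⟨1, one_mem _, one_ne_zero (α := ℂ), fun _ _ => trivial⟩
  | inter s t _ _ hs ht =>
    obtain ⟨a, ha, h1, h2⟩ := hs hw.1
    obtain ⟨b, hb, h3, h4⟩ := ht hw.2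
    exact ⟨a * b, mul_mem ha hb, mul_ne_zero h1 h3,
      fun v hv => ⟨h2 v (left_ne_zero_of_mul hv), h4 v (right_ne_zero_of_mul hv)⟩⟩
  | sUnion S _ hS =>
    obtain ⟨t, ht, hwt⟩ := hw
    obtain ⟨a, ha, h1, h2⟩ := hS t ht hwt
    exact ⟨a, ha, h1, fun v hv => ⟨t, ht, h2 v hv⟩⟩

/-- Hilbert's basis theorem: sending an open set to the ideal of polynomials vanishing on its
complement is strictly monotone, so ascending chains of open sets stop. -/
instance noetherianSpace_vectorSpace [FiniteDimensional ℂ W] :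
    TopologicalSpace.NoetherianSpace (vectorSpace W) := by
  let b := Module.finBasis ℂ W
  let I : TopologicalSpace.Opens (vectorSpace W) →
      Ideal (MvPolynomial (Fin (Module.finrank ℂ W)) ℂ) := fun O =>
    ⨅ w : W, ⨅ _ : ¬ w ∈ (O : Set (vectorSpace W)), RingHom.ker (MvPolynomial.eval (b.repr w))
  have hI : ∀ O p, p ∈ I O ↔ ∀ w : W, ¬ w ∈ (O : Set (vectorSpace W)) →
      MvPolynomial.eval (b.repr w) p = 0 := by
    intro O p
    simp only [I, Ideal.mem_iInf, RingHom.mem_ker]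
  have hmono : StrictMono I := by
    intro O O' hlt
    refine lt_of_le_of_ne (fun p hp => (hI _ _).2 fun w hw => (hI _ _).1 hp w fun h => hw
      (hlt.le h)) fun heq => ?_
    obtain ⟨w, hw', hw⟩ := Set.exists_of_ssubset (show (O : Set (vectorSpace W)) ⊂ O' from hlt)
    obtain ⟨a, ha, h1, h2⟩ := exists_basic_open O'.isOpen hw'
    obtain ⟨p, hp⟩ := exists_mvPolynomial b ha
    have hpI : p ∈ I O' := (hI _ _).2 fun v hv => by
      by_contra hne
      exact hv (h2 v (by rwa [hp]))
    rw [← heq] at hpI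
    exact h1 ((hp w).trans ((hI _ _).1 hpI w hw))
  exact hmono.wellFoundedGT

instance noetherianSpace_sub [FiniteDimensional ℂ W] (S : Set W) :
    TopologicalSpace.NoetherianSpace ((vectorSpace W).sub S) :=
  Topology.IsInducing.noetherianSpace (β := (vectorSpace W).sub S) (α := vectorSpace W)
    (i := fun x : S => x.1) ⟨rfl⟩

end zariski

/-! ### Affine varieties and separatedness -/

/-- An isomorphism restricts to an isomorphism from a subset to its image. -/
theorem isIso_image {X Y : FunSpace} {e : X ≃ Y} (he : IsIso e) (S : Set X) :
    IsIso (X := X.sub S) (Y := Y.sub (e '' S)) (e.image S) := by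
  refine ⟨isMorphism_sub_iff.2 (he.1.comp (isMorphism_val X S)), ?_⟩
  refine isMorphism_sub_iff.2 ?_
  have := he.2.comp (isMorphism_val Y (e '' S))
  convert this using 1
  funext y
  obtain ⟨_, x, hx, rfl⟩ := y
  exact (congrArg Subtype.val ((e.image S).symm_apply_apply ⟨x, hx⟩)).trans
    (e.symm_apply_apply x).symm

theorem isIso_univ (X : FunSpace) :
    IsIso (X := X.sub Set.univ) (Y := X) (Equiv.Set.univ X) :=
  ⟨isMorphism_val X _, isMorphism_sub_iff.2 (isMorphism_iff.2 fun _ => MorphAt.id)⟩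

theorem IsAffineVariety.of_iso {X Y : FunSpace} {e : X ≃ Y} (he : IsIso e)
    (h : IsAffineVariety Y) : IsAffineVariety X := by
  obtain ⟨N, S, hS, e', he'⟩ := h
  exact ⟨N, S, hS, e.trans e', he.trans he'⟩

theorem isAffineVariety_sub {W : Type} [AddCommGroup W] [Module ℂ W] [FiniteDimensional ℂ W]
    {S : Set (vectorSpace W)} (hS : IsClosed S) : IsAffineVariety ((vectorSpace W).sub S) := by
  let L : W ≃ₗ[ℂ] (Fin (Module.finrank ℂ W) → ℂ) := (Module.finBasis ℂ W).equivFun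
  refine ⟨Module.finrank ℂ W, L.toEquiv '' S, ?_,
    Equiv.image (α := vectorSpace W) (β := vectorSpace _) L.toEquiv S,
    isIso_image (isIso_linearEquiv L) S⟩
  have := hS.preimage (isIso_linearEquiv L).2.1
  convert this using 1
  exact L.toEquiv.image_eq_preimage_symm S

theorem isClosed_diagonal {X : FunSpace} (h : ∀ z : X.carrier × X.carrier, z.1 ≠ z.2 →
    ∃ f : X.carrier × X.carrier → ℂ, (X.prod X).RegAt f z ∧ f z ≠ 0 ∧
      ∀ᶠ y : X.carrier × X.carrier in @nhds (X.prod X) _ z, y.1 = y.2 → f y = 0) :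
    IsClosed (X := X.prod X) {z : X.carrier × X.carrier | z.1 = z.2} := by
  refine isOpen_compl_iff.1 (isOpen_iff_mem_nhds.2 fun z hz => ?_)
  obtain ⟨f, hf, hfz, h0⟩ := h z hz
  filter_upwards [(X.prod X).ne_zero hf hfz, h0] with y h1 h2 h3 using h1 (h2 h3)

theorem isVariety_sub {W : Type} [AddCommGroup W] [Module ℂ W] [FiniteDimensional ℂ W]
    {S : Set (vectorSpace W)} (hS : IsClosed S) : IsVariety ((vectorSpace W).sub S) := by
  have hn := noetherianSpace_sub (W := W) S
  refine ⟨inferInstance, fun x => ⟨Set.univ, isOpen_univ, trivial,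
    (isAffineVariety_sub hS).of_iso (isIso_univ _)⟩, isClosed_diagonal fun z hz => ?_⟩
  let b := Module.finBasis ℂ W
  have hv : (z.1 : S).1 ≠ (z.2 : S).1 := fun h => hz (Subtype.ext h)
  obtain ⟨i, hi⟩ : ∃ i, b.repr (z.1 : S).1 i ≠ b.repr (z.2 : S).1 i := by
    by_contra! hcon
    exact hv (b.repr.injective (Finsupp.ext hcon))
  refine ⟨fun y => b.coord i (y.1 : S).1 - b.coord i (y.2 : S).1, RegAt.sub ?_ ?_,
    sub_ne_zero.2 hi, .of_forall fun y hy => sub_eq_zero.2 (by rw [hy])⟩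
  · exact morphAt_vectorSpace_iff.1 (((isMorphism_val _ S).comp (isMorphism_fst _ _)).morphAt z) _
  · exact morphAt_vectorSpace_iff.1 (((isMorphism_val _ S).comp (isMorphism_snd _ _)).morphAt z) _

/-! ### Charts -/

/-- An isomorphism from a vector space to an open subset of `X`. -/
structure Chart (X : FunSpace) (W : Type) [AddCommGroup W] [Module ℂ W] where
  dom : Set X
  isOpen_dom : IsOpen dom
  toFun : W → X
  coord : X → W
  isMorphism_toFun : IsMorphism (vectorSpace W) X toFun
  morphAt_coord : ∀ y ∈ dom, MorphAt X (vectorSpace W) coord y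
  toFun_mem : ∀ w, toFun w ∈ dom
  coord_toFun : ∀ w, coord (toFun w) = w
  toFun_coord : ∀ y ∈ dom, toFun (coord y) = y

theorem Chart.isAffineVariety {X : FunSpace} {W : Type} [AddCommGroup W] [Module ℂ W]
    [FiniteDimensional ℂ W] (c : Chart X W) : IsAffineVariety (X.sub c.dom) := by
  let e : c.dom ≃ W := ⟨fun y => c.coord y.1, fun w => ⟨c.toFun w, c.toFun_mem w⟩,
    fun y => Subtype.ext (c.toFun_coord _ y.2), fun w => c.coord_toFun w⟩
  have he : IsIso (X := X.sub c.dom) (Y := vectorSpace W) e :=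
    ⟨isMorphism_iff.2 fun y => morphAt_restrict (c.morphAt_coord _ (Subtype.prop (p := (· ∈ c.dom)) y)),
      isMorphism_sub_iff.2 c.isMorphism_toFun⟩
  exact ((isAffineVariety_sub isClosed_univ).of_iso (isIso_univ (vectorSpace W)).symm).of_iso he

/-! ### Local rings of smooth points -/

/-- The chart identifies the local ring with the localization of a polynomial ring at the ideal of
the point `c.coord x`, and such localizations are regular. -/
theorem isRegularLocalRing_of_chart {X : FunSpace} {W : Type} [AddCommGroup W] [Module ℂ W]
    [FiniteDimensional ℂ W] (c : Chart X W) {x : X} (hx : x ∈ c.dom) :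
    IsRegularLocalRing (X.localRing x) := by
  let b := Module.finBasis ℂ W
  let ev : W → MvPolynomial (Fin (Module.finrank ℂ W)) ℂ →+* ℂ := fun w =>
    MvPolynomial.eval (b.repr w)
  have hreg : ∀ p, X.RegAt (fun y => ev (c.coord y) p) x := fun p =>
    (c.morphAt_coord x hx).2 _
      (regAt_generate (i := ()) (Set.mem_univ (c.coord x)) (mvPolynomial_mem_adjoin b p))
  let P : MvPolynomial (Fin (Module.finrank ℂ W)) ℂ →+* X.localRing x :=
    { toFun := fun p => ⟨((fun y => ev (c.coord y) p : X → ℂ) : Germ (𝓝 x) ℂ), _, hreg p, rfl⟩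
      map_one' := by ext1; simp only [map_one]; rfl
      map_zero' := by ext1; simp only [map_zero]; rfl
      map_add' := fun p q => by ext1; simp only [map_add]; rfl
      map_mul' := fun p q => by ext1; simp only [map_mul]; rfl }
  let M : Ideal (MvPolynomial (Fin (Module.finrank ℂ W)) ℂ) := RingHom.ker (ev (c.coord x))
  have hM : M.IsPrime := RingHom.ker_isPrime _
  let _ : Algebra (MvPolynomial (Fin (Module.finrank ℂ W)) ℂ) (X.localRing x) := P.toAlgebra
  have hunit : ∀ p, ev (c.coord x) p ≠ 0 → IsUnit (P p) := fun p hp => by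
    refine IsUnit.of_mul_eq_one ⟨_, _, X.inv (hreg p) hp, rfl⟩ (Subtype.ext ?_)
    refine Germ.coe_eq.2 ?_
    filter_upwards [X.ne_zero (hreg p) hp] with y hy using mul_inv_cancel₀ hy
  have hloc : IsLocalization.AtPrime (X.localRing x) M := by
    refine ⟨?_, ?_, ?_⟩
    · rintro ⟨p, hp⟩
      exact hunit p hp
    -- Pulled back along the chart, a regular germ is a quotient of polynomials; this gives the
    -- fraction representing it.
    · rintro ⟨_, f, hf, rfl⟩
      have hfx := hf
      rw [← c.toFun_coord x hx] at hfx
      obtain ⟨i, -, a, ha, d, hd, hdx, hfe⟩ := (c.isMorphism_toFun.morphAt (c.coord x)).2 f hfx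
      obtain ⟨p, hp⟩ := exists_mvPolynomial b ha
      obtain ⟨q, hq⟩ := exists_mvPolynomial b hd
      refine ⟨(p, ⟨q, fun h => hdx ((hq _).trans h)⟩), Subtype.ext (Germ.coe_eq.2 ?_)⟩
      filter_upwards [c.isOpen_dom.mem_nhds hx, (c.morphAt_coord x hx).1.eventually hfe,
        X.ne_zero (hreg q) (fun h => hdx ((hq _).trans h))] with y h1 h2 h3
      rw [c.toFun_coord y h1] at h2
      change f y * ev (c.coord y) q = ev (c.coord y) p
      rw [h2, hp, hq]
      exact div_mul_cancel₀ _ h3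
    · intro p q hpq
      have h1 : ∀ᶠ y in 𝓝 x, ev (c.coord y) p = ev (c.coord y) q :=
        Germ.coe_eq.1 (congrArg Subtype.val hpq)
      rw [← c.toFun_coord x hx] at h1
      have h0 : ∀ w, ev (c.coord (c.toFun w)) p = ev (c.coord (c.toFun w)) q → ev w p = ev w q :=
        fun w hw => by rwa [c.coord_toFun] at hw
      have h2 := ((c.isMorphism_toFun.morphAt (c.coord x)).1.eventually h1).mono h0
      obtain ⟨O, h3, hO, hxO⟩ := (eventually_nhds_iff (X := vectorSpace W)).1 h2
      obtain ⟨a, ha, h4, h5⟩ := exists_basic_open hO hxO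
      obtain ⟨d, hd⟩ := exists_mvPolynomial b ha
      -- Equal germs give polynomials that agree wherever `d` is nonzero, so multiplying by `d`
      -- makes them agree everywhere.
      refine ⟨⟨d, fun h => h4 ((hd _).trans h)⟩, MvPolynomial.funext fun v => ?_⟩
      obtain ⟨w, rfl⟩ : ∃ w : W, ⇑(b.repr w) = v := ⟨b.equivFun.symm v, by
        exact b.equivFun.apply_symm_apply v⟩
      refine (map_mul _ _ _).trans (Eq.trans ?_ (map_mul _ _ _).symm)
      by_cases h0 : a w = 0
      · rw [← hd, h0, zero_mul, zero_mul]
      · exact congrArg _ (h3 w (h5 w h0))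
  exact IsRegularLocalRing.of_ringEquiv
    (IsLocalization.algEquiv M.primeCompl (Localization.AtPrime M) (X.localRing x)).toRingEquiv

/-! ### The classical topology -/

theorem IsMorphism.continuous_classicalTop {X Y : FunSpace} {φ : X → Y} (h : IsMorphism X Y φ) :
    @Continuous X Y X.classicalTop Y.classicalTop φ := by
  refine (@continuous_generateFrom_iff _ _ _ X.classicalTop _).2 ?_
  rintro _ ⟨U, f, B, hU, hf, hB, rfl⟩
  exact TopologicalSpace.isOpen_generateFrom_of_mem
    ⟨φ ⁻¹' U, fun x => f (φ x), B, hU.preimage h.1, fun x hx => h.2 f x (hf _ hx), hB, rfl⟩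

theorem continuous_of_mem_adjoin {W : Type} [AddCommGroup W] [Module ℂ W] [FiniteDimensional ℂ W]
    [TopologicalSpace W] [IsTopologicalAddGroup W] [ContinuousSMul ℂ W] [T2Space W] {a : W → ℂ}
    (ha : a ∈ Algebra.adjoin ℂ {f : W → ℂ | ∃ l : Module.Dual ℂ W, f = fun w => l w}) :
    Continuous a := by
  induction ha using Algebra.adjoin_induction with
  | mem f hf =>
    obtain ⟨l, rfl⟩ := hf
    exact l.continuous_of_finiteDimensional
  | algebraMap r => exact continuous_const
  | add f g _ _ hf hg => exact hf.add hg
  | mul f g _ _ hf hg => exact hf.mul hg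

/-- The classical topology of a subset of a vector space is the euclidean topology. -/
theorem classicalTop_sub_vectorSpace {W : Type} [AddCommGroup W] [Module ℂ W]
    [FiniteDimensional ℂ W] [τ : TopologicalSpace W] [IsTopologicalAddGroup W] [ContinuousSMul ℂ W]
    [T2Space W] (S : Set W) :
    ((vectorSpace W).sub S).classicalTop = (instTopologicalSpaceSubtype : TopologicalSpace S) := by
  have hzar : @Continuous W (vectorSpace W) τ _ (fun w => w) := by
    refine continuous_generateFrom_iff.2 ?_
    rintro _ ⟨i, a, ha, rfl⟩
    have : IsOpen {w | a w ≠ 0} := isOpen_ne_fun (continuous_of_mem_adjoin ha) continuous_const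
    convert this using 1
    exact Set.ext fun _ => ⟨fun h => h.2, fun h => ⟨trivial, h⟩⟩
  have hzarS : @Continuous S ((vectorSpace W).sub S) _ _ (fun w => w) :=
    continuous_induced_rng.2 (hzar.comp continuous_subtype_val)
  refine le_antisymm ?_ ?_
  -- Linear coordinates are regular, hence continuous for the classical topology, which is therefore
  -- at least as fine as the euclidean one.
  · refine (@continuous_iff_le_induced _ _ _ ((vectorSpace W).sub S).classicalTop _).1 ?_
    let L := (Module.finBasis ℂ W).equivFun.toContinuousLinearEquiv
    refine (@Topology.IsInducing.continuous_iff _ _ _ (fun w : S => w.1) _ _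
      ((vectorSpace W).sub S).classicalTop _ L.toHomeomorph.isInducing).2 (@continuous_pi _ _ _
      ((vectorSpace W).sub S).classicalTop _ _ fun i => ?_)
    refine (@continuous_def _ _ ((vectorSpace W).sub S).classicalTop _ _).2 fun B hB =>
      TopologicalSpace.isOpen_generateFrom_of_mem
      ⟨Set.univ, fun w : S => L w.1 i, B, isOpen_univ, fun w _ => ?_, hB,
        Set.ext fun _ => ⟨fun h => ⟨trivial, h⟩, fun h => h.2⟩⟩
    exact regAt_sub_of_regAt (regAt_linear ((Module.finBasis ℂ W).coord i) _)
  · refine le_generateFrom ?_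
    rintro _ ⟨U, f, B, hU, hf, hB, rfl⟩
    refine isOpen_iff_mem_nhds.2 fun x hx => ?_
    -- Conversely, a regular function is locally a quotient of polynomials with nonvanishing
    -- denominator, hence continuous for the euclidean topology.
    obtain ⟨g, ⟨i, -, a, ha, b, hb, hbx, hg⟩, hfg⟩ := hf x hx.1
    have h1 : ∀ᶠ y : S in 𝓝 x, f y = g y.1 := hzarS.continuousAt.eventually hfg
    have h2 : ∀ᶠ y : S in 𝓝 x, g y.1 = a y.1 / b y.1 :=
      (hzar.comp continuous_subtype_val).continuousAt.eventually hg
    have h3 : ContinuousAt (fun y : S => a y.1 / b y.1) x :=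
      ((continuous_of_mem_adjoin ha).comp continuous_subtype_val).continuousAt.div
        ((continuous_of_mem_adjoin hb).comp continuous_subtype_val).continuousAt hbx
    have h4 : @ContinuousAt S ℂ _ _ f x := h3.congr (by
      filter_upwards [h1, h2] with y h5 h6
      exact h6.symm.trans h5.symm)
    filter_upwards [h4 (hB.mem_nhds hx.2), (hU.preimage hzarS).mem_nhds hx.1] with y h5 h6
      using ⟨h6, h5⟩

end FunSpace

end

noncomputable section

namespace TwoColumn

open FunSpace

/-! ### Column spans and diagonal idempotents -/

section linear

variable {n : ℕ}

/-- The diagonal idempotent onto the first `k` coordinates. -/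
def proj (n k : ℕ) : Matrix (Fin n) (Fin n) ℂ :=
  Matrix.diagonal fun j => if j.val < k then 1 else 0

theorem proj_mul_proj (k l : ℕ) : proj n k * proj n l = proj n (min k l) := by
  rw [proj, proj, proj, Matrix.diagonal_mul_diagonal]
  congr 1
  funext j
  by_cases h1 : j.val < k <;> by_cases h2 : j.val < l <;> simp [h1, h2]

theorem proj_mul_self (k : ℕ) : proj n k * proj n k = proj n k := by
  rw [proj_mul_proj, min_self]

theorem proj_mul_of_le {k l : ℕ} (h : k ≤ l) : proj n k * proj n l = proj n k := by
  rw [proj_mul_proj, min_eq_left h]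

theorem proj_mul_of_ge {k l : ℕ} (h : k ≤ l) : proj n l * proj n k = proj n k := by
  rw [proj_mul_proj, min_eq_right h]

theorem im_le_im_iff {X Y : Matrix (Fin n) (Fin n) ℂ} :
    im X ≤ im Y ↔ ∃ K : Matrix (Fin n) (Fin n) ℂ, X = Y * K := by
  constructor
  · intro h
    have h1 : ∀ j, ∃ v : Fin n → ℂ, Y.mulVec v = X.col j := fun j => by
      obtain ⟨v, hv⟩ := h ⟨Pi.single j 1, rfl⟩
      exact ⟨v, by simpa using hv⟩
    choose v hv using h1
    refine ⟨Matrix.of fun i j => v j i, ?_⟩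
    ext i j
    exact (congrFun (hv j) i).symm
  · rintro ⟨K, rfl⟩ _ ⟨v, rfl⟩
    exact ⟨K.mulVec v, by simp⟩

theorem im_le_ker_iff {X Y : Matrix (Fin n) (Fin n) ℂ} : im X ≤ ker Y ↔ Y * X = 0 := by
  rw [LinearMap.range_le_ker_iff, ← Matrix.mulVecLin_mul]
  exact ⟨fun h => Matrix.ext_of_mulVec_single fun i =>
    (LinearMap.congr_fun h (Pi.single i 1)).trans (Matrix.zero_mulVec _).symm,
    fun h => by rw [h, Matrix.mulVecLin_zero]⟩

/-- With `im_le_im_iff` and `im_le_ker_iff`, this turns inclusions between members of flags into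
identities between matrices. -/
theorem colSpan_eq_im (A : Matrix (Fin n) (Fin n) ℂ) (k : ℕ) :
    colSpan A k = im (A * proj n k) := by
  rw [im, Matrix.range_mulVecLin]
  have hcol : ∀ j, (A * proj n k).col j = if j.val < k then A.col j else 0 := fun j => by
    ext i
    by_cases h : j.val < k <;> simp [proj, Matrix.mul_diagonal, h]
  refine le_antisymm (Submodule.span_le.2 ?_) (Submodule.span_le.2 ?_)
  · rintro _ ⟨j, hj, rfl⟩
    refine Submodule.subset_span ⟨j, ?_⟩
    rw [hcol]
    exact if_pos hj
  · rintro _ ⟨j, rfl⟩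
    rw [hcol]
    split_ifs with h
    · exact Submodule.subset_span ⟨j, h, rfl⟩
    · exact zero_mem _

theorem finrank_im (g : Matrix (Fin n) (Fin n) ℂ) : Module.finrank ℂ (im g) = g.rank := rfl

theorem rank_add_finrank_ker (g : Matrix (Fin n) (Fin n) ℂ) :
    g.rank + Module.finrank ℂ (ker g) = n := by
  have := LinearMap.finrank_range_add_finrank_ker g.mulVecLin
  rwa [Module.finrank_pi, Fintype.card_fin] at this

theorem rank_proj {k : ℕ} (h : k ≤ n) : (proj n k).rank = k := by
  rw [← finrank_im, ← one_mul (proj n k), ← colSpan_eq_im]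
  exact finrank_colSpan (by simp) h

theorem exists_extend_linearIndependent {V : Type*} [AddCommGroup V] [Module ℂ V]
    {k l : ℕ} {v : Fin k → V} (hv : LinearIndependent ℂ v) (hkl : k ≤ l)
    (hl : l ≤ Module.finrank ℂ V) :
    ∃ w : Fin l → V, LinearIndependent ℂ w ∧ ∀ i, w (Fin.castLE hkl i) = v i := by
  induction l, hkl using Nat.le_induction with
  | base => exact ⟨v, hv, fun i => rfl⟩
  | succ l hkl ih =>
    obtain ⟨w, hw, hwv⟩ := ih (by omega)
    obtain ⟨x, hx⟩ := exists_linearIndependent_snoc_of_lt_finrank hw (by omega)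
    refine ⟨_, hx, fun i => ?_⟩
    rw [← hwv i]
    exact Fin.snoc_castSucc (α := fun _ => V) x w (Fin.castLE hkl i)

/-- Every flag is spanned by initial columns of an invertible matrix. -/
theorem exists_colSpan_eq {a b : ℕ} {U₁ U₂ : Submodule ℂ (Fin n → ℂ)} (hle : U₁ ≤ U₂)
    (h₁ : Module.finrank ℂ U₁ = a) (h₂ : Module.finrank ℂ U₂ = b) :
    ∃ A : Matrix (Fin n) (Fin n) ℂ, IsUnit A.det ∧ colSpan A a = U₁ ∧ colSpan A b = U₂ := by
  have hab : a ≤ b := by rw [← h₁, ← h₂]; exact Submodule.finrank_mono hle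
  have hbn : b ≤ n := by
    rw [← h₂]
    simpa using Submodule.finrank_le U₂
  -- A basis of `U₁`, obtained from the empty family, is extended inside `U₂` and then inside the
  -- whole space; the columns are the final basis.
  obtain ⟨w₁, hw₁, -⟩ := exists_extend_linearIndependent (V := U₁)
    (linearIndependent_empty_type (ι := Fin 0) (v := Fin.elim0)) (Nat.zero_le a) h₁.ge
  obtain ⟨w₂, hw₂, he₂⟩ := exists_extend_linearIndependent
    (hw₁.map' (Submodule.inclusion hle) (by simp)) hab h₂.ge
  obtain ⟨w, hw, he⟩ := exists_extend_linearIndependent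
    (hw₂.map' U₂.subtype (by simp)) hbn (by simp)
  have hdet : IsUnit (Matrix.of fun i j => w j i).det :=
    (Matrix.isUnit_iff_isUnit_det _).1 (Matrix.linearIndependent_cols_iff_isUnit.1 hw)
  refine ⟨_, hdet, Submodule.eq_of_le_of_finrank_eq (Submodule.span_le.2 ?_)
    ((finrank_colSpan hdet (hab.trans hbn)).trans h₁.symm),
    Submodule.eq_of_le_of_finrank_eq (Submodule.span_le.2 ?_)
    ((finrank_colSpan hdet hbn).trans h₂.symm)⟩
  · rintro _ ⟨j, hj, rfl⟩
    have h1 := he (Fin.castLE hab ⟨j, hj⟩)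
    have h2 := he₂ ⟨j, hj⟩
    change w j ∈ _
    have h3 : w j = (w₁ ⟨j, hj⟩ : Fin n → ℂ) := h1.trans (congrArg U₂.subtype h2)
    rw [h3]
    exact (w₁ _).2
  · rintro _ ⟨j, hj, rfl⟩
    have h1 : w j = _ := he ⟨j, hj⟩
    change w j ∈ _
    rw [h1]
    exact (w₂ _).2

/-- In a frame adapted to both subspaces, the span of the first `k` columns lies between them. -/
theorem exists_between {U W : Submodule ℂ (Fin n → ℂ)} (hle : U ≤ W) {k : ℕ}
    (h₁ : Module.finrank ℂ U ≤ k) (h₂ : k ≤ Module.finrank ℂ W) :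
    ∃ U' : Submodule ℂ (Fin n → ℂ), U ≤ U' ∧ U' ≤ W ∧ Module.finrank ℂ U' = k := by
  obtain ⟨A, hA, h3, h4⟩ := exists_colSpan_eq hle rfl rfl
  have hn : Module.finrank ℂ W ≤ n := by simpa using Submodule.finrank_le W
  exact ⟨colSpan A k, h3.symm.le.trans (colSpan_mono A h₁), (colSpan_mono A h₂).trans h4.le,
    finrank_colSpan hA (h₂.trans hn)⟩

end linear

/-! ### Cells in the flag variety -/

section cells

variable {n a b : ℕ}

theorem Flag.ext' {x y : Flag n a b} (h₁ : x.U₁ = y.U₁) (h₂ : x.U₂ = y.U₂) : x = y := by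
  cases x
  cases y
  subst h₁ h₂
  rfl

theorem isUnit_det_of_mul_eq_one {A B : Matrix (Fin n) (Fin n) ℂ} (h : A * B = 1) :
    IsUnit A.det := Matrix.isUnit_det_of_right_inverse h

/-- The matrix of the projection onto `im (B * E)` along `im (A * (1 - E))`. -/
def projAlong (E A B : Matrix (Fin n) (Fin n) ℂ) : Matrix (Fin n) (Fin n) ℂ :=
  B * E * (B * E + A * (1 - E))⁻¹

/-- Put `S = B * E + A * (1 - E)`. Then `S * E = B * E` and `S * (1 - E) = A * (1 - E)`, so
`projAlong E A B = S * E * S⁻¹`. -/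
theorem projAlong_mul {E A B : Matrix (Fin n) (Fin n) ℂ} (hE : E * E = E)
    (h : IsUnit (B * E + A * (1 - E)).det) :
    projAlong E A B * (B * E) = B * E ∧ projAlong E A B * A * (1 - E) = 0 := by
  have h1 := Matrix.nonsing_inv_mul _ h
  rw [projAlong]
  generalize (B * E + A * (1 - E))⁻¹ = N at *
  constructor
  · linear_combination (norm := noncomm_ring) B * E * h1 * E - B * E * N * B * hE +
      B * E * N * A * hE + B * hE
  · linear_combination (norm := noncomm_ring) B * E * h1 * (1 - E) + B * E * N * B * hE -
      B * E * N * A * hE - B * hE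

/-- A projection is determined by its image and kernel, and the two factorizations say that `B * E`
and `B' * E` have the same image. -/
theorem projAlong_congr {E A B B' K K' : Matrix (Fin n) (Fin n) ℂ} (hE : E * E = E)
    (h : IsUnit (B * E + A * (1 - E)).det) (hK : B' * E = B * E * K) (hK' : B * E = B' * E * K') :
    IsUnit (B' * E + A * (1 - E)).det ∧ projAlong E A B' = projAlong E A B := by
  have h1 : B * E + A * (1 - E) = (B' * E + A * (1 - E)) * (E * K' * E + (1 - E)) := by
    linear_combination (norm := noncomm_ring) hK' * E - B * hE - B' * hE * K' * E - A * hE +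
      A * hE * K' * E + B' * hE
  have hu : IsUnit (B' * E + A * (1 - E)).det := by
    rw [h1, Matrix.det_mul] at h
    exact isUnit_of_mul_isUnit_left h
  refine ⟨hu, ?_⟩
  obtain ⟨h2, h3⟩ := projAlong_mul hE h
  have h4 : projAlong E A B * (B' * E + A * (1 - E)) = B' * E := by
    linear_combination (norm := noncomm_ring) projAlong E A B * hK + h2 * K - hK + h3
  calc projAlong E A B' = projAlong E A B * (B' * E + A * (1 - E)) *
        (B' * E + A * (1 - E))⁻¹ := by rw [h4, projAlong]
    _ = projAlong E A B := by rw [mul_assoc, Matrix.mul_nonsing_inv _ hu, mul_one]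

/-- Block lower triangular nilpotent matrices: coordinates on a cell of the flag variety. -/
def cellSpace (n a b : ℕ) : Submodule ℂ (Matrix (Fin n) (Fin n) ℂ) where
  carrier := {x | proj n a * x = 0 ∧ x * proj n b = x ∧ proj n b * x * (1 - proj n a) = 0}
  zero_mem' := by simp
  add_mem' := by
    rintro x y ⟨h1, h2, h3⟩ ⟨h4, h5, h6⟩
    refine ⟨?_, ?_, ?_⟩
    · rw [mul_add, h1, h4, add_zero]
    · rw [add_mul, h2, h5]
    · rw [mul_add, add_mul, h3, h6, add_zero]
  smul_mem' := by
    rintro c x ⟨h1, h2, h3⟩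
    refine ⟨?_, ?_, ?_⟩
    · rw [Matrix.mul_smul, h1, smul_zero]
    · rw [Matrix.smul_mul, h2]
    · rw [Matrix.mul_smul, Matrix.smul_mul, h3, smul_zero]

variable {x : Matrix (Fin n) (Fin n) ℂ}

/-- The product is `1 + x ^ 3`. The defining equations give `x * x = x * x * E` and `E * x = 0` with
`E = proj n a`, so the cube vanishes, as for strictly triangular matrices with three blocks. -/
theorem cellSpace_mul_inv (hx : x ∈ cellSpace n a b) : (1 + x) * (1 - x + x * x) = 1 := by
  obtain ⟨h1, h2, h3⟩ := hx
  generalize proj n a = E at *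
  generalize proj n b = F at *
  have h4 : x * x = x * x * E := by
    linear_combination (norm := noncomm_ring) (x * h3) - h2 * x + h2 * x * E
  linear_combination (norm := noncomm_ring) x * x * h1 + h4 * x

theorem isUnit_cell {A : Matrix (Fin n) (Fin n) ℂ} (hA : IsUnit A.det)
    (hx : x ∈ cellSpace n a b) : IsUnit (A * (1 + x)).det := by
  rw [Matrix.det_mul]
  exact hA.mul (isUnit_det_of_mul_eq_one (cellSpace_mul_inv hx))

/-- The matrix, block lower triangular near `1`, of the cell coordinates of the flag of `B` with
respect to the flag of `A`. -/
def cellMatrix (a b : ℕ) (A B : Matrix (Fin n) (Fin n) ℂ) : Matrix (Fin n) (Fin n) ℂ :=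
  A⁻¹ * projAlong (proj n a) A B * A +
    A⁻¹ * projAlong (proj n b) A B * A * (1 - proj n a) - proj n b

/-- The flag of `B` is transversal to the flag opposite to that of `A`. -/
def Transversal (a b : ℕ) (A B : Matrix (Fin n) (Fin n) ℂ) : Prop :=
  IsUnit (B * proj n a + A * (1 - proj n a)).det ∧ IsUnit (B * proj n b + A * (1 - proj n b)).det

theorem exists_of_colSpan_le {B B' : Matrix (Fin n) (Fin n) ℂ} {k : ℕ}
    (h : colSpan B k ≤ colSpan B' k) : ∃ K, B * proj n k = B' * proj n k * K := by
  rw [colSpan_eq_im, colSpan_eq_im] at h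
  exact im_le_im_iff.1 h

/-- Cell coordinates thereby descend from frames to flags. -/
theorem Transversal.congr {A B B' : Matrix (Fin n) (Fin n) ℂ} (h : Transversal a b A B)
    (h₁ : colSpan B a = colSpan B' a) (h₂ : colSpan B b = colSpan B' b) :
    Transversal a b A B' ∧ cellMatrix a b A B' = cellMatrix a b A B := by
  obtain ⟨K₁, hK₁⟩ := exists_of_colSpan_le h₁.le
  obtain ⟨L₁, hL₁⟩ := exists_of_colSpan_le h₁.ge
  obtain ⟨K₂, hK₂⟩ := exists_of_colSpan_le h₂.le
  obtain ⟨L₂, hL₂⟩ := exists_of_colSpan_le h₂.ge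
  obtain ⟨h3, h4⟩ := projAlong_congr (proj_mul_self a) h.1 hL₁ hK₁
  obtain ⟨h5, h6⟩ := projAlong_congr (proj_mul_self b) h.2 hL₂ hK₂
  exact ⟨⟨h3, h5⟩, by rw [cellMatrix, cellMatrix, h4, h6]⟩

/-- In the frame `A` the projection `p` has kernel `im (1 - E)`: it kills `1 - E`, and `1 - p` takes
values in `im (1 - E)`. -/
theorem proj_conj_projAlong {E A B : Matrix (Fin n) (Fin n) ℂ} (hE : E * E = E)
    (hA : IsUnit A.det) (h : IsUnit (B * E + A * (1 - E)).det) :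
    E * (A⁻¹ * projAlong E A B * A) = E ∧
      A⁻¹ * projAlong E A B * A * E = A⁻¹ * projAlong E A B * A := by
  have h1 := Matrix.mul_nonsing_inv _ h
  have h2 := Matrix.nonsing_inv_mul _ hA
  have h3 := (projAlong_mul hE h).2
  constructor
  · rw [projAlong]
    generalize (B * E + A * (1 - E))⁻¹ = N at *
    generalize A⁻¹ = A' at *
    linear_combination (norm := noncomm_ring) E * A' * h1 * A + E * h2 -
      E * h2 * (1 - E) * N * A + hE * N * A
  · linear_combination (norm := noncomm_ring) - A⁻¹ * h3

/-- Writing `p` and `q` for the two projections in the frame `A`, one has `1 + cellMatrix a b A B =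
p + q * (1 - E) + (1 - F)`. The first block of columns comes from `p`, the second from `q`, and the
third is standard; the kernels of `p` and `q` force the remaining blocks to be those of a unipotent
lower triangular matrix. -/
theorem cellMatrix_mem (hab : a ≤ b) {A B : Matrix (Fin n) (Fin n) ℂ} (hA : IsUnit A.det)
    (h : Transversal a b A B) : cellMatrix a b A B ∈ cellSpace n a b := by
  obtain ⟨h1, h2⟩ := proj_conj_projAlong (proj_mul_self a) hA h.1
  obtain ⟨h3, h4⟩ := proj_conj_projAlong (proj_mul_self b) hA h.2
  have hEF := proj_mul_of_le (n := n) hab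
  have hFE := proj_mul_of_ge (n := n) hab
  have hE := proj_mul_self (n := n) a
  have hF := proj_mul_self (n := n) b
  change proj n a * cellMatrix a b A B = 0 ∧ cellMatrix a b A B * proj n b = cellMatrix a b A B ∧
    proj n b * cellMatrix a b A B * (1 - proj n a) = 0
  rw [cellMatrix]
  generalize A⁻¹ * projAlong (proj n a) A B * A = p at *
  generalize A⁻¹ * projAlong (proj n b) A B * A = q at *
  generalize proj n a = E at *
  generalize proj n b = F at *
  refine ⟨?_, ?_, ?_⟩
  · linear_combination (norm := noncomm_ring) h1 + E * h3 * (1 - E) - hEF * q * (1 - E) + hEF * (1 - E) - hEF - hE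
  · linear_combination (norm := noncomm_ring) h4 - q * hEF - hF + h2 - h2 * F + p * hEF
  · linear_combination (norm := noncomm_ring) h3 * (1 - E) - h3 * (1 - E) * E - F * h2 -
      hF * (1 - E) + F * hE

/-- The columns in question are values of the projections onto the two members of the flag of `B`,
which gives inclusions; equal dimensions finish. -/
theorem colSpan_cellMatrix (hab : a ≤ b) (hbn : b ≤ n) {A B : Matrix (Fin n) (Fin n) ℂ}
    (hA : IsUnit A.det) (hB : IsUnit B.det) (h : Transversal a b A B) :
    colSpan (A * (1 + cellMatrix a b A B)) a = colSpan B a ∧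
      colSpan (A * (1 + cellMatrix a b A B)) b = colSpan B b := by
  have hu := isUnit_cell hA (cellMatrix_mem hab hA h)
  obtain ⟨-, h2⟩ := proj_conj_projAlong (proj_mul_self a) hA h.1
  obtain ⟨-, h4⟩ := proj_conj_projAlong (proj_mul_self b) hA h.2
  have hEF := proj_mul_of_le (n := n) hab
  have hFE := proj_mul_of_ge (n := n) hab
  have hE := proj_mul_self (n := n) a
  have hF := proj_mul_self (n := n) b
  have h5 := Matrix.mul_nonsing_inv _ hA
  have e : A * (1 + cellMatrix a b A B) = projAlong (proj n a) A B * A +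
      projAlong (proj n b) A B * A * (1 - proj n a) + A * (1 - proj n b) := by
    rw [cellMatrix]
    linear_combination (norm := noncomm_ring) h5 * projAlong (proj n a) A B * A +
      h5 * projAlong (proj n b) A B * A * (1 - proj n a)
  have h6 : projAlong (proj n a) A B * A * proj n a = projAlong (proj n a) A B * A := by
    linear_combination (norm := noncomm_ring) A * h2 - h5 * projAlong (proj n a) A B * A * proj n a
      + h5 * projAlong (proj n a) A B * A
  have e1 : A * (1 + cellMatrix a b A B) * proj n a = projAlong (proj n a) A B * A := by
    rw [e]
    linear_combination (norm := noncomm_ring) h6 - projAlong (proj n b) A B * A * hE - A * hFE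
  constructor
  · refine Submodule.eq_of_le_of_finrank_eq ?_ ?_
    · rw [colSpan_eq_im, colSpan_eq_im, im_le_im_iff, e1]
      exact ⟨(B * proj n a + A * (1 - proj n a))⁻¹ * A, by rw [projAlong, mul_assoc]⟩
    · rw [finrank_colSpan hu (hab.trans hbn), finrank_colSpan hB (hab.trans hbn)]
  · refine Submodule.eq_of_le_of_finrank_eq ?_ ?_
    · rw [colSpan_eq_im, colSpan_eq_im, im_le_im_iff, e]
      refine ⟨proj n a * (B * proj n a + A * (1 - proj n a))⁻¹ * A * proj n b +
        (B * proj n b + A * (1 - proj n b))⁻¹ * A * (1 - proj n a) * proj n b, ?_⟩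
      rw [projAlong, projAlong]
      generalize (B * proj n a + A * (1 - proj n a))⁻¹ = N
      generalize (B * proj n b + A * (1 - proj n b))⁻¹ = N'
      linear_combination (norm := noncomm_ring) - B * hFE * N * A * proj n b - A * hF
    · rw [finrank_colSpan hu hbn, finrank_colSpan hB hbn]

/-- For `B = A * (1 + x)` the two matrices to be inverted are `A * (1 + x * E)` and `A * (1 + x)`.
Their inverses are explicit because `x * E` has square zero and `x` has cube zero. -/
theorem transversal_cell (hab : a ≤ b) {A : Matrix (Fin n) (Fin n) ℂ} (hA : IsUnit A.det)
    (hx : x ∈ cellSpace n a b) :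
    Transversal a b A (A * (1 + x)) ∧ cellMatrix a b A (A * (1 + x)) = x := by
  have hinv := cellSpace_mul_inv hx
  obtain ⟨h1, h2, h3⟩ := hx
  have hEF := proj_mul_of_le (n := n) hab
  have hFE := proj_mul_of_ge (n := n) hab
  have hE := proj_mul_self (n := n) a
  have hF := proj_mul_self (n := n) b
  have hA1 := Matrix.mul_nonsing_inv _ hA
  have hA2 := Matrix.nonsing_inv_mul _ hA
  have e1 : (A * (1 + x) * proj n a + A * (1 - proj n a)) * ((1 - x * proj n a) * A⁻¹) = 1 := by
    linear_combination (norm := noncomm_ring) hA1 - A * x * h1 * proj n a * A⁻¹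
  have e2 : (A * (1 + x) * proj n b + A * (1 - proj n b)) * ((1 - x + x * x) * A⁻¹) = 1 := by
    linear_combination (norm := noncomm_ring) hA1 + A * hinv * A⁻¹ + A * h2 * (1 - x + x * x) * A⁻¹
  refine ⟨⟨isUnit_det_of_mul_eq_one e1, isUnit_det_of_mul_eq_one e2⟩, ?_⟩
  rw [cellMatrix, projAlong, projAlong, Matrix.inv_eq_right_inv e1, Matrix.inv_eq_right_inv e2]
  generalize A⁻¹ = A' at *
  generalize proj n a = E at *
  generalize proj n b = F at *
  have h4 : x * x * (1 - E) = 0 := by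
    linear_combination (norm := noncomm_ring) x * h3 - h2 * x * (1 - E)
  have e3 : A' * (A * (1 + x) * E * ((1 - x * E) * A')) * A = (1 + x) * E := by
    linear_combination (norm := noncomm_ring) hA2 * (1 + x) * E * (1 - x * E) * A' * A +
      (1 + x) * E * (1 - x * E) * hA2 - (1 + x) * h1 * E
  have e4 : A' * (A * (1 + x) * F * ((1 - x + x * x) * A')) * A * (1 - E) =
      (1 + x) * (F - E) := by
    linear_combination (norm := noncomm_ring) hA2 * (1 + x) * F * (1 - x + x * x) * A' * A * (1 - E) +
      (1 + x) * F * (1 - x + x * x) * hA2 * (1 - E) - (1 + x) * h3 + (1 + x) * F * h4 -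
      (1 + x) * hFE
  rw [e3, e4]
  linear_combination (norm := noncomm_ring) h2

end cells

end TwoColumn

end

noncomputable section

namespace TwoColumn

open FunSpace

/-! ### Regular sections over the cells of the flag variety -/

section flagVariety

variable {n a b : ℕ}

theorem isMorphism_flagOf (hab : a ≤ b) (hbn : b ≤ n) :
    IsMorphism (generalLinear n) (flagVariety (n := n) hab hbn) (flagOf hab hbn) :=
  isMorphism_final (fun _ : Unit => generalLinear n) (fun _ => flagOf hab hbn) ()

theorem regMat_generalLinear (B : generalLinear n) :
    RegMat (X := generalLinear n)
      (fun B : {A : Matrix (Fin n) (Fin n) ℂ | IsUnit A.det} => B.1) B :=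
  RegMat.of_morphAt ((isMorphism_val (matrixSpace n) _).morphAt B)

theorem morphAt_generalLinear {X : FunSpace}
    {ψ : X → {A : Matrix (Fin n) (Fin n) ℂ | IsUnit A.det}} {x : X}
    (h : RegMat (fun y => (ψ y).1) x) : MorphAt X (generalLinear n) ψ x :=
  morphAt_sub_iff.2 (morphAt_matrix_iff.2 h)

/-- A map to the flag variety is a morphism near a point where it lifts to invertible matrices. -/
theorem morphAt_flagVariety (hab : a ≤ b) (hbn : b ≤ n) {X : FunSpace}
    {φ : X → Matrix (Fin n) (Fin n) ℂ} {x : X} (hφ : RegMat φ x) (hu : IsUnit (φ x).det) {ψ : X → Flag n a b}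
    (hψ : ∀ᶠ y in 𝓝 x, colSpan (φ y) a = (ψ y).U₁ ∧ colSpan (φ y) b = (ψ y).U₂) :
    MorphAt X (flagVariety hab hbn) ψ x := by
  classical
  -- The value `1` off the invertible locus only makes the lift total; it is never taken near `x`.
  let φ' : X → {A : Matrix (Fin n) (Fin n) ℂ | IsUnit A.det} := fun y =>
    if hy : IsUnit (φ y).det then ⟨φ y, hy⟩ else ⟨1, by simp⟩
  have h1 : ∀ᶠ y in 𝓝 x, φ y = (φ' y).1 := by
    filter_upwards [hφ.eventually_isUnit hu] with y hy
    simp only [φ', dif_pos hy]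
  refine (((isMorphism_flagOf hab hbn).morphAt _).comp
    (morphAt_generalLinear (hφ.congr h1))).congr ?_
  filter_upwards [h1, hψ] with y h2 h3
  exact Flag.ext' ((congrArg (colSpan · a) h2.symm).trans h3.1)
    ((congrArg (colSpan · b) h2.symm).trans h3.2)

/-- The cell of flags transversal to the flag opposite to that of `A`. -/
def cell (n a b : ℕ) (A : Matrix (Fin n) (Fin n) ℂ) : Set (Flag n a b) :=
  {fl | ∃ B, IsUnit B.det ∧ Transversal a b A B ∧ colSpan B a = fl.U₁ ∧ colSpan B b = fl.U₂}

theorem transversal_of_mem_cell {A B : Matrix (Fin n) (Fin n) ℂ} {fl : Flag n a b}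
    (h : fl ∈ cell n a b A) (h₁ : colSpan B a = fl.U₁) (h₂ : colSpan B b = fl.U₂) :
    Transversal a b A B := by
  obtain ⟨B', -, ht, h3, h4⟩ := h
  exact (ht.congr (h3.trans h₁.symm) (h4.trans h₂.symm)).1

theorem mem_cell_self {A : Matrix (Fin n) (Fin n) ℂ} (hA : IsUnit A.det)
    {fl : Flag n a b}
    (h₁ : colSpan A a = fl.U₁) (h₂ : colSpan A b = fl.U₂) : fl ∈ cell n a b A := by
  refine ⟨A, hA, ⟨?_, ?_⟩, h₁, h₂⟩ <;> simpa [mul_sub] using hA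

theorem isOpen_cell (hab : a ≤ b) (hbn : b ≤ n) (A : Matrix (Fin n) (Fin n) ℂ) :
    IsOpen (X := flagVariety hab hbn) (cell n a b A) := by
  refine isOpen_final fun _ => isOpen_iff_mem_nhds.2 fun B hB => ?_
  obtain ⟨h1, h2⟩ := transversal_of_mem_cell hB rfl rfl
  have hr := regMat_generalLinear B
  filter_upwards [((hr.mul (.const _)).add (.const _)).eventually_isUnit h1,
    ((hr.mul (.const _)).add (.const _)).eventually_isUnit h2] with C h3 h4
  exact ⟨_, Subtype.prop (p := (· ∈ {A : Matrix (Fin n) (Fin n) ℂ | IsUnit A.det})) C,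
    ⟨h3, h4⟩, rfl, rfl⟩

/-- The regular section over `cell n a b A` of the quotient map from the general linear group. -/
def cellSection (A : Matrix (Fin n) (Fin n) ℂ) (fl : Flag n a b) : Matrix (Fin n) (Fin n) ℂ :=
  A * (1 + cellMatrix a b A (exists_colSpan_eq fl.le fl.dim₁ fl.dim₂).choose)

/-- The arbitrary frame chosen in `cellSection` is harmless on the cell, so any convenient frame of
the flag may be used. -/
theorem cellSection_eq {A B : Matrix (Fin n) (Fin n) ℂ} {fl : Flag n a b}
    (h : fl ∈ cell n a b A) (h₁ : colSpan B a = fl.U₁) (h₂ : colSpan B b = fl.U₂) :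
    cellSection A fl = A * (1 + cellMatrix a b A B) := by
  obtain ⟨-, h3, h4⟩ := (exists_colSpan_eq fl.le fl.dim₁ fl.dim₂).choose_spec
  rw [cellSection, ((transversal_of_mem_cell h h₁ h₂).congr (h₁.trans h3.symm)
    (h₂.trans h4.symm)).2]

theorem isUnit_cellSection (hab : a ≤ b) {A : Matrix (Fin n) (Fin n) ℂ} (hA : IsUnit A.det)
    {fl : Flag n a b}
    (h : fl ∈ cell n a b A) : IsUnit (cellSection A fl).det := by
  have h' := h
  obtain ⟨B, hB, ht, h3, h4⟩ := h'
  rw [cellSection_eq h h3 h4]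
  exact isUnit_cell hA (cellMatrix_mem hab hA ht)

theorem inv_mul_cellSection (hab : a ≤ b) {A : Matrix (Fin n) (Fin n) ℂ} (hA : IsUnit A.det)
    {fl : Flag n a b}
    (h : fl ∈ cell n a b A) : A⁻¹ * cellSection A fl - 1 ∈ cellSpace n a b := by
  have h' := h
  obtain ⟨B, hB, ht, h3, h4⟩ := h'
  rw [cellSection_eq h h3 h4, ← mul_assoc, Matrix.nonsing_inv_mul _ hA, one_mul,
    add_sub_cancel_left]
  exact cellMatrix_mem hab hA ht

theorem colSpan_cellSection (hab : a ≤ b) (hbn : b ≤ n)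
    {A : Matrix (Fin n) (Fin n) ℂ} (hA : IsUnit A.det)
    {fl : Flag n a b}
    (h : fl ∈ cell n a b A) :
    colSpan (cellSection A fl) a = fl.U₁ ∧ colSpan (cellSection A fl) b = fl.U₂ := by
  have h' := h
  obtain ⟨B, hB, ht, h3, h4⟩ := h'
  rw [cellSection_eq h h3 h4, ← h3, ← h4]
  exact colSpan_cellMatrix hab hbn hA hB ht

theorem cellSection_cell (hab : a ≤ b) {A x : Matrix (Fin n) (Fin n) ℂ} (hA : IsUnit A.det)
    (hx : x ∈ cellSpace n a b) {fl : Flag n a b} (h₁ : colSpan (A * (1 + x)) a = fl.U₁)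
    (h₂ : colSpan (A * (1 + x)) b = fl.U₂) :
    fl ∈ cell n a b A ∧ cellSection A fl = A * (1 + x) := by
  obtain ⟨h3, h4⟩ := transversal_cell hab hA hx
  have h5 : fl ∈ cell n a b A := ⟨_, isUnit_cell hA hx, h3, h₁, h₂⟩
  exact ⟨h5, by rw [cellSection_eq h5 h₁ h₂, h4]⟩

/-- Regularity on the quotient is tested after pulling back to invertible matrices `B`. There the
section is rational in the entries of `B`, with the two transversality determinants as denominators.
-/
theorem regMat_cellSection (hab : a ≤ b) (hbn : b ≤ n) {A : Matrix (Fin n) (Fin n) ℂ}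
    {fl : Flag n a b} (h : fl ∈ cell n a b A) :
    RegMat (X := flagVariety hab hbn) (cellSection A) fl := by
  have key : ∀ B : generalLinear n, flagOf hab hbn B ∈ cell n a b A →
      RegMat (X := generalLinear n) (fun B => cellSection A (flagOf hab hbn B)) B := by
    intro B hB
    have hr := regMat_generalLinear B
    obtain ⟨h1, h2⟩ := transversal_of_mem_cell hB rfl rfl
    refine RegMat.congr (φ := fun B : {A : Matrix (Fin n) (Fin n) ℂ | IsUnit A.det} =>
      A * (1 + cellMatrix a b A B.1)) ?_ ?_
    · refine (RegMat.const _).mul ((RegMat.const _).add (RegMat.sub (.add (.mul (.mul (.const _) ?_)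
        (.const _)) (.mul (.mul (.mul (.const _) ?_) (.const _)) (.const _))) (.const _)))
      · exact (hr.mul (.const _)).mul (((hr.mul (.const _)).add (.const _)).inv h1)
      · exact (hr.mul (.const _)).mul (((hr.mul (.const _)).add (.const _)).inv h2)
    · filter_upwards [((isOpen_cell hab hbn A).preimage (isMorphism_flagOf hab hbn).1).mem_nhds hB]
        with C hC
      exact (cellSection_eq hC rfl rfl).symm
  intro i j
  exact regAt_final (O := cell n a b A) (fun _ => (isOpen_cell hab hbn A).preimage
    (isMorphism_flagOf hab hbn).1) (fun _ B hB => key B hB i j) h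

end flagVariety

/-! ### Charts of the variety of triples -/

/-- Matrices concentrated in the upper right block: the fibre of `Hom(V / U₂, U₁)`. -/
def fibreSpace (n a b : ℕ) : Submodule ℂ (Matrix (Fin n) (Fin n) ℂ) where
  carrier := {c | proj n a * c = c ∧ c * proj n b = 0}
  zero_mem' := by simp
  add_mem' := by
    rintro x y ⟨h1, h2⟩ ⟨h3, h4⟩
    exact ⟨by rw [mul_add, h1, h3], by rw [add_mul, h2, h4, add_zero]⟩
  smul_mem' := by
    rintro c x ⟨h1, h2⟩
    exact ⟨by rw [Matrix.mul_smul, h1], by rw [Matrix.smul_mul, h2, smul_zero]⟩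

section triples

variable {n m : ℕ}

/-- With `E = proj n m` and `F = proj n (n - m)`, the hypothesis `2 * m ≤ n` gives `F * E = E`,
whence `c * c = c * E * c = c * F * E * c = 0`. The rank is bounded by that of `E`. -/
theorem conj_mem_orbitClosureSet (h : 2 * m ≤ n) {A c : Matrix (Fin n) (Fin n) ℂ}
    (hA : IsUnit A.det) (hc : c ∈ fibreSpace n m (n - m)) : A * c * A⁻¹ ∈ orbitClosureSet n m := by
  obtain ⟨h1, h2⟩ := hc
  have hFE := proj_mul_of_ge (n := n) (show m ≤ n - m by omega)
  have hA2 := Matrix.nonsing_inv_mul _ hA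
  constructor
  · linear_combination (norm := noncomm_ring) A * c * hA2 * c * A⁻¹ - A * c * h1 * A⁻¹ -
      A * c * hFE * c * A⁻¹ + A * h2 * proj n m * c * A⁻¹
  · calc (A * c * A⁻¹).rank = (A * proj n m * (c * A⁻¹)).rank := by
          congr 1
          linear_combination (norm := noncomm_ring) - A * h1 * A⁻¹
      _ ≤ (A * proj n m).rank := Matrix.rank_mul_le_left _ _
      _ ≤ (proj n m).rank := Matrix.rank_mul_le_right _ _
      _ = m := rank_proj (by omega)

theorem im_conj_le {a b : ℕ} {A c : Matrix (Fin n) (Fin n) ℂ} (hc : c ∈ fibreSpace n a b) :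
    im (A * c * A⁻¹) ≤ colSpan A a := by
  rw [colSpan_eq_im, im_le_im_iff]
  exact ⟨c * A⁻¹, by linear_combination (norm := noncomm_ring) - A * hc.1 * A⁻¹⟩

theorem le_ker_conj {a b : ℕ} {A c : Matrix (Fin n) (Fin n) ℂ}
    (hA : IsUnit A.det) (hc : c ∈ fibreSpace n a b) : colSpan A b ≤ ker (A * c * A⁻¹) := by
  rw [colSpan_eq_im, im_le_ker_iff]
  have hA2 := Matrix.nonsing_inv_mul _ hA
  linear_combination (norm := noncomm_ring) A * hc.2 + A * c * hA2 * proj n b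

theorem conj_mem_fibreSpace {a b : ℕ} {A g : Matrix (Fin n) (Fin n) ℂ} (hA : IsUnit A.det)
    (h₁ : im g ≤ colSpan A a) (h₂ : colSpan A b ≤ ker g) :
    A⁻¹ * g * A ∈ fibreSpace n a b := by
  rw [colSpan_eq_im, im_le_im_iff] at h₁
  rw [colSpan_eq_im, im_le_ker_iff] at h₂
  obtain ⟨K, rfl⟩ := h₁
  have hA2 := Matrix.nonsing_inv_mul _ hA
  have hE := proj_mul_self (n := n) a
  constructor
  · linear_combination (norm := noncomm_ring) proj n a * hA2 * proj n a * K * A -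
      hA2 * proj n a * K * A + hE * K * A
  · linear_combination (norm := noncomm_ring) A⁻¹ * h₂

theorem morphAt_tripleVariety (h : 2 * m ≤ n) {X : FunSpace} {φ : X → tripleSet n m} {x : X}
    (h₁ : RegMat (fun y => (φ y).1.1.1) x)
    (h₂ : MorphAt X (flagBase h) (fun y => (φ y).1.2) x) : MorphAt X (tripleVariety h) φ x :=
  morphAt_sub_iff.2 (MorphAt.prodMk (Y := orbitClosure n m) (Z := flagBase h)
    (φ := fun y => (φ y).1.1) (morphAt_sub_iff.2 (morphAt_matrix_iff.2 h₁)) h₂)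

theorem isMorphism_tripleProj (h : 2 * m ≤ n) :
    IsMorphism (tripleVariety h) (orbitClosure n m) (tripleProj h) :=
  (isMorphism_fst (orbitClosure n m) (flagBase h)).comp
    (isMorphism_val ((orbitClosure n m).prod (flagBase h)) (tripleSet n m))

theorem isMorphism_tripleToFlag (h : 2 * m ≤ n) :
    IsMorphism (tripleVariety h) (flagBase h) (tripleToFlag h) :=
  (isMorphism_snd (orbitClosure n m) (flagBase h)).comp
    (isMorphism_val ((orbitClosure n m).prod (flagBase h)) (tripleSet n m))

theorem regMat_tripleMatrix (h : 2 * m ≤ n) (z : tripleVariety h) : RegMat (tripleMatrix h) z :=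
  RegMat.of_morphAt (((isMorphism_val (matrixSpace n) (orbitClosureSet n m)).comp
    (isMorphism_tripleProj h)).morphAt z)

/-- The triple of the flag of `A` and of the matrix `c` in the frame `A`. -/
def tripleOf (h : 2 * m ≤ n) (A c : Matrix (Fin n) (Fin n) ℂ) (hA : IsUnit A.det)
    (hc : c ∈ fibreSpace n m (n - m)) : tripleSet n m :=
  ⟨(⟨A * c * A⁻¹, conj_mem_orbitClosureSet h hA hc⟩,
    flagOf (by omega) (Nat.sub_le n m) ⟨A, hA⟩), im_conj_le hc, le_ker_conj hA hc⟩

theorem morphAt_tripleOf (h : 2 * m ≤ n) {X : FunSpace} {φ ψ : X → Matrix (Fin n) (Fin n) ℂ} {x : X}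
    (hφ : RegMat φ x) (hψ : RegMat ψ x) (hu : ∀ y, IsUnit (φ y).det)
    (hc : ∀ y, ψ y ∈ fibreSpace n m (n - m)) :
    MorphAt X (tripleVariety h) (fun y => tripleOf h (φ y) (ψ y) (hu y) (hc y)) x :=
  morphAt_tripleVariety h ((hφ.mul hψ).mul (hφ.inv (hu x)))
    (morphAt_flagVariety _ _ hφ (hu x) (.of_forall fun _ => ⟨rfl, rfl⟩))

theorem mem_fibreSpace_of_mem_cell (h : 2 * m ≤ n) {A : Matrix (Fin n) (Fin n) ℂ}
    (hA : IsUnit A.det) (z : tripleSet n m) (hz : z.1.2 ∈ cell n m (n - m) A) :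
    (cellSection A z.1.2)⁻¹ * z.1.1.1 * cellSection A z.1.2 ∈ fibreSpace n m (n - m) := by
  obtain ⟨h1, h2⟩ := colSpan_cellSection (by omega) (Nat.sub_le n m) hA hz
  exact conj_mem_fibreSpace (isUnit_cellSection (by omega) hA hz) (z.2.1.trans h1.ge)
    (h2.le.trans z.2.2)

/-- The projection of matrices to `cellSpace n a b`. -/
def toCellSpace {a b : ℕ} (hab : a ≤ b) (X : Matrix (Fin n) (Fin n) ℂ) : cellSpace n a b :=
  ⟨(proj n b - proj n a) * X * proj n a + (1 - proj n b) * X * proj n b, by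
    have hEF := proj_mul_of_le (n := n) hab
    have hFE := proj_mul_of_ge (n := n) hab
    have hE := proj_mul_self (n := n) a
    have hF := proj_mul_self (n := n) b
    change proj n a * _ = 0 ∧ _ * proj n b = _ ∧ proj n b * _ * (1 - proj n a) = 0
    generalize proj n a = E at *
    generalize proj n b = F at *
    refine ⟨?_, ?_, ?_⟩
    · linear_combination (norm := noncomm_ring) hEF * X * E - hE * X * E - hEF * X * F
    · linear_combination (norm := noncomm_ring) (F - E) * X * hEF + (1 - F) * X * hF
    · linear_combination (norm := noncomm_ring) F * (E - F) * X * hE - hF * X * F * (1 - E)⟩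

theorem toCellSpace_of_mem {a b : ℕ} (hab : a ≤ b) {X : Matrix (Fin n) (Fin n) ℂ}
    (hX : X ∈ cellSpace n a b) : (toCellSpace hab X : Matrix (Fin n) (Fin n) ℂ) = X := by
  obtain ⟨h1, h2, h3⟩ := hX
  change (proj n b - proj n a) * X * proj n a + (1 - proj n b) * X * proj n b = X
  linear_combination (norm := noncomm_ring) h2 - h1 * proj n a - h3 - proj n b * h2

/-- The projection of matrices to `fibreSpace n a b`. -/
def toFibreSpace (n a b : ℕ) (X : Matrix (Fin n) (Fin n) ℂ) : fibreSpace n a b :=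
  ⟨proj n a * X * (1 - proj n b), by
    have hE := proj_mul_self (n := n) a
    have hF := proj_mul_self (n := n) b
    constructor
    · linear_combination (norm := noncomm_ring) hE * X * (1 - proj n b)
    · linear_combination (norm := noncomm_ring) - proj n a * X * hF⟩

theorem toFibreSpace_of_mem {a b : ℕ} {X : Matrix (Fin n) (Fin n) ℂ}
    (hX : X ∈ fibreSpace n a b) : (toFibreSpace n a b X : Matrix (Fin n) (Fin n) ℂ) = X := by
  obtain ⟨h1, h2⟩ := hX
  change proj n a * X * (1 - proj n b) = X
  linear_combination (norm := noncomm_ring) h1 - proj n a * h2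

theorem conj_conj_inv {A g : Matrix (Fin n) (Fin n) ℂ} (hA : IsUnit A.det) :
    A * (A⁻¹ * g * A) * A⁻¹ = g := by
  have h1 := Matrix.mul_nonsing_inv _ hA
  linear_combination (norm := noncomm_ring) h1 * g * A * A⁻¹ + g * h1

theorem tripleOf_cellSection (h : 2 * m ≤ n) {A S c : Matrix (Fin n) (Fin n) ℂ}
    (hA : IsUnit A.det) (z : tripleSet n m) (hz : z.1.2 ∈ cell n m (n - m) A)
    (hu : IsUnit S.det) (hc : c ∈ fibreSpace n m (n - m)) (hS : S = cellSection A z.1.2)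
    (hcS : c = (cellSection A z.1.2)⁻¹ * z.1.1.1 * cellSection A z.1.2) :
    tripleOf h S c hu hc = z := by
  subst hS hcS
  obtain ⟨h5, h6⟩ := colSpan_cellSection (show m ≤ n - m by omega) (Nat.sub_le n m) hA hz
  exact Subtype.ext (Prod.ext (Subtype.ext (conj_conj_inv hu)) (Flag.ext' h5 h6))

/-- The chart of the variety of triples over a cell of the flag variety. -/
def tripleChart (h : 2 * m ≤ n) (A : Matrix (Fin n) (Fin n) ℂ) (hA : IsUnit A.det) :
    Chart (tripleVariety h) (cellSpace n m (n - m) × fibreSpace n m (n - m)) where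
  dom := tripleToFlag h ⁻¹' cell n m (n - m) A
  isOpen_dom := (isOpen_cell _ _ A).preimage (isMorphism_tripleToFlag h).1
  toFun w := tripleOf h (A * (1 + w.1.1)) w.2.1 (isUnit_cell hA w.1.2) w.2.2
  -- The projections `toCellSpace` and `toFibreSpace` make the coordinates total and polynomial in
  -- the data; on the domain of the chart they change nothing.
  coord := fun z : tripleSet n m => (toCellSpace (by omega) (A⁻¹ * cellSection A z.1.2 - 1),
    toFibreSpace n m (n - m) ((cellSection A z.1.2)⁻¹ * z.1.1.1 * cellSection A z.1.2))
  isMorphism_toFun := isMorphism_iff.2 fun w => by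
    have h0 := (morphAt_prodSpace_iff (φ := fun w => w) (x := w)).1 MorphAt.id
    exact morphAt_tripleOf h ((RegMat.const A).mul ((RegMat.const 1).add
      (RegMat.of_morphAt (morphAt_submodule_iff.1 h0.1))))
      (RegMat.of_morphAt (morphAt_submodule_iff.1 h0.2)) _ _
  morphAt_coord z hz := by
    have hS : RegMat (X := tripleVariety h) (fun z : tripleSet n m => cellSection A z.1.2) z :=
      RegMat.comp (regMat_cellSection _ _ hz) ((isMorphism_tripleToFlag h).morphAt z)
    have hu := isUnit_cellSection (by omega) hA hz
    refine morphAt_prodSpace_iff.2 ⟨morphAt_submodule_iff.2 (morphAt_matrix_iff.2 ?_),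
      morphAt_submodule_iff.2 (morphAt_matrix_iff.2 ?_)⟩
    · have hX := ((RegMat.const A⁻¹).mul hS).sub (.const 1)
      exact (((RegMat.const _).mul hX).mul (.const _)).add
        (((RegMat.const _).mul hX).mul (.const _))
    · exact ((RegMat.const _).mul (((hS.inv hu).mul (regMat_tripleMatrix h z)).mul hS)).mul
        (.const _)
  toFun_mem w := (cellSection_cell (by omega) hA w.1.2 rfl rfl).1
  coord_toFun w := by
    obtain ⟨h1, h2⟩ := cellSection_cell (show m ≤ n - m by omega) hA w.1.2
      (fl := flagOf (by omega) (Nat.sub_le n m) ⟨_, isUnit_cell hA w.1.2⟩) rfl rfl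
    refine Prod.ext (Subtype.ext ?_) (Subtype.ext ?_)
    · refine (congrArg (fun S => (toCellSpace (show m ≤ n - m by omega) (A⁻¹ * S - 1)).1) h2).trans ?_
      rw [← mul_assoc, Matrix.nonsing_inv_mul _ hA, one_mul, add_sub_cancel_left,
        toCellSpace_of_mem _ w.1.2]
    · refine (congrArg (fun S => (toFibreSpace n m (n - m) (S⁻¹ *
        (A * (1 + w.1.1) * w.2.1 * (A * (1 + w.1.1))⁻¹) * S)).1) h2).trans ?_
      have h3 := Matrix.nonsing_inv_mul _ (isUnit_cell hA w.1.2)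
      clear h1 h2
      generalize A * (1 + w.1.1) = S at *
      have h4 : S⁻¹ * (S * w.2.1 * S⁻¹) * S = w.2.1 := by
        linear_combination (norm := noncomm_ring) h3 * w.2.1 * S⁻¹ * S + w.2.1 * h3
      rw [h4, toFibreSpace_of_mem w.2.2]
  toFun_coord := fun (z : tripleSet n m) (hz : z.1.2 ∈ cell n m (n - m) A) => by
    refine tripleOf_cellSection h hA z hz _ _ ?_ (toFibreSpace_of_mem
      (mem_fibreSpace_of_mem_cell h hA z hz))
    change A * (1 + (toCellSpace (show m ≤ n - m by omega) (A⁻¹ * cellSection A z.1.2 - 1)).1) = _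
    rw [toCellSpace_of_mem _ (inv_mul_cellSection (show m ≤ n - m by omega) hA hz),
      add_sub_cancel, ← mul_assoc, Matrix.mul_nonsing_inv _ hA, one_mul]

theorem exists_tripleChart (h : 2 * m ≤ n) (z : tripleVariety h) :
    ∃ A : Matrix (Fin n) (Fin n) ℂ, ∃ hA : IsUnit A.det, z ∈ (tripleChart h A hA).dom := by
  obtain ⟨A, hA, h1, h2⟩ := exists_colSpan_eq (tripleToFlag h z : Flag n m (n - m)).le
    (tripleToFlag h z : Flag n m (n - m)).dim₁ (tripleToFlag h z : Flag n m (n - m)).dim₂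
  exact ⟨A, hA, mem_cell_self hA h1 h2⟩

theorem isSmooth_tripleVariety (h : 2 * m ≤ n) : IsSmooth (tripleVariety h) := fun z => by
  obtain ⟨A, hA, hz⟩ := exists_tripleChart h z
  exact isRegularLocalRing_of_chart _ hz

end triples

end TwoColumn

end

noncomputable section

/-! ### Irreducibility of vector spaces and images of compact spaces -/

namespace FunSpace

/-- Vector spaces are irreducible: nonempty Zariski open subsets meet. -/
theorem exists_mem_inter_vectorSpace {W : Type} [AddCommGroup W] [Module ℂ W]
    [FiniteDimensional ℂ W] {O O' : Set (vectorSpace W)} (hO : IsOpen O) (hO' : IsOpen O')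
    {v w : W} (hv : v ∈ O) (hw : w ∈ O') : ∃ u : W, u ∈ O ∧ u ∈ O' := by
  let b := Module.finBasis ℂ W
  obtain ⟨f, hf, h1, h2⟩ := exists_basic_open hO hv
  obtain ⟨g, hg, h3, h4⟩ := exists_basic_open hO' hw
  obtain ⟨p, hp⟩ := exists_mvPolynomial b hf
  obtain ⟨q, hq⟩ := exists_mvPolynomial b hg
  have hp0 : p ≠ 0 := fun h => h1 (by rw [hp, h, map_zero])
  have hq0 : q ≠ 0 := fun h => h3 (by rw [hq, h, map_zero])
  by_contra! hcon
  -- If the two basic open sets were disjoint, the product of two nonzero polynomials would vanish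
  -- at every point.
  refine mul_ne_zero hp0 hq0 (MvPolynomial.funext fun x => ?_)
  obtain ⟨u, rfl⟩ : ∃ u : W, ⇑(b.repr u) = x :=
    ⟨b.equivFun.symm x, b.equivFun.apply_symm_apply x⟩
  rw [map_mul, ← hp, ← hq, map_zero]
  by_contra hne
  exact hcon u (h2 u (left_ne_zero_of_mul hne)) (h4 u (right_ne_zero_of_mul hne))

theorem IsMorphism.compactSpace {X Y : FunSpace} {φ : X → Y} (h : IsMorphism X Y φ)
    (hs : Function.Surjective φ) [CompactSpace X] : CompactSpace Y := by
  have hc := isCompact_range h.1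
  rwa [hs.range_eq, isCompact_univ_iff] at hc

theorem regAt_scalar (t : vectorSpace ℂ) : (vectorSpace ℂ).RegAt (fun s : ℂ => s) t :=
  regAt_linear LinearMap.id t

end FunSpace

namespace TwoColumn

open FunSpace

/-! ### Algebraic conditions for rank bounds and for inclusions of column spans -/

section rank

variable {n : ℕ}

/-- A frame `A` whose first `r` columns lie in `im g` satisfies `A * proj n r = g * Q`; take `P =
A⁻¹`. -/
theorem exists_mul_mul_eq_proj {g : Matrix (Fin n) (Fin n) ℂ} {r : ℕ} (hr : r ≤ g.rank) :
    ∃ P Q : Matrix (Fin n) (Fin n) ℂ, P * g * Q = proj n r := by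
  obtain ⟨U, -, hU, hUr⟩ := exists_between (bot_le : ⊥ ≤ im g) (k := r) (by simp) hr
  obtain ⟨A, hA, hA1, -⟩ := exists_colSpan_eq le_rfl hUr hUr
  rw [← hA1, colSpan_eq_im, im_le_im_iff] at hU
  obtain ⟨Q, hQ⟩ := hU
  refine ⟨A⁻¹, Q, ?_⟩
  rw [mul_assoc, ← hQ, ← mul_assoc, Matrix.nonsing_inv_mul _ hA, one_mul]

theorem le_rank_of_isUnit {X : Matrix (Fin n) (Fin n) ℂ} {r : ℕ} (hr : r ≤ n)
    (h : IsUnit (X + (1 - proj n r)).det) : r ≤ X.rank := by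
  have h1 : (X + (1 - proj n r)) * proj n r = X * proj n r := by
    linear_combination (norm := noncomm_ring) - proj_mul_self (n := n) r
  calc r = ((X + (1 - proj n r)) * proj n r).rank := by
        rw [Matrix.rank_mul_eq_right_of_isUnit_det _ _ h, rank_proj hr]
    _ = (X * proj n r).rank := by rw [h1]
    _ ≤ X.rank := Matrix.rank_mul_le_left _ _

/-- Being of rank at least `r` is a Zariski open condition. -/
theorem eventually_le_rank {X : FunSpace} {φ : X → Matrix (Fin n) (Fin n) ℂ} {x : X}
    (hφ : RegMat φ x) {r : ℕ} (hr : r ≤ (φ x).rank) : ∀ᶠ y in 𝓝 x, r ≤ (φ y).rank := by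
  obtain ⟨P, Q, hPQ⟩ := exists_mul_mul_eq_proj hr
  have hrn : r ≤ n := hr.trans (by simpa using Matrix.rank_le_card_width (φ x))
  -- This determinant equals `1` at `x`, and wherever it is nonzero the rank is at least `r`.
  have h1 : IsUnit (P * φ x * Q + (1 - proj n r)).det := by rw [hPQ]; simp
  filter_upwards [((((RegMat.const P).mul hφ).mul (.const Q)).add (.const _)).eventually_isUnit h1]
    with y hy
  calc r ≤ (P * φ y * Q).rank := le_rank_of_isUnit hrn hy
    _ ≤ (P * φ y).rank := Matrix.rank_mul_le_left _ _
    _ ≤ (φ y).rank := Matrix.rank_mul_le_right _ _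

/-- Read in the frame `S`, the first `k` columns of `S'` must have no components beyond the first
`k`. Inclusion thus becomes the vanishing of regular functions, which serves both separatedness and
the closedness of points of the grassmannian. -/
theorem colSpan_le_colSpan_iff {S S' : Matrix (Fin n) (Fin n) ℂ} (hS : IsUnit S.det) (k : ℕ) :
    colSpan S' k ≤ colSpan S k ↔ (1 - proj n k) * S⁻¹ * S' * proj n k = 0 := by
  rw [colSpan_eq_im, colSpan_eq_im, im_le_im_iff]
  have h1 := Matrix.mul_nonsing_inv _ hS
  have h2 := Matrix.nonsing_inv_mul _ hS
  have hE := proj_mul_self (n := n) k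
  constructor
  · rintro ⟨K, hK⟩
    linear_combination (norm := noncomm_ring) (1 - proj n k) * S⁻¹ * hK +
      (1 - proj n k) * h2 * proj n k * K - hE * K
  · intro h
    refine ⟨S⁻¹ * S' * proj n k, ?_⟩
    linear_combination (norm := noncomm_ring) S * h - h1 * S' * proj n k

end rank

/-! ### The orbit closure and the triples are varieties -/

section variety

variable {n m : ℕ}

theorem isClosed_orbitClosureSet (n m : ℕ) :
    IsClosed (X := matrixSpace n) (orbitClosureSet n m) := by
  refine isOpen_compl_iff.1 (isOpen_iff_mem_nhds.2
    fun (g : Matrix (Fin n) (Fin n) ℂ) hg => ?_)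
  have hr : RegMat (X := matrixSpace n) (fun g : Matrix (Fin n) (Fin n) ℂ => g) g :=
    RegMat.of_morphAt MorphAt.id
  by_cases h : g * g = 0
  · have h1 : m + 1 ≤ g.rank := by
      by_contra hlt
      exact hg ⟨h, by omega⟩
    filter_upwards [eventually_le_rank hr h1] with y hy hy'
    exact absurd hy'.2 (by omega)
  · obtain ⟨i, j, hij⟩ : ∃ i j, (g * g) i j ≠ 0 := by
      by_contra! hcon
      exact h (Matrix.ext hcon)
    filter_upwards [(matrixSpace n).ne_zero ((hr.mul hr) i j) hij] with y hy hy'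
    exact hy (congrFun (congrFun hy'.1 i) j)

theorem isVariety_orbitClosure (n m : ℕ) : IsVariety (orbitClosure n m) :=
  isVariety_sub (isClosed_orbitClosureSet n m)

/-- Pairs of a frame `A` and a matrix `g` with `im g` and `ker g` compatible with the flag
of `A`. -/
def frameSet (n m : ℕ) : Set (Matrix (Fin n) (Fin n) ℂ × Matrix (Fin n) (Fin n) ℂ) :=
  {w | IsUnit w.1.det ∧ w.1⁻¹ * w.2 * w.1 ∈ fibreSpace n m (n - m)}

/-- The triple of the flag of a frame and a matrix. -/
def frameToTriple (h : 2 * m ≤ n) (w : frameSet n m) : tripleSet n m :=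
  tripleOf h w.1.1 (w.1.1⁻¹ * w.1.2 * w.1.1) w.2.1 w.2.2

theorem isMorphism_frameToTriple (h : 2 * m ≤ n) :
    IsMorphism ((vectorSpace (Matrix (Fin n) (Fin n) ℂ × Matrix (Fin n) (Fin n) ℂ)).sub
      (frameSet n m)) (tripleVariety h) (frameToTriple h) := isMorphism_iff.2 fun w => by
  have h0 := morphAt_prodSpace_iff.1 ((isMorphism_val (vectorSpace (Matrix (Fin n) (Fin n) ℂ ×
    Matrix (Fin n) (Fin n) ℂ)) (frameSet n m)).morphAt w)
  have h1 := RegMat.of_morphAt h0.1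
  have h2 := RegMat.of_morphAt h0.2
  exact morphAt_tripleOf h h1 (((h1.inv (w : frameSet n m).2.1).mul h2).mul h1) _ _

theorem frameToTriple_eq (h : 2 * m ≤ n) (z : tripleSet n m) {A : Matrix (Fin n) (Fin n) ℂ}
    (hA : IsUnit A.det) (h₁ : colSpan A m = z.1.2.U₁) (h₂ : colSpan A (n - m) = z.1.2.U₂) :
    ∃ hw : (A, z.1.1.1) ∈ frameSet n m, frameToTriple h ⟨_, hw⟩ = z :=
  ⟨⟨hA, conj_mem_fibreSpace hA (z.2.1.trans h₁.ge) (h₂.le.trans z.2.2)⟩,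
    Subtype.ext (Prod.ext (Subtype.ext (conj_conj_inv hA)) (Flag.ext' h₁ h₂))⟩

/-- The triples are the image of `frameSet`, a subset of a vector space and hence a noetherian
space. -/
theorem compactSpace_tripleVariety (h : 2 * m ≤ n) : CompactSpace (tripleVariety h) := by
  have hn := noetherianSpace_sub (frameSet n m)
  have hs : Function.Surjective (frameToTriple h) := fun z => by
    obtain ⟨A, hA, h1, h2⟩ := exists_colSpan_eq z.1.2.le z.1.2.dim₁ z.1.2.dim₂
    obtain ⟨hw, h3⟩ := frameToTriple_eq h z hA h1 h2
    exact ⟨⟨_, hw⟩, h3⟩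
  exact (isMorphism_frameToTriple h).compactSpace hs

/-- Distinct flags, near two given ones, are separated by a regular function. -/
theorem exists_separating {a b : ℕ} (hab : a ≤ b) (hbn : b ≤ n) {Z : FunSpace}
    {φ ψ : Z → Flag n a b} {z : Z} (hφ : MorphAt Z (flagVariety hab hbn) φ z)
    (hψ : MorphAt Z (flagVariety hab hbn) ψ z) (hne : φ z ≠ ψ z) :
    ∃ f : Z → ℂ, Z.RegAt f z ∧ f z ≠ 0 ∧ ∀ᶠ y in 𝓝 z, φ y = ψ y → f y = 0 := by
  obtain ⟨A, hA, h1, h2⟩ := exists_colSpan_eq (φ z).le (φ z).dim₁ (φ z).dim₂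
  obtain ⟨A', hA', h1', h2'⟩ := exists_colSpan_eq (ψ z).le (ψ z).dim₁ (ψ z).dim₂
  have hc := mem_cell_self hA h1 h2
  have hc' := mem_cell_self hA' h1' h2'
  have hS : RegMat (fun y => cellSection A (φ y)) z :=
    RegMat.comp (regMat_cellSection hab hbn hc) hφ
  have hS' : RegMat (fun y => cellSection A' (ψ y)) z :=
    RegMat.comp (regMat_cellSection hab hbn hc') hψ
  have hu := isUnit_cellSection hab hA hc
  have hev : ∀ᶠ y in 𝓝 z, φ y ∈ cell n a b A ∧ ψ y ∈ cell n a b A' := by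
    filter_upwards [hφ.1 ((isOpen_cell hab hbn A).mem_nhds hc),
      hψ.1 ((isOpen_cell hab hbn A').mem_nhds hc')] with y h3 h4 using ⟨h3, h4⟩
  -- The separating function is a nonzero entry of the block that compares the local sections
  -- through the two flags; it vanishes where the flags coincide.
  have key : ∀ k, (∀ fl ∈ cell n a b A, ∀ fl' ∈ cell n a b A', fl = fl' →
        colSpan (cellSection A' fl') k ≤ colSpan (cellSection A fl) k) →
      ¬ colSpan (cellSection A' (ψ z)) k ≤ colSpan (cellSection A (φ z)) k →
      ∃ f : Z → ℂ, Z.RegAt f z ∧ f z ≠ 0 ∧ ∀ᶠ y in 𝓝 z, φ y = ψ y → f y = 0 := by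
    intro k hk hnot
    rw [colSpan_le_colSpan_iff hu] at hnot
    obtain ⟨i, j, hij⟩ : ∃ i j, ((1 - proj n k) * (cellSection A (φ z))⁻¹ *
        cellSection A' (ψ z) * proj n k) i j ≠ 0 := by
      by_contra! hcon
      exact hnot (Matrix.ext hcon)
    refine ⟨_, ((((RegMat.const _).mul (hS.inv hu)).mul hS').mul (.const (proj n k))) i j, hij, ?_⟩
    filter_upwards [hev] with y hy he
    have := (colSpan_le_colSpan_iff (isUnit_cellSection hab hA hy.1) k).1 (hk _ hy.1 _ hy.2 he)
    rw [this]
    rfl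
  have hs := fun fl hfl => colSpan_cellSection (fl := fl) hab hbn hA hfl
  have hs' := fun fl hfl => colSpan_cellSection (fl := fl) hab hbn hA' hfl
  by_cases he : (φ z).U₁ = (ψ z).U₁
  · refine key b (fun fl hfl fl' hfl' e => ?_) fun hle => hne (Flag.ext' he ?_)
    · rw [(hs _ hfl).2, (hs' _ hfl').2, e]
    · rw [(hs _ hc).2, (hs' _ hc').2] at hle
      exact (Submodule.eq_of_le_of_finrank_eq hle ((ψ z).dim₂.trans (φ z).dim₂.symm)).symm
  · refine key a (fun fl hfl fl' hfl' e => ?_) fun hle => he ?_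
    · rw [(hs _ hfl).1, (hs' _ hfl').1, e]
    · rw [(hs _ hc).1, (hs' _ hc').1] at hle
      exact (Submodule.eq_of_le_of_finrank_eq hle ((ψ z).dim₁.trans (φ z).dim₁.symm)).symm

theorem isVariety_tripleVariety (h : 2 * m ≤ n) : IsVariety (tripleVariety h) := by
  refine ⟨compactSpace_tripleVariety h, fun z => ?_, isClosed_diagonal fun z hz => ?_⟩
  · obtain ⟨A, hA, hz⟩ := exists_tripleChart h z
    exact ⟨_, (tripleChart h A hA).isOpen_dom, hz, (tripleChart h A hA).isAffineVariety⟩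
  · have h1 := (isMorphism_fst (tripleVariety h) (tripleVariety h)).morphAt z
    have h2 := (isMorphism_snd (tripleVariety h) (tripleVariety h)).morphAt z
    by_cases hg : tripleMatrix h z.1 = tripleMatrix h z.2
    · obtain ⟨f, hf, hfz, h0⟩ := exists_separating (Z := (tripleVariety h).prod (tripleVariety h))
        _ _ (((isMorphism_tripleToFlag h).morphAt _).comp h1)
        (((isMorphism_tripleToFlag h).morphAt _).comp h2)
        (fun he => hz (Subtype.ext (Prod.ext (Subtype.ext hg) he)))
      refine ⟨f, hf, hfz, ?_⟩
      filter_upwards [h0] with y hy e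
      exact hy (congrArg (tripleToFlag h) e)
    · obtain ⟨i, j, hij⟩ : ∃ i j, tripleMatrix h z.1 i j ≠ tripleMatrix h z.2 i j := by
        by_contra! hcon
        exact hg (Matrix.ext hcon)
      refine ⟨fun y => tripleMatrix h y.1 i j - tripleMatrix h y.2 i j,
        RegAt.sub (((regMat_tripleMatrix h _).comp h1) i j)
          (((regMat_tripleMatrix h _).comp h2) i j), sub_ne_zero.2 hij, .of_forall fun y e => ?_⟩
      exact sub_eq_zero.2 (by rw [e])

end variety

/-! ### Properness -/

section proper

variable {n m : ℕ}

open InnerProductSpace in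
-- Gram–Schmidt preserves the span of every initial segment of columns.
theorem exists_unitary_colSpan_eq {a b : ℕ} {U₁ U₂ : Submodule ℂ (Fin n → ℂ)} (hle : U₁ ≤ U₂)
    (h₁ : Module.finrank ℂ U₁ = a) (h₂ : Module.finrank ℂ U₂ = b) :
    ∃ A ∈ Matrix.unitaryGroup (Fin n) ℂ, colSpan A a = U₁ ∧ colSpan A b = U₂ := by
  obtain ⟨B, hB, hB1, hB2⟩ := exists_colSpan_eq hle h₁ h₂
  have hbn : b ≤ n := by
    rw [← h₂]
    simpa using Submodule.finrank_le U₂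
  have han : a ≤ n := by
    rw [← h₁]
    simpa using Submodule.finrank_le U₁
  let L := (WithLp.linearEquiv 2 ℂ (Fin n → ℂ))
  let f : Fin n → EuclideanSpace ℂ (Fin n) := fun j => L.symm (B.col j)
  have hf : LinearIndependent ℂ f :=
    (Matrix.linearIndependent_cols_iff_isUnit.2 ((Matrix.isUnit_iff_isUnit_det B).2 hB)).map'
      L.symm.toLinearMap L.symm.ker
  let u := gramSchmidtNormed ℂ f
  have hu : Orthonormal ℂ u := gramSchmidtNormed_orthonormal hf
  let A : Matrix (Fin n) (Fin n) ℂ := Matrix.of fun i j => u j i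
  have hA : A ∈ Matrix.unitaryGroup (Fin n) ℂ := by
    rw [Matrix.mem_unitaryGroup_iff']
    ext i j
    have := orthonormal_iff_ite.1 hu i j
    rw [Matrix.one_apply, ← this, Matrix.mul_apply, PiLp.inner_apply]
    refine Finset.sum_congr rfl fun k _ => ?_
    simp [A, Matrix.star_apply, mul_comm]
  have hdet : IsUnit A.det := isUnit_det_of_mul_eq_one ((Matrix.mem_unitaryGroup_iff).1 hA)
  have key : ∀ k, k ≤ n → colSpan A k = colSpan B k := fun k hk => by
    refine Submodule.eq_of_le_of_finrank_eq (Submodule.span_le.2 ?_)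
      ((finrank_colSpan hdet hk).trans (finrank_colSpan hB hk).symm)
    rintro _ ⟨j, hj, rfl⟩
    have h3 : u j ∈ Submodule.span ℂ (f '' Set.Iic j) :=
      Submodule.smul_mem _ _ (gramSchmidt_mem_span ℂ f le_rfl)
    have h4 : L (u j) ∈ (Submodule.span ℂ (f '' Set.Iic j)).map L.toLinearMap :=
      Submodule.mem_map_of_mem h3
    rw [Submodule.map_span] at h4
    refine Submodule.span_mono ?_ h4
    rintro _ ⟨_, ⟨i, hi, rfl⟩, rfl⟩
    exact ⟨i, lt_of_le_of_lt (Fin.le_def.1 hi) hj, (L.apply_symm_apply _).symm⟩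
  exact ⟨A, hA, (key a han).trans hB1, (key b hbn).trans hB2⟩

theorem isCompact_unitaryGroup (n : ℕ) :
    IsCompact (Matrix.unitaryGroup (Fin n) ℂ : Set (Matrix (Fin n) (Fin n) ℂ)) := by
  have h1 : IsCompact (Set.univ.pi fun _ => Set.univ.pi fun _ => Metric.closedBall 0 1 :
      Set (Fin n → Fin n → ℂ)) :=
    isCompact_univ_pi fun _ => isCompact_univ_pi fun _ => isCompact_closedBall 0 1
  refine IsCompact.of_isClosed_subset (X := Matrix (Fin n) (Fin n) ℂ) h1 ?_ fun A hA i _ j _ => ?_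
  · have h2 : (Matrix.unitaryGroup (Fin n) ℂ : Set (Matrix (Fin n) (Fin n) ℂ)) =
        {A | A * star A = 1} := Set.ext fun A => Matrix.mem_unitaryGroup_iff
    rw [h2]
    exact isClosed_eq (by fun_prop) continuous_const
  · simpa using entry_norm_bound_of_unitary hA i j

theorem isClosed_fibreSpace (n a b : ℕ) :
    IsClosed (fibreSpace n a b : Set (Matrix (Fin n) (Fin n) ℂ)) :=
  Submodule.closed_of_finiteDimensional _

/-- The set `C` of compatible pairs (unitary frame, matrix) is closed, and its projection to
matrices is proper because the unitary group is compact. This projection factors through the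
continuous surjection `f` from `C` to the triples, so properness descends to `p`. -/
theorem isProper_tripleProj (h : 2 * m ≤ n) :
    IsProper (tripleVariety h) (orbitClosure n m) (tripleProj h) := by
  have hK : CompactSpace (Matrix.unitaryGroup (Fin n) ℂ) :=
    isCompact_iff_compactSpace.1 (isCompact_unitaryGroup n)
  let C : Set (Matrix.unitaryGroup (Fin n) ℂ × Matrix (Fin n) (Fin n) ℂ) :=
    {w | star w.1.1 * w.2 * w.1.1 ∈ fibreSpace n m (n - m)}
  have hC : IsClosed C := (isClosed_fibreSpace n m (n - m)).preimage (by fun_prop)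
  have hinv : ∀ w : Matrix.unitaryGroup (Fin n) ℂ × Matrix (Fin n) (Fin n) ℂ, w.1.1⁻¹ = star w.1.1 :=
    fun w =>
    Matrix.inv_eq_right_inv (Matrix.mem_unitaryGroup_iff.1 w.1.2)
  have hCf : ∀ w : C, (w.1.1.1, w.1.2) ∈ frameSet n m := fun w =>
    ⟨isUnit_det_of_mul_eq_one (Matrix.mem_unitaryGroup_iff.1 w.1.1.2), by
      rw [hinv w.1]; exact w.2⟩
  let f : C → tripleSet n m := fun w => frameToTriple h ⟨_, hCf w⟩
  have hf : @Continuous C (tripleVariety h) _ (tripleVariety h).classicalTop f := by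
    have h1 := (isMorphism_frameToTriple h).continuous_classicalTop
    rw [classicalTop_sub_vectorSpace] at h1
    exact @Continuous.comp C (frameSet n m) (tripleVariety h) _ instTopologicalSpaceSubtype
      (tripleVariety h).classicalTop _ _ h1
      (Continuous.subtype_mk (by fun_prop) _)
  have hmat : ∀ w, (f w).1.1.1 = w.1.2 := fun w => conj_conj_inv (hCf w).1
  have hpf : @IsProperMap C (orbitClosure n m) _ (orbitClosure n m).classicalTop
      (fun w => tripleProj h (f w)) := by
    have e : (orbitClosure n m).classicalTop = _ :=
      classicalTop_sub_vectorSpace (orbitClosureSet n m)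
    rw [e]
    have h2 : IsProperMap (fun w : C => w.1.2) :=
      (isProperMap_snd_of_compactSpace (X := Matrix.unitaryGroup (Fin n) ℂ)
        (Y := Matrix (Fin n) (Fin n) ℂ)).restrict hC
    have h3 : (fun w : C => w.1.2) = (fun g : orbitClosureSet n m => g.1) ∘
        (fun w => (f w).1.1) := funext fun w => (hmat w).symm
    refine isProperMap_of_comp_of_inj (Y := orbitClosureSet n m)
      (g := fun g : orbitClosureSet n m => g.1) ?_
      continuous_subtype_val (h3 ▸ h2) Subtype.val_injective
    exact continuous_induced_rng.2 (h3 ▸ h2.continuous)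
  refine @isProperMap_of_comp_of_surj _ _ _ _ (tripleVariety h).classicalTop
    (orbitClosure n m).classicalTop f (tripleProj h) hf
    (isMorphism_tripleProj h).continuous_classicalTop hpf fun z => ?_
  obtain ⟨A, hA, h1, h2⟩ := exists_unitary_colSpan_eq z.1.2.le z.1.2.dim₁ z.1.2.dim₂
  obtain ⟨hw, h3⟩ := frameToTriple_eq h z
    (isUnit_det_of_mul_eq_one (Matrix.mem_unitaryGroup_iff.1 hA)) h1 h2
  refine ⟨⟨(⟨A, hA⟩, z.1.1.1), ?_⟩, h3⟩
  have h4 := hw.2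
  rwa [Matrix.inv_eq_right_inv (Matrix.mem_unitaryGroup_iff.1 hA)] at h4

end proper

end TwoColumn

end

noncomputable section

namespace TwoColumn

open FunSpace

section birational

variable {n m : ℕ}

/-! ### The stratum of matrices of rank `m` -/

/-- The square zero matrices of rank exactly `m`. -/
def rankStratum (n m : ℕ) : Set (orbitClosureSet n m) := {g | m ≤ g.1.rank}

theorem rank_of_mem_rankStratum {g : orbitClosureSet n m} (hg : g ∈ rankStratum n m) :
    g.1.rank = m := le_antisymm g.2.2 hg

theorem regMat_orbitClosure (g : orbitClosure n m) :
    RegMat (X := orbitClosure n m) (fun g : orbitClosureSet n m => g.1) g :=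
  RegMat.of_morphAt ((isMorphism_val (matrixSpace n) (orbitClosureSet n m)).morphAt g)

theorem isOpen_rankStratum (n m : ℕ) : IsOpen (X := orbitClosure n m) (rankStratum n m) :=
  isOpen_iff_mem_nhds.2 fun g hg => eventually_le_rank (regMat_orbitClosure g) hg

/-- The flag `im g ⊆ ker g` of a square zero matrix of rank `m`. -/
def flagOfMatrix (g : Matrix (Fin n) (Fin n) ℂ) (h0 : g * g = 0) (hr : g.rank = m) :
    Flag n m (n - m) where
  U₁ := im g
  U₂ := ker g
  le := im_le_ker_iff.2 h0
  dim₁ := hr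
  dim₂ := by
    have := rank_add_finrank_ker g
    omega

/-- At rank `m` both inclusions `im g ⊆ U₁` and `U₂ ⊆ ker g` are between spaces of equal dimension.
-/
theorem flag_eq_flagOfMatrix {z : tripleSet n m}
    (hz : z.1.1 ∈ rankStratum n m) :
    z.1.2 = flagOfMatrix z.1.1.1 z.1.1.2.1 (rank_of_mem_rankStratum hz) := by
  have hr := rank_of_mem_rankStratum hz
  refine Flag.ext' (Submodule.eq_of_le_of_finrank_eq z.2.1 (hr.trans z.1.2.dim₁.symm)).symm
    (Submodule.eq_of_le_of_finrank_eq z.2.2 ?_)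
  have := rank_add_finrank_ker z.1.1.1
  rw [z.1.2.dim₂]
  change _ = Module.finrank ℂ (ker z.1.1.1)
  omega

/-- A generalized inverse of the upper right block of `x`. -/
def blockInverse (n m : ℕ) (Q x : Matrix (Fin n) (Fin n) ℂ) : Matrix (Fin n) (Fin n) ℂ :=
  Q * (proj n m * x * Q + (1 - proj n m))⁻¹ * proj n m

/-- A frame adapted to the flag `im x ⊆ ker x`, for `x` near a matrix in `fibreSpace`. -/
def frameMatrix (n m : ℕ) (Q x : Matrix (Fin n) (Fin n) ℂ) : Matrix (Fin n) (Fin n) ℂ :=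
  x * blockInverse n m Q x + (1 - blockInverse n m Q x * x) * (proj n (n - m) - proj n m) +
    (1 - proj n (n - m))

theorem mul_blockInverse {Q x : Matrix (Fin n) (Fin n) ℂ}
    (hu : IsUnit (proj n m * x * Q + (1 - proj n m)).det) :
    proj n m * x * blockInverse n m Q x = proj n m := by
  have h1 := Matrix.mul_nonsing_inv _ hu
  have hE := proj_mul_self (n := n) m
  rw [blockInverse]
  generalize (proj n m * x * Q + (1 - proj n m))⁻¹ = N at *
  generalize proj n m = E at *
  linear_combination (norm := noncomm_ring) E * h1 * E - hE * x * Q * N * E + hE * N * E + hE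

/-- Let `c` be the block inverse and `E = proj n m`. From `E * x * c = E` and `c * E = c`, the
matrix `x * c` is idempotent of rank at least `m`, so its image is all of `im x` and `x * c * x =
x`. Hence `x * c` supplies columns spanning `im x`, while `1 - c * x` supplies vectors of `ker x`.
-/
theorem frameMatrix_spec (h : 2 * m ≤ n) {Q x : Matrix (Fin n) (Fin n) ℂ} (h0 : x * x = 0)
    (hr : x.rank = m) (hu : IsUnit (proj n m * x * Q + (1 - proj n m)).det) :
    (∃ K, frameMatrix n m Q x * proj n m = x * K) ∧
    (∃ K, x = frameMatrix n m Q x * proj n m * K) ∧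
    x * frameMatrix n m Q x * proj n (n - m) = 0 := by
  have h1 := mul_blockInverse hu
  have hE := proj_mul_self (n := n) m
  have hF := proj_mul_self (n := n) (n - m)
  have hEF := proj_mul_of_le (n := n) (show m ≤ n - m by omega)
  have hFE := proj_mul_of_ge (n := n) (show m ≤ n - m by omega)
  have h2 : blockInverse n m Q x * proj n m = blockInverse n m Q x := by
    rw [blockInverse, mul_assoc, hE]
  have h3 : x * blockInverse n m Q x * x = x := by
    have h4 : im (x * blockInverse n m Q x) = im x := by
      refine Submodule.eq_of_le_of_finrank_le (im_le_im_iff.2 ⟨_, rfl⟩) ?_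
      rw [finrank_im, finrank_im, hr]
      calc m = (proj n m * (x * blockInverse n m Q x)).rank := by
            rw [← mul_assoc, h1, rank_proj (by omega)]
        _ ≤ _ := Matrix.rank_mul_le_right _ _
    obtain ⟨K, hK⟩ := im_le_im_iff.1 h4.ge
    generalize blockInverse n m Q x = c at *
    linear_combination (norm := noncomm_ring) x * c * hK - hK + x * c * h1 * K -
      x * h2 * x * c * K + x * h2 * K
  have h5 : frameMatrix n m Q x * proj n m = x * blockInverse n m Q x := by
    rw [frameMatrix]
    generalize blockInverse n m Q x = c at *
    linear_combination (norm := noncomm_ring) x * h2 + (1 - c * x) * (hFE - hE) - hFE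
  refine ⟨⟨_, h5⟩, ⟨x, by rw [h5, h3]⟩, ?_⟩
  rw [frameMatrix]
  generalize blockInverse n m Q x = c at *
  linear_combination (norm := noncomm_ring) h0 * c * proj n (n - m) -
    h3 * (proj n (n - m) - proj n m) * proj n (n - m) - x * hF

theorem colSpan_frameMatrix (h : 2 * m ≤ n) {A Q g : Matrix (Fin n) (Fin n) ℂ}
    (hA : IsUnit A.det) (h0 : g * g = 0) (hr : g.rank = m)
    (hu : IsUnit (proj n m * (A⁻¹ * g * A) * Q + (1 - proj n m)).det)
    (hf : IsUnit (A * frameMatrix n m Q (A⁻¹ * g * A)).det) :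
    colSpan (A * frameMatrix n m Q (A⁻¹ * g * A)) m = im g ∧
      colSpan (A * frameMatrix n m Q (A⁻¹ * g * A)) (n - m) = ker g := by
  have hA1 := Matrix.mul_nonsing_inv _ hA
  obtain ⟨⟨K, hK⟩, ⟨L, hL⟩, hk⟩ := frameMatrix_spec (Q := Q) (x := A⁻¹ * g * A) h
    (by linear_combination (norm := noncomm_ring) A⁻¹ * g * hA1 * g * A + A⁻¹ * h0 * A)
    (by rw [Matrix.rank_mul_eq_left_of_isUnit_det _ _ hA,
      Matrix.rank_mul_eq_right_of_isUnit_det _ _ (Matrix.isUnit_nonsing_inv_det _ hA), hr]) hu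
  generalize frameMatrix n m Q (A⁻¹ * g * A) = a at *
  constructor
  · rw [colSpan_eq_im]
    refine le_antisymm (im_le_im_iff.2 ⟨A * K, ?_⟩) (im_le_im_iff.2 ⟨L * A⁻¹, ?_⟩)
    · linear_combination (norm := noncomm_ring) A * hK + hA1 * g * A * K
    · linear_combination (norm := noncomm_ring) A * hL * A⁻¹ - hA1 * g * A * A⁻¹ - g * hA1
  · refine Submodule.eq_of_le_of_finrank_eq ?_ ?_
    · rw [colSpan_eq_im, im_le_ker_iff]
      linear_combination (norm := noncomm_ring) A * hk - hA1 * g * A * a * proj n (n - m)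
    · have := rank_add_finrank_ker g
      rw [finrank_colSpan hf (Nat.sub_le n m)]
      omega

/-- The flag `im g ⊆ ker g` depends algebraically on `g` in the stratum of rank `m`. -/
theorem morphAt_flagOfMatrix (h : 2 * m ≤ n) {X : FunSpace} {φ : X → Matrix (Fin n) (Fin n) ℂ}
    {x : X} (hφ : RegMat φ x) (h0 : ∀ y, φ y * φ y = 0) (hr : ∀ y, (φ y).rank = m) :
    MorphAt X (flagBase h) (fun y => flagOfMatrix (φ y) (h0 y) (hr y)) x := by
  obtain ⟨A, hA, hA1, hA2⟩ := exists_colSpan_eq (flagOfMatrix (φ x) (h0 x) (hr x)).le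
    (flagOfMatrix (φ x) (h0 x) (hr x)).dim₁ (flagOfMatrix (φ x) (h0 x) (hr x)).dim₂
  change colSpan A m = im (φ x) at hA1
  change colSpan A (n - m) = ker (φ x) at hA2
  have hAA := Matrix.mul_nonsing_inv _ hA
  have hAA' := Matrix.nonsing_inv_mul _ hA
  obtain ⟨hc1, hc2⟩ := conj_mem_fibreSpace hA hA1.ge hA2.le
  rw [colSpan_eq_im] at hA1
  obtain ⟨K, hK⟩ := im_le_im_iff.1 hA1.le
  have hE := proj_mul_self (n := n) m
  have hF := proj_mul_self (n := n) (n - m)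
  have hFE := proj_mul_of_ge (n := n) (show m ≤ n - m by omega)
  have hEF := proj_mul_of_le (n := n) (show m ≤ n - m by omega)
  -- Since `A * proj n m = φ x * K`, this `Q` is a right inverse of the upper right block of `A⁻¹ *
  -- φ x * A`. At `x` the matrix to be inverted and the frame matrix both become `1`, so near `x`
  -- they stay invertible.
  obtain ⟨Q, hQ⟩ : ∃ Q, Q = (1 - proj n (n - m)) * A⁻¹ * K * proj n m := ⟨_, rfl⟩
  have hcQ : A⁻¹ * φ x * A * Q = proj n m := by
    rw [hQ]
    linear_combination (norm := noncomm_ring) - hc2 * A⁻¹ * K * proj n m +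
      A⁻¹ * φ x * hAA * K * proj n m - A⁻¹ * hK * proj n m + hAA' * proj n m * proj n m + hE
  have e1 : proj n m * (A⁻¹ * φ x * A) * Q + (1 - proj n m) = 1 := by
    linear_combination (norm := noncomm_ring) proj n m * hcQ + hE
  have e2 : frameMatrix n m Q (A⁻¹ * φ x * A) = 1 := by
    rw [frameMatrix, blockInverse, e1, inv_one]
    generalize A⁻¹ * φ x * A = c at *
    have hcE : c * proj n m = 0 := by
      linear_combination (norm := noncomm_ring) hc2 * proj n m - c * hFE
    linear_combination (norm := noncomm_ring) hcQ * proj n m + hE -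
      Q * proj n m * hc2 + Q * proj n m * hcE
  have hu1 : IsUnit (proj n m * (A⁻¹ * φ x * A) * Q + (1 - proj n m)).det := by rw [e1]; simp
  have hu2 : IsUnit (A * frameMatrix n m Q (A⁻¹ * φ x * A)).det := by rwa [e2, mul_one]
  have hx : RegMat (fun y => A⁻¹ * φ y * A) x := ((RegMat.const _).mul hφ).mul (.const _)
  have hM : RegMat (fun y => proj n m * (A⁻¹ * φ y * A) * Q + (1 - proj n m)) x :=
    (((RegMat.const _).mul hx).mul (.const _)).add (.const _)
  have hb : RegMat (fun y => blockInverse n m Q (A⁻¹ * φ y * A)) x :=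
    ((RegMat.const _).mul (hM.inv hu1)).mul (.const _)
  have hf : RegMat (fun y => A * frameMatrix n m Q (A⁻¹ * φ y * A)) x :=
    (RegMat.const _).mul (((hx.mul hb).add
      (((RegMat.const _).sub (hb.mul hx)).mul (.const _))).add (.const _))
  refine morphAt_flagVariety _ _ hf hu2 ?_
  filter_upwards [hM.eventually_isUnit hu1, hf.eventually_isUnit hu2] with y h1 h2
  exact colSpan_frameMatrix h hA (h0 y) (hr y) h1 h2

theorem isIsoOver_rankStratum (h : 2 * m ≤ n) :
    IsIsoOver (tripleVariety h) (orbitClosure n m) (tripleProj h) (rankStratum n m) := by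
  let inv : rankStratum n m → tripleSet n m := fun g =>
    ⟨(g.1, flagOfMatrix g.1.1 g.1.2.1 (rank_of_mem_rankStratum g.2)), le_rfl, le_rfl⟩
  let e : (tripleProj h ⁻¹' rankStratum n m : Set (tripleSet n m)) ≃ rankStratum n m :=
    { toFun := fun z => ⟨z.1.1.1, z.2⟩
      invFun := fun g => ⟨inv g, g.2⟩
      left_inv := fun z => Subtype.ext (Subtype.ext (Prod.ext rfl (flag_eq_flagOfMatrix z.2).symm))
      right_inv := fun g => rfl }
  refine ⟨e, ⟨?_, ?_⟩, fun x hx => rfl⟩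
  · exact isMorphism_sub_iff.2 ((isMorphism_tripleProj h).comp (isMorphism_val _ _))
  · refine isMorphism_sub_iff.2 (isMorphism_iff.2 fun g => ?_)
    have hreg : RegMat (X := (orbitClosure n m).sub (rankStratum n m))
        (fun g : rankStratum n m => g.1.1) g :=
      (regMat_orbitClosure _).comp ((isMorphism_val (orbitClosure n m) (rankStratum n m)).morphAt g)
    exact morphAt_tripleVariety h hreg (morphAt_flagOfMatrix h hreg
      (fun g : rankStratum n m => g.1.2.1) fun g : rankStratum n m => rank_of_mem_rankStratum g.2)

/-! ### Density -/

/-- A matrix of rank `m` in `fibreSpace n m (n - m)`. -/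
def antiDiag (n m : ℕ) : Matrix (Fin n) (Fin n) ℂ :=
  Matrix.of fun i j => if i.val < m ∧ j = i.rev then 1 else 0

theorem antiDiag_mem (n m : ℕ) : antiDiag n m ∈ fibreSpace n m (n - m) := by
  constructor
  · ext i j
    by_cases hi : i.val < m <;> simp [proj, antiDiag, Matrix.diagonal_mul, hi]
  · ext i j
    simp only [proj, antiDiag, Matrix.mul_diagonal, Matrix.of_apply, Matrix.zero_apply]
    by_cases hi : i.val < m ∧ j = i.rev
    · obtain ⟨h1, rfl⟩ := hi
      have : ¬ (i.rev).val < n - m := by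
        rw [Fin.val_rev]
        omega
      rw [if_neg this, mul_zero]
    · simp [hi]

/-- The factor `antiDiag n n` is the permutation matrix reversing the coordinates; the identity
certifies that `antiDiag n m` has rank at least `m` when `m ≤ n`. -/
theorem antiDiag_mul (n m : ℕ) : antiDiag n m * antiDiag n n = proj n m := by
  ext i j
  rw [Matrix.mul_apply, Finset.sum_eq_single i.rev]
  · by_cases hi : i.val < m <;> by_cases hij : i = j <;>
      simp [antiDiag, proj, hi, hij, eq_comm]
  · intro k _ hk
    simp [antiDiag, hk]
  · simp

/-- The triples over matrices of rank `m` are dense; in fact they meet every line through the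
`antiDiag` direction in a fibre. -/
theorem dense_preimage_rankStratum (h : 2 * m ≤ n) :
    Dense (X := tripleVariety h) (tripleProj h ⁻¹' rankStratum n m) := by
  refine dense_iff_inter_open.2 fun O hO ⟨z, hz⟩ => ?_
  change tripleSet n m at z
  obtain ⟨A, hA, h1, h2⟩ := exists_colSpan_eq z.1.2.le z.1.2.dim₁ z.1.2.dim₂
  have hc := conj_mem_fibreSpace hA (z.2.1.trans h1.ge) (h2.le.trans z.2.2)
  obtain ⟨c, hcdef⟩ : ∃ c, c = A⁻¹ * z.1.1.1 * A := ⟨_, rfl⟩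
  rw [← hcdef] at hc
  have hct : ∀ t : ℂ, c + t • antiDiag n m ∈ fibreSpace n m (n - m) := fun t =>
    add_mem hc (Submodule.smul_mem _ t (antiDiag_mem n m))
  let γ : ℂ → tripleSet n m := fun t => tripleOf h A (c + t • antiDiag n m) hA (hct t)
  have hγ : IsMorphism (vectorSpace ℂ) (tripleVariety h) γ := isMorphism_iff.2 fun t =>
    morphAt_tripleOf h (.const A) ((RegMat.const c).add fun i j =>
      (vectorSpace ℂ).mul (regAt_scalar t) ((vectorSpace ℂ).const _ t)) _ _
  have h0 : γ 0 ∈ O := by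
    refine Eq.subst (motive := (· ∈ O)) (a := z) (Eq.symm ?_) hz
    refine Subtype.ext (Prod.ext (Subtype.ext ?_) (Flag.ext' h1 h2))
    change A * (c + (0 : ℂ) • antiDiag n m) * A⁻¹ = z.1.1.1
    rw [zero_smul, add_zero, hcdef, conj_conj_inv hA]
  let B := c * antiDiag n n
  -- Because `(c + t • antiDiag n m) * antiDiag n n = proj n m * (B + t • 1)`, invertibility of `B +
  -- t • 1` forces rank at least `m` at the parameter `t`.
  let D : Set ℂ := {t | IsUnit (B + t • (1 : Matrix (Fin n) (Fin n) ℂ)).det}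
  have hD : IsOpen (X := vectorSpace ℂ) D := isOpen_iff_mem_nhds.2 fun t ht =>
    RegMat.eventually_isUnit (X := vectorSpace ℂ) ((RegMat.const B).add fun i j =>
      (vectorSpace ℂ).mul (regAt_scalar t) ((vectorSpace ℂ).const _ t)) ht
  obtain ⟨t₀, ht₀⟩ : ∃ t, t ∈ D := by
    -- Any `t` that is not an eigenvalue of `-B` works.
    obtain ⟨t, ht⟩ : ∃ t, (Matrix.charpoly (-B)).eval t ≠ 0 := by
      by_contra! hcon
      exact (Matrix.charpoly_monic (-B)).ne_zero (Polynomial.funext fun t => by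
        rw [hcon, Polynomial.eval_zero])
    refine ⟨t, ?_⟩
    rw [Matrix.eval_charpoly] at ht
    refine isUnit_iff_ne_zero.2 ?_
    convert ht using 2
    rw [sub_neg_eq_add, add_comm, Matrix.smul_one_eq_diagonal]
    rfl
  obtain ⟨t, ht, htD⟩ := exists_mem_inter_vectorSpace (hO.preimage hγ.1) hD h0 ht₀
  refine ⟨γ t, ht, ?_⟩
  have hE := proj_mul_self (n := n) m
  have e : proj n m * (B + t • 1) = (c + t • antiDiag n m) * antiDiag n n := by
    rw [mul_add, add_mul, ← mul_assoc, hc.1, Matrix.mul_smul, mul_one, Matrix.smul_mul,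
      antiDiag_mul]
  change m ≤ (A * (c + t • antiDiag n m) * A⁻¹).rank
  rw [Matrix.rank_mul_eq_left_of_isUnit_det _ _ (Matrix.isUnit_nonsing_inv_det _ hA),
    Matrix.rank_mul_eq_right_of_isUnit_det _ _ hA]
  calc m = (proj n m * (B + t • 1)).rank := by
        rw [Matrix.rank_mul_eq_left_of_isUnit_det _ _ htD, rank_proj (by omega)]
    _ ≤ _ := by
        rw [e]
        exact Matrix.rank_mul_le_left _ _

/-- There is room for the flag between `im g` and `ker g`, since `g.rank ≤ m ≤ n - m ≤ n - g.rank`.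
-/
theorem tripleProj_surjective (h : 2 * m ≤ n) : Function.Surjective (tripleProj h) := by
  intro g
  change orbitClosureSet n m at g
  have h1 := rank_add_finrank_ker g.1
  have h2 := g.2.2
  obtain ⟨U₁, h3, h4, h5⟩ := exists_between (im_le_ker_iff.2 g.2.1) (k := m)
    h2 (by omega)
  obtain ⟨U₂, h6, h7, h8⟩ := exists_between h4 (k := n - m) (by omega) (by omega)
  exact ⟨(⟨(g, ⟨U₁, U₂, h6, h5, h8⟩), h3, h7⟩ : tripleSet n m), rfl⟩

theorem isBirational_tripleProj (h : 2 * m ≤ n) :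
    IsBirational (tripleVariety h) (orbitClosure n m) (tripleProj h) := by
  refine ⟨rankStratum n m, isOpen_rankStratum n m, ?_, dense_preimage_rankStratum h,
    isIsoOver_rankStratum h⟩
  -- Density of the rank `m` stratum below follows from density above, by pushing forward along a
  -- continuous surjection.
  have := (tripleProj_surjective h).denseRange.dense_image (isMorphism_tripleProj h).1
    (dense_preimage_rankStratum h)
  exact this.mono (Set.image_preimage_subset _ _)

theorem isResolution_tripleProj (h : 2 * m ≤ n) :
    IsResolution (tripleVariety h) (orbitClosure n m) (tripleProj h) where
  source := isVariety_tripleVariety h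
  target := isVariety_orbitClosure n m
  smooth := isSmooth_tripleVariety h
  morphism := isMorphism_tripleProj h
  proper := isProper_tripleProj h
  birational := isBirational_tripleProj h

end birational

end TwoColumn

end

noncomputable section

namespace TwoColumn

open FunSpace

/-! ### Comparison with cotangent bundles of grassmannians -/

section cotangent

variable {n m : ℕ}

/-- Needed so that a morphism from the affine line that is constant off `0` is constant. -/
theorem isClosed_grassmannian_point {k : ℕ} (hk : k ≤ n) {A : Matrix (Fin n) (Fin n) ℂ}
    (hA : IsUnit A.det) :
    IsClosed (X := grassmannian hk) {y : GrPoint n k | y.U = colSpan A k} := by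
  refine isOpen_compl_iff.1 (isOpen_final fun _ => isOpen_iff_mem_nhds.2 fun B hB => ?_)
  change {A : Matrix (Fin n) (Fin n) ℂ | IsUnit A.det} at B
  have h1 : ¬ colSpan B.1 k ≤ colSpan A k := fun hle => hB
    (Submodule.eq_of_le_of_finrank_eq hle
      ((finrank_colSpan B.2 hk).trans (finrank_colSpan hA hk).symm))
  rw [colSpan_le_colSpan_iff hA] at h1
  obtain ⟨i, j, hij⟩ : ∃ i j, ((1 - proj n k) * A⁻¹ * B.1 * proj n k) i j ≠ 0 := by
    by_contra! hcon
    exact h1 (Matrix.ext hcon)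
  filter_upwards [(generalLinear n).ne_zero ((((RegMat.const _).mul (regMat_generalLinear B)).mul
    (.const _)) i j) hij] with C hC hC'
  exact hC (congrFun (congrFun ((colSpan_le_colSpan_iff hA k).1 (le_of_eq hC')) i) j)

theorem rank_smul_antiDiag (h : m ≤ n) {A : Matrix (Fin n) (Fin n) ℂ} (hA : IsUnit A.det) {t : ℂ}
    (ht : t ≠ 0) : m ≤ (A * (t • antiDiag n m) * A⁻¹).rank := by
  rw [Matrix.rank_mul_eq_left_of_isUnit_det _ _ (Matrix.isUnit_nonsing_inv_det _ hA),
    Matrix.rank_mul_eq_right_of_isUnit_det _ _ hA]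
  calc m = ((t • antiDiag n m) * (t⁻¹ • antiDiag n n)).rank := by
        rw [Matrix.smul_mul, Matrix.mul_smul, smul_smul, mul_inv_cancel₀ ht, one_smul,
          antiDiag_mul, rank_proj h]
    _ ≤ _ := Matrix.rank_mul_le_left _ _

/-- An isomorphism over the orbit closure to `T^* Gr(k, V)` is `(0, U₁, U₂) ↦ (0, U₁)` or
`(0, U₁, U₂) ↦ (0, U₂)` over `0`, since it is so over the matrices of rank `m`. -/
theorem cotangent_subspace_eq (h : 2 * m ≤ n) {k : ℕ} (hk : k ≤ n) (hkm : k = m ∨ k = n - m)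
    {e : tripleSet n m → pairSet n m k}
    (he : IsMorphism (tripleVariety h) (cotangentVariety m hk) e)
    (hp : ∀ z, (e z).1.1 = z.1.1) {A : Matrix (Fin n) (Fin n) ℂ} (hA : IsUnit A.det) :
    (e (tripleOf h A 0 hA (zero_mem _))).1.2.U = colSpan A k := by
  have hct : ∀ t : ℂ, t • antiDiag n m ∈ fibreSpace n m (n - m) := fun t =>
    Submodule.smul_mem _ t (antiDiag_mem n m)
  let γ : ℂ → tripleSet n m := fun t => tripleOf h A (t • antiDiag n m) hA (hct t)
  have hγ : IsMorphism (vectorSpace ℂ) (tripleVariety h) γ := isMorphism_iff.2 fun t =>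
    morphAt_tripleOf h (.const A) (fun i j =>
      (vectorSpace ℂ).mul (regAt_scalar t) ((vectorSpace ℂ).const _ t)) _ _
  have hδ : IsMorphism (vectorSpace ℂ) (grassmannian hk) (fun t => (e (γ t)).1.2) :=
    ((isMorphism_snd (orbitClosure n m) (grassmannian hk)).comp
      (isMorphism_val ((orbitClosure n m).prod (grassmannian hk)) (pairSet n m k))).comp
      (he.comp hγ)
  have h1 : ∀ t : ℂ, t ≠ 0 → (e (γ t)).1.2.U = colSpan A k := by
    intro t ht
    have hr := rank_smul_antiDiag (show m ≤ n by omega) hA ht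
    have hg : (e (γ t)).1.1.1 = A * (t • antiDiag n m) * A⁻¹ := congrArg Subtype.val (hp (γ t))
    obtain ⟨h2, h3⟩ := (e (γ t)).2
    rw [hg] at h2 h3
    have h4 := im_conj_le (A := A) (hct t)
    have h5 := le_ker_conj hA (hct t)
    have h6 := rank_add_finrank_ker (A * (t • antiDiag n m) * A⁻¹)
    have h7 := (conj_mem_orbitClosureSet h hA (hct t)).2
    have h8 := finrank_colSpan hA hk
    have h9 := (e (γ t)).1.2.dim
    -- At rank `m`, dimensions leave no choice: the subspace is `im g`, equal to `U₁`, when `k = m`,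
    -- and `ker g`, equal to `U₂`, when `k = n - m`.
    rcases hkm with rfl | rfl
    · rw [← Submodule.eq_of_le_of_finrank_eq h2 (by rw [finrank_im]; omega),
        Submodule.eq_of_le_of_finrank_eq h4 (by rw [finrank_im]; omega)]
    · rw [Submodule.eq_of_le_of_finrank_eq h3 (by omega),
        Submodule.eq_of_le_of_finrank_eq h5 (by omega)]
  -- Otherwise the parameters with a different subspace would form a nonempty open set of the line
  -- missing every `t ≠ 0`, against irreducibility.
  have h0 : (e (γ 0)).1.2.U = colSpan A k := by
    by_contra hne
    have hO := (isClosed_grassmannian_point hk hA).isOpen_compl.preimage hδ.1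
    have hD : IsOpen (X := vectorSpace ℂ) {t : ℂ | t ≠ 0} := isOpen_iff_mem_nhds.2 fun t ht =>
      (vectorSpace ℂ).ne_zero (regAt_scalar t) ht
    obtain ⟨t, ht, ht'⟩ := exists_mem_inter_vectorSpace hO hD (v := (0 : ℂ)) (w := (1 : ℂ)) hne
      one_ne_zero
    exact ht (h1 t ht')
  have h2 : γ 0 = tripleOf h A 0 hA (zero_mem _) := by
    simp only [γ, zero_smul]
  rwa [h2] at h0

theorem proj_mul_single (k : ℕ) (i j : Fin n) :
    proj n k * Matrix.single i j 1 = if i.val < k then Matrix.single i j 1 else 0 := by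
  ext a b
  rw [proj, Matrix.diagonal_mul]
  split_ifs with h1 h2 h2
  · rw [one_mul]
  · rw [Matrix.single_apply_of_ne (h := by rintro ⟨rfl, rfl⟩; exact h2 h1), mul_zero,
      Matrix.zero_apply]
  · rw [Matrix.single_apply_of_ne (h := by rintro ⟨rfl, rfl⟩; exact h1 h2), mul_zero]
  · rw [zero_mul, Matrix.zero_apply]

theorem single_mul_proj (k : ℕ) (i j : Fin n) :
    Matrix.single i j 1 * proj n k = if j.val < k then Matrix.single i j 1 else 0 := by
  ext a b
  rw [proj, Matrix.mul_diagonal]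
  split_ifs with h1 h2 h2
  · rw [mul_one]
  · rw [Matrix.single_apply_of_ne (h := by rintro ⟨rfl, rfl⟩; exact h2 h1), zero_mul,
      Matrix.zero_apply]
  · rw [Matrix.single_apply_of_ne (h := by rintro ⟨rfl, rfl⟩; exact h1 h2), zero_mul]
  · rw [mul_zero, Matrix.zero_apply]

/-- There are two complete flags that differ exactly in dimension `p`. -/
theorem exists_frame_differing {p : ℕ} (h0 : 0 < p) (hp : p < n) :
    ∃ A : Matrix (Fin n) (Fin n) ℂ, IsUnit A.det ∧ colSpan A p ≠ colSpan 1 p ∧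
      ∀ k ≤ n, k ≠ p → colSpan A k = colSpan 1 k := by
  obtain ⟨i, hi⟩ : ∃ i : Fin n, i.val = p - 1 := ⟨⟨p - 1, by omega⟩, rfl⟩
  obtain ⟨j, hj⟩ : ∃ j : Fin n, j.val = p := ⟨⟨p, hp⟩, rfl⟩
  have hij : i ≠ j := fun e => by
    rw [e, hj] at hi
    omega
  -- Counting from `0`, the basis vector of index `p` is added to column `p - 1`. Spans of fewer
  -- than `p` columns do not see the change, and spans of more than `p` columns already contain the
  -- added vector.
  obtain ⟨A, hAdef⟩ : ∃ A : Matrix (Fin n) (Fin n) ℂ, A = 1 + Matrix.single j i 1 := ⟨_, rfl⟩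
  have hN : Matrix.single j i (1 : ℂ) * Matrix.single j i 1 = 0 :=
    by simp [hij]
  have hA : IsUnit A.det := isUnit_det_of_mul_eq_one (B := 1 - Matrix.single j i 1) (by
    rw [hAdef]
    linear_combination (norm := noncomm_ring) - hN)
  have h1 : IsUnit (1 : Matrix (Fin n) (Fin n) ℂ).det := by simp
  have key : ∀ k, (1 - proj n k) * (1 : Matrix (Fin n) (Fin n) ℂ)⁻¹ * A * proj n k =
      if k = p then Matrix.single j i 1 else 0 := by
    intro k
    have hE := proj_mul_self (n := n) k
    have e1 : (1 - proj n k) * (1 : Matrix (Fin n) (Fin n) ℂ)⁻¹ * A * proj n k =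
        (Matrix.single j i 1 * proj n k) - proj n k * (Matrix.single j i 1 * proj n k) := by
      rw [inv_one, hAdef]
      linear_combination (norm := noncomm_ring) - hE
    rw [e1, single_mul_proj]
    by_cases hik : i.val < k
    · rw [if_pos hik, proj_mul_single]
      by_cases hjk : j.val < k
      · rw [if_pos hjk, sub_self, if_neg]
        omega
      · rw [if_neg hjk, sub_zero, if_pos]
        omega
    · rw [if_neg hik, mul_zero, sub_self, if_neg]
      omega
  refine ⟨A, hA, fun he => ?_, fun k hk hkp => ?_⟩
  · have h2 := (colSpan_le_colSpan_iff h1 p).1 he.le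
    rw [key, if_pos rfl] at h2
    have h3 := congrFun (congrFun h2 j) i
    simp at h3
  · refine Submodule.eq_of_le_of_finrank_eq ((colSpan_le_colSpan_iff h1 k).2 ?_)
      ((finrank_colSpan hA hk).trans (finrank_colSpan h1 hk).symm)
    rw [key, if_neg hkp]

theorem not_exists_iso_cotangentVariety (h : 2 * m ≤ n) (hm : 0 < m) (hn : 2 * m < n) {k : ℕ}
    (hk : k ≤ n) (hkm : k = m ∨ k = n - m) :
    ¬ ∃ e : tripleVariety h ≃ cotangentVariety m hk,
      IsIso e ∧ ∀ z, cotangentProj m hk (e z) = tripleProj h z := by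
  rintro ⟨e, he, hp⟩
  -- The dimension `p` is that of the subspace forgotten by `e` over `0`; it differs from `k`
  -- because `2 * m < n`. Frames differing only in dimension `p` give distinct triples with the same
  -- image.
  obtain ⟨p, hpm, hpk⟩ : ∃ p, (p = m ∨ p = n - m) ∧ p ≠ k := by
    rcases hkm with rfl | rfl
    · exact ⟨n - k, Or.inr rfl, by omega⟩
    · exact ⟨m, Or.inl rfl, by omega⟩
  obtain ⟨A, hA, hne, heq⟩ := exists_frame_differing (n := n) (p := p) (by omega) (by omega)
  have h1 : IsUnit (1 : Matrix (Fin n) (Fin n) ℂ).det := by simp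
  have h2 := cotangent_subspace_eq h hk hkm (e := e) he.1 hp hA
  have h3 := cotangent_subspace_eq h hk hkm (e := e) he.1 hp h1
  have h4 : e (tripleOf h A 0 hA (zero_mem _)) = e (tripleOf h 1 0 h1 (zero_mem _)) := by
    have hU := h2.trans ((heq k hk hpk.symm).trans h3.symm)
    have hg := (hp (tripleOf h A 0 hA (zero_mem _))).trans
      ((Subtype.ext (by
          exact (by simp : A * 0 * A⁻¹ = 1 * 0 * 1⁻¹)) :
        tripleProj h (tripleOf h A 0 hA (zero_mem _)) =
          tripleProj h (tripleOf h 1 0 h1 (zero_mem _))).trans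
      (hp (tripleOf h 1 0 h1 (zero_mem _))).symm)
    refine Subtype.ext (Prod.ext hg ?_)
    generalize e (tripleOf h A 0 hA (zero_mem _)) = x at *
    generalize e (tripleOf h 1 0 h1 (zero_mem _)) = y at *
    obtain ⟨⟨_, ⟨_, _⟩⟩, _⟩ := x
    obtain ⟨⟨_, ⟨_, _⟩⟩, _⟩ := y
    change GrPoint.mk _ _ = GrPoint.mk _ _
    congr 1
  have h5 : (tripleOf h A 0 hA (zero_mem _)).1.2 = (tripleOf h 1 0 h1 (zero_mem _)).1.2 :=
    congrArg (fun z : tripleSet n m => z.1.2) (e.injective h4)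
  rcases hpm with rfl | rfl
  · exact hne (congrArg Flag.U₁ h5)
  · exact hne (congrArg Flag.U₂ h5)

end cotangent

end TwoColumn

end

noncomputable section

namespace TwoColumn

open FunSpace

/-! ### The tensor product of the tautological and the dual quotient bundle -/

section contraction

variable {n a b : ℕ}

/-- The matrix of `v ↦ ξ v • u`. -/
def rankOne (n : ℕ) :
    (Fin n → ℂ) →ₗ[ℂ] Module.Dual ℂ (Fin n → ℂ) →ₗ[ℂ] Matrix (Fin n) (Fin n) ℂ :=
  LinearMap.mk₂ ℂ (fun u ξ => Matrix.vecMulVec u fun j => ξ (Pi.single j 1))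
    (fun _ _ _ => Matrix.add_vecMulVec _ _ _) (fun _ _ _ => Matrix.smul_vecMulVec _ _ _)
    (fun _ _ _ => Matrix.vecMulVec_add _ _ _) (fun _ _ _ => Matrix.vecMulVec_smul _ _ _)

theorem rankOne_mulVec (u : Fin n → ℂ) (ξ : Module.Dual ℂ (Fin n → ℂ)) (v : Fin n → ℂ) :
    (rankOne n u ξ).mulVec v = ξ v • u := by
  have h : ∑ j, ξ (Pi.single j 1) * v j = ξ v := by
    conv_rhs => rw [← Finset.univ_sum_single v, map_sum]
    refine Finset.sum_congr rfl fun j _ => ?_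
    rw [mul_comm, ← smul_eq_mul, ← map_smul, ← Pi.single_smul, smul_eq_mul, mul_one]
  ext i
  rw [← h]
  simp [rankOne, Matrix.mulVec, dotProduct, Matrix.vecMulVec_apply, Finset.mul_sum, mul_comm,
    mul_left_comm]

/-- The map `U ⊗ D → End V` given by `V ⊗ V^* ≅ End V`. -/
def contract (U : Submodule ℂ (Fin n → ℂ)) (D : Submodule ℂ (Module.Dual ℂ (Fin n → ℂ))) :
    U ⊗[ℂ] D →ₗ[ℂ] Matrix (Fin n) (Fin n) ℂ :=
  TensorProduct.lift ((rankOne n).domRestrict₁₂ U D)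

theorem contract_tmul {U : Submodule ℂ (Fin n → ℂ)}
    {D : Submodule ℂ (Module.Dual ℂ (Fin n → ℂ))} (u : U) (ξ : D) :
    contract U D (u ⊗ₜ ξ) = rankOne n u ξ := rfl

theorem im_contract_le {U : Submodule ℂ (Fin n → ℂ)}
    {D : Submodule ℂ (Module.Dual ℂ (Fin n → ℂ))} (t : U ⊗[ℂ] D) : im (contract U D t) ≤ U := by
  rintro _ ⟨v, rfl⟩
  rw [Matrix.mulVecLin_apply]
  induction t using TensorProduct.induction_on with
  | zero => simp
  | tmul u ξ =>
    rw [contract_tmul, rankOne_mulVec]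
    exact U.smul_mem _ u.2
  | add s t hs ht =>
    rw [map_add, Matrix.add_mulVec]
    exact U.add_mem hs ht

theorem le_ker_contract {U U' : Submodule ℂ (Fin n → ℂ)} (t : U ⊗[ℂ] U'.dualAnnihilator) :
    U' ≤ ker (contract U U'.dualAnnihilator t) := by
  intro v hv
  rw [LinearMap.mem_ker, Matrix.mulVecLin_apply]
  induction t using TensorProduct.induction_on with
  | zero => simp
  | tmul u ξ =>
    rw [contract_tmul, rankOne_mulVec, (Submodule.mem_dualAnnihilator _).1 ξ.2 v hv, zero_smul]
  | add s t hs ht => rw [map_add, Matrix.add_mulVec, hs, ht, add_zero]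

/-! ### Adapted bases -/

/-- The first `a` columns of an invertible matrix, as a basis of their span. -/
def colBasis (han : a ≤ n) {S : Matrix (Fin n) (Fin n) ℂ} (hS : IsUnit S.det)
    {U : Submodule ℂ (Fin n → ℂ)} (hU : colSpan S a = U) : Module.Basis (Fin a) ℂ U :=
  have hli : LinearIndependent ℂ fun i : Fin a => (⟨S.col (Fin.castLE han i), by
      rw [← hU]; exact Submodule.subset_span ⟨_, i.2, rfl⟩⟩ : U) :=
    LinearIndependent.of_comp U.subtype
      ((Matrix.linearIndependent_cols_iff_isUnit.2 ((Matrix.isUnit_iff_isUnit_det S).2 hS)).comp _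
        (Fin.castLE_injective han))
  .mk hli (hli.span_eq_top_of_card_eq_finrank' (by
    rw [Fintype.card_fin, ← hU, finrank_colSpan hS han])).ge

theorem colBasis_apply (han : a ≤ n) {S : Matrix (Fin n) (Fin n) ℂ} (hS : IsUnit S.det)
    {U : Submodule ℂ (Fin n → ℂ)} (hU : colSpan S a = U) (i : Fin a) :
    (colBasis han hS hU i : Fin n → ℂ) = S.col (Fin.castLE han i) := by
  rw [colBasis, Module.Basis.mk_apply]

/-- The functional given by a row of `S⁻¹`. -/
def invRow (S : Matrix (Fin n) (Fin n) ℂ) (i : Fin n) : Module.Dual ℂ (Fin n → ℂ) :=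
  LinearMap.proj i ∘ₗ S⁻¹.mulVecLin

theorem invRow_single (S : Matrix (Fin n) (Fin n) ℂ) (i j : Fin n) :
    invRow S i (Pi.single j 1) = S⁻¹ i j := by
  simp [invRow]

theorem invRow_col {S : Matrix (Fin n) (Fin n) ℂ} (hS : IsUnit S.det) (i j : Fin n) :
    invRow S i (S.col j) = (1 : Matrix (Fin n) (Fin n) ℂ) i j := by
  rw [← Matrix.nonsing_inv_mul S hS]
  rfl

/-- The last indices `b, …, n - 1`. -/
def lastIdx (n b : ℕ) (j : Fin (n - b)) : Fin n := ⟨b + j, by omega⟩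

theorem lastIdx_injective (n b : ℕ) : Function.Injective (lastIdx n b) := fun i j h => by
  have := congrArg Fin.val h
  simp only [lastIdx] at this
  exact Fin.ext (by omega)

theorem invRow_mem {S : Matrix (Fin n) (Fin n) ℂ} (hS : IsUnit S.det) (j : Fin (n - b)) :
    invRow S (lastIdx n b j) ∈ (colSpan S b).dualAnnihilator := by
  rw [Submodule.mem_dualAnnihilator]
  intro w hw
  have : colSpan S b ≤ LinearMap.ker (invRow S (lastIdx n b j)) := by
    refine Submodule.span_le.2 ?_
    rintro _ ⟨i, hi, rfl⟩
    change invRow S _ (S.col i) = 0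
    rw [invRow_col hS, Matrix.one_apply_ne]
    rintro rfl
    exact absurd hi (by simp [lastIdx])
  exact this hw

/-- The last `n - b` rows of `S⁻¹`, as a basis of the annihilator of the first `b` columns
of `S`. -/
def rowBasis (hbn : b ≤ n) {S : Matrix (Fin n) (Fin n) ℂ} (hS : IsUnit S.det)
    {U : Submodule ℂ (Fin n → ℂ)} (hU : colSpan S b = U) :
    Module.Basis (Fin (n - b)) ℂ U.dualAnnihilator :=
  have hli : LinearIndependent ℂ fun j : Fin (n - b) => (⟨invRow S (lastIdx n b j), by
      rw [← hU]; exact invRow_mem hS j⟩ : U.dualAnnihilator) := by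
    refine LinearIndependent.of_comp U.dualAnnihilator.subtype
      (Fintype.linearIndependent_iff.2 fun g hg j => ?_)
    have h1 := LinearMap.congr_fun hg (S.col (lastIdx n b j))
    simpa [invRow_col hS, Matrix.one_apply, (lastIdx_injective n b).eq_iff] using h1
  .mk hli (hli.span_eq_top_of_card_eq_finrank' (by
    have h1 := Subspace.finrank_add_finrank_dualAnnihilator_eq U
    have h2 := finrank_colSpan hS hbn
    rw [hU] at h2
    rw [Module.finrank_fin_fun] at h1
    rw [Fintype.card_fin]
    omega)).ge

theorem rowBasis_apply (hbn : b ≤ n) {S : Matrix (Fin n) (Fin n) ℂ} (hS : IsUnit S.det)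
    {U : Submodule ℂ (Fin n → ℂ)} (hU : colSpan S b = U) (j : Fin (n - b)) :
    (rowBasis hbn hS hU j : Module.Dual ℂ (Fin n → ℂ)) = invRow S (lastIdx n b j) := by
  rw [rowBasis, Module.Basis.mk_apply]

theorem rankOne_col_invRow (S : Matrix (Fin n) (Fin n) ℂ) (i j : Fin n) :
    rankOne n (S.col i) (invRow S j) = S * Matrix.single i j 1 * S⁻¹ := by
  ext k l
  change S k i * invRow S j (Pi.single l 1) = _
  rw [invRow_single]
  simp [Matrix.mul_apply, Matrix.single_apply, ite_and]

/-- The matrix with upper right block `c`. -/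
def cornerMatrix (han : a ≤ n) (c : Fin a × Fin (n - b) → ℂ) : Matrix (Fin n) (Fin n) ℂ :=
  ∑ i, ∑ j, c (i, j) • Matrix.single (Fin.castLE han i) (lastIdx n b j) 1

theorem cornerMatrix_apply (han : a ≤ n) (c : Fin a × Fin (n - b) → ℂ) (i : Fin a)
    (j : Fin (n - b)) : cornerMatrix han c (Fin.castLE han i) (lastIdx n b j) = c (i, j) := by
  simp [cornerMatrix, Matrix.sum_apply, Matrix.single_apply, (lastIdx_injective n b).eq_iff,
    (Fin.castLE_injective han).eq_iff, ite_and]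

theorem cornerMatrix_of_mem (han : a ≤ n) {C : Matrix (Fin n) (Fin n) ℂ}
    (hC : C ∈ fibreSpace n a b) :
    cornerMatrix (b := b) han (fun p => C (Fin.castLE han p.1) (lastIdx n b p.2)) = C := by
  ext k l
  by_cases hk : k.val < a
  · by_cases hl : b ≤ l.val
    · have h1 : k = Fin.castLE han ⟨k, hk⟩ := rfl
      have h2 : l = lastIdx n b ⟨l - b, by omega⟩ := Fin.ext (by simp only [lastIdx]; omega)
      generalize (⟨k, hk⟩ : Fin a) = i at h1
      generalize (⟨l - b, by omega⟩ : Fin (n - b)) = j at h2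
      rw [h1, h2, cornerMatrix_apply]
    · have h1 : C k l = 0 := by
        have := congrFun (congrFun hC.2 k) l
        rwa [proj, Matrix.mul_diagonal, if_pos (by omega), mul_one] at this
      rw [h1]
      simp only [cornerMatrix, Matrix.sum_apply, Matrix.smul_apply]
      refine Finset.sum_eq_zero fun i _ => Finset.sum_eq_zero fun j _ => ?_
      rw [Matrix.single_apply, if_neg, smul_zero]
      rintro ⟨-, rfl⟩
      exact hl (by simp [lastIdx])
  · have h1 : C k l = 0 := by
      have := congrFun (congrFun hC.1 k) l
      rwa [proj, Matrix.diagonal_mul, if_neg hk, zero_mul, eq_comm] at this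
    rw [h1]
    simp only [cornerMatrix, Matrix.sum_apply, Matrix.smul_apply]
    refine Finset.sum_eq_zero fun i _ => Finset.sum_eq_zero fun j _ => ?_
    rw [Matrix.single_apply, if_neg, smul_zero]
    rintro ⟨rfl, -⟩
    exact hk i.2

/-- In bases read off from `S` and `S⁻¹`, contraction is conjugation of the coordinate block, so
tensor coordinates can be recovered as matrix entries. -/
theorem contract_sum (han : a ≤ n) (hbn : b ≤ n) {S : Matrix (Fin n) (Fin n) ℂ}
    (hS : IsUnit S.det) {U U' : Submodule ℂ (Fin n → ℂ)} (hU : colSpan S a = U)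
    (hU' : colSpan S b = U') (c : Fin a × Fin (n - b) → ℂ) :
    contract U U'.dualAnnihilator
      (∑ i, ∑ j, c (i, j) • (colBasis han hS hU i ⊗ₜ rowBasis hbn hS hU' j)) =
        S * cornerMatrix han c * S⁻¹ := by
  simp only [map_sum, map_smul, contract_tmul, colBasis_apply, rowBasis_apply, rankOne_col_invRow,
    cornerMatrix, Matrix.mul_sum, Matrix.sum_mul, Matrix.mul_smul, Matrix.smul_mul]

/-- Choose one frame adapted to both subspaces; by `contract_sum` the coordinates of the tensor are
the corner entries of the conjugated matrix. -/
theorem contract_injective (U U' : Submodule ℂ (Fin n → ℂ)) (hle : U ≤ U') :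
    Function.Injective (contract U U'.dualAnnihilator) := by
  obtain ⟨S, hS, hU, hU'⟩ := exists_colSpan_eq hle rfl rfl
  have han := (Submodule.finrank_le U).trans_eq (Module.finrank_fin_fun ℂ)
  have hbn := (Submodule.finrank_le U').trans_eq (Module.finrank_fin_fun ℂ)
  refine (injective_iff_map_eq_zero _).2 fun t ht => ?_
  let B := (colBasis han hS hU).tensorProduct (rowBasis hbn hS hU')
  have h1 : ∑ i, ∑ j, B.repr t (i, j) • (colBasis han hS hU i ⊗ₜ rowBasis hbn hS hU' j) = t := by
    rw [← Fintype.sum_prod_type'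
      (f := fun i j => B.repr t (i, j) • (colBasis han hS hU i ⊗ₜ rowBasis hbn hS hU' j))]
    conv_rhs => rw [← B.sum_repr t]
    exact Finset.sum_congr rfl fun p _ => by rw [Module.Basis.tensorProduct_apply']
  have h2 : cornerMatrix (b := Module.finrank ℂ U') han (B.repr t) = 0 := by
    rw [← h1, contract_sum han hbn hS hU hU' (B.repr t)] at ht
    have hA2 := Matrix.nonsing_inv_mul _ hS
    linear_combination (norm := noncomm_ring)
      S⁻¹ * ht * S - hA2 * cornerMatrix han (B.repr t) - 
        S⁻¹ * S * cornerMatrix han (B.repr t) * hA2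
  rw [← B.repr.map_eq_zero_iff]
  ext ⟨i, j⟩
  rw [← cornerMatrix_apply han (B.repr t) i j, h2]
  rfl

end contraction

end TwoColumn

end

noncomputable section

namespace TwoColumn

open FunSpace

/-! ### Regular frames over cells and the isomorphism with the variety of triples -/

section tensor

variable {n m : ℕ}

/-- The frame of the tautological bundle attached to the section of `GL(V) → F` over a cell. -/
def tautFrame (h : 2 * m ≤ n) {A : Matrix (Fin n) (Fin n) ℂ} (hA : IsUnit A.det) :
    LocalFrame (flagBase h) (taut h) where
  dom := cell n m (n - m) A
  isOpen_dom := isOpen_cell _ _ A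
  rank := m
  basis x := colBasis (by omega) (isUnit_cellSection (by omega) hA x.2)
    (colSpan_cellSection (by omega) (Nat.sub_le n m) hA x.2).1
  regular i := isMorphism_iff.2 fun x => by
    refine (morphAt_pi_iff (ι := Fin n)).2 fun k => ?_
    exact FunSpace.congr _
      (.of_forall fun y => (congrFun (colBasis_apply _ (isUnit_cellSection (by omega) hA y.2) _ i)
        k).symm)
      (regAt_sub_of_regAt (regMat_cellSection (show m ≤ n - m by omega) (Nat.sub_le n m) x.2 k _))

theorem morphAt_dual_iff {X : FunSpace} {φ : X → Module.Dual ℂ (Fin n → ℂ)} {x : X} :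
    MorphAt X (vectorSpace (Module.Dual ℂ (Fin n → ℂ))) φ x ↔
      ∀ i, X.RegAt (fun y => φ y (Pi.single i 1)) x := by
  rw [morphAt_basis_iff (Pi.basisFun ℂ (Fin n)).dualBasis]
  simp [Module.Basis.dualBasis_repr]

/-- The frame of the dual quotient bundle attached to the section of `GL(V) → F` over a cell. -/
def dualQuotFrame (h : 2 * m ≤ n) {A : Matrix (Fin n) (Fin n) ℂ} (hA : IsUnit A.det) :
    LocalFrame (flagBase h) (dualQuot h) where
  dom := cell n m (n - m) A
  isOpen_dom := isOpen_cell _ _ A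
  -- This equals `m`; the unsimplified form matches the index type of `rowBasis` at `b = n - m`.
  rank := n - (n - m)
  basis x := rowBasis (Nat.sub_le n m) (isUnit_cellSection (by omega) hA x.2)
    (colSpan_cellSection (by omega) (Nat.sub_le n m) hA x.2).2
  regular i := isMorphism_iff.2 fun x => by
    refine morphAt_dual_iff.2 fun k => ?_
    exact FunSpace.congr _
      (.of_forall fun y => ((LinearMap.congr_fun (rowBasis_apply _
        (isUnit_cellSection (by omega) hA y.2) _ i) _).trans (invRow_single _ _ k)).symm)
      (regAt_sub_of_regAt
        ((regMat_cellSection (show m ≤ n - m by omega) (Nat.sub_le n m) x.2).inv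
          (isUnit_cellSection (by omega) hA x.2) _ k))

theorem contract_sum_apply {U : Submodule ℂ (Fin n → ℂ)}
    {D : Submodule ℂ (Module.Dual ℂ (Fin n → ℂ))} {ι κ : Type} [Fintype ι] [Fintype κ]
    (c : ι × κ → ℂ) (u : ι → U) (ξ : κ → D) (k l : Fin n) :
    contract U D (∑ i, ∑ j, c (i, j) • (u i ⊗ₜ ξ j)) k l =
      ∑ i, ∑ j, c (i, j) * ((u i : Fin n → ℂ) k *
        (ξ j : Module.Dual ℂ (Fin n → ℂ)) (Pi.single l 1)) := by
  simp only [map_sum, map_smul, contract_tmul, Matrix.sum_apply, Matrix.smul_apply, smul_eq_mul]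
  rfl

theorem contract_mem_orbitClosureSet (x : Flag n m (n - m))
    (t : x.U₁ ⊗[ℂ] x.U₂.dualAnnihilator) :
    contract x.U₁ x.U₂.dualAnnihilator t ∈ orbitClosureSet n m := by
  refine ⟨im_le_ker_iff.1 ((im_contract_le t).trans (x.le.trans (le_ker_contract t))), ?_⟩
  rw [← finrank_im]
  exact (Submodule.finrank_mono (im_contract_le t)).trans_eq x.dim₁

/-- The map `Taut ⊗ Q^* → {(g, U₁, U₂)}` given by `U₁ ⊗ (V / U₂)^* ⊆ V ⊗ V^* ≅ End V`. -/
def tensorToTriple (h : 2 * m ≤ n) (z : TensorPoint (taut h) (dualQuot h)) : tripleSet n m :=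
  let x : Flag n m (n - m) := z.1
  ⟨(⟨contract x.U₁ x.U₂.dualAnnihilator z.2, contract_mem_orbitClosureSet x z.2⟩, x),
    im_contract_le _, le_ker_contract _⟩

theorem tensorToTriple_injective (h : 2 * m ≤ n) : Function.Injective (tensorToTriple h) := by
  rintro ⟨x, s⟩ ⟨y, t⟩ hst
  obtain rfl : x = y := congrArg (fun z : tripleSet n m => z.1.2) hst
  exact congrArg _ (contract_injective _ _ (Flag.le x)
    (congrArg (fun z : tripleSet n m => z.1.1.1) hst))

/-- The coordinates of a triple with respect to the frames over the cell of `A`. -/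
def tripleCoord (h : 2 * m ≤ n) (A : Matrix (Fin n) (Fin n) ℂ) (z : tripleSet n m)
    (p : Fin m × Fin (n - (n - m))) : ℂ :=
  ((cellSection A z.1.2)⁻¹ * z.1.1.1 * cellSection A z.1.2) (Fin.castLE (by omega) p.1)
    (lastIdx n (n - m) p.2)

/-- An explicit local inverse, from which both surjectivity and regularity of the inverse map
follow. -/
theorem tensorToTriple_tensorChart (h : 2 * m ≤ n) {A : Matrix (Fin n) (Fin n) ℂ}
    (hA : IsUnit A.det) (z : tripleSet n m) (hz : z.1.2 ∈ cell n m (n - m) A) :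
    tensorToTriple h (tensorChart (tautFrame h hA) (dualQuotFrame h hA)
      (⟨z.1.2, hz, hz⟩, tripleCoord h A z)) = z := by
  refine Subtype.ext (Prod.ext (Subtype.ext ?_) rfl)
  refine (contract_sum (by omega) (Nat.sub_le n m) (isUnit_cellSection (by omega) hA hz)
    (colSpan_cellSection (by omega) (Nat.sub_le n m) hA hz).1
    (colSpan_cellSection (by omega) (Nat.sub_le n m) hA hz).2 _).trans ?_
  refine (congrArg (fun c => cellSection A z.1.2 * c * (cellSection A z.1.2)⁻¹)
    (cornerMatrix_of_mem _ (mem_fibreSpace_of_mem_cell h hA z hz))).trans ?_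
  exact conj_conj_inv (isUnit_cellSection (by omega) hA hz)

theorem exists_mem_cell (z : tripleSet n m) :
    ∃ A : Matrix (Fin n) (Fin n) ℂ, IsUnit A.det ∧ z.1.2 ∈ cell n m (n - m) A := by
  obtain ⟨A, hA, h1, h2⟩ := exists_colSpan_eq z.1.2.le z.1.2.dim₁ z.1.2.dim₂
  exact ⟨A, hA, mem_cell_self hA h1 h2⟩

theorem tensorToTriple_bijective (h : 2 * m ≤ n) : Function.Bijective (tensorToTriple h) := by
  refine ⟨tensorToTriple_injective h, fun z => ?_⟩
  obtain ⟨A, hA, hz⟩ := exists_mem_cell z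
  exact ⟨_, tensorToTriple_tensorChart h hA z hz⟩

/-- The isomorphism of `Taut ⊗ Q^*` with the variety of triples. -/
def tensorEquiv (h : 2 * m ≤ n) : tensorBundle (taut h) (dualQuot h) ≃ tripleVariety h :=
  Equiv.ofBijective (tensorToTriple h) (tensorToTriple_bijective h)

/-- The structure on the tensor bundle is final for all pairs of local frames, so arbitrary frames
have to be tested. The matrix entries are sums of products of the coordinates with entries of the
frame sections, all regular. -/
theorem isMorphism_tensorToTriple (h : 2 * m ≤ n) :
    IsMorphism (tensorBundle (taut h) (dualQuot h)) (tripleVariety h) (tensorToTriple h) := by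
  refine isMorphism_of_final fun f => isMorphism_iff.2 fun z => ?_
  obtain ⟨f, f'⟩ := f
  let P := ((flagBase h).sub (f.dom ∩ f'.dom)).prod
    (vectorSpace (Fin f.rank × Fin f'.rank → ℂ))
  let T := ↥(f.dom ∩ f'.dom) × (Fin f.rank × Fin f'.rank → ℂ)
  have hbase : IsMorphism P (flagBase h) fun w : T => w.1.1 :=
    (isMorphism_val (flagBase h) (f.dom ∩ f'.dom)).comp (isMorphism_fst _ _)
  have h1 : ∀ i, MorphAt P (vectorSpace (Fin n → ℂ))
      (fun w : T => (f.basis ⟨w.1.1, w.1.2.1⟩ i : Fin n → ℂ)) z := fun i =>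
    ((f.regular i).comp (isMorphism_sub_iff (X := P) (S := f.dom)
      (φ := fun w : T => ⟨w.1.1, w.1.2.1⟩).2 hbase)).morphAt z
  have h2 : ∀ j, MorphAt P (vectorSpace (Module.Dual ℂ (Fin n → ℂ)))
      (fun w : T => (f'.basis ⟨w.1.1, w.1.2.2⟩ j : Module.Dual ℂ (Fin n → ℂ))) z := fun j =>
    ((f'.regular j).comp (isMorphism_sub_iff (X := P) (S := f'.dom)
      (φ := fun w : T => ⟨w.1.1, w.1.2.2⟩).2 hbase)).morphAt z
  have h3 : MorphAt P (vectorSpace (Fin f.rank × Fin f'.rank → ℂ)) (fun w : T => w.2) z :=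
    (isMorphism_snd _ _).morphAt z
  refine morphAt_tripleVariety h (fun k l => ?_) (hbase.morphAt z)
  refine FunSpace.congr _ (.of_forall fun w => ?_) (regAt_sum Finset.univ fun i _ =>
    regAt_sum Finset.univ fun j _ => FunSpace.mul _ (morphAt_pi_iff.1 h3 (i, j))
      (FunSpace.mul _ ((morphAt_pi_iff (ι := Fin n)).1 (h1 i) k) (morphAt_dual_iff.1 (h2 j) l)))
  exact (contract_sum_apply w.2 (f.basis ⟨w.1.1, w.1.2.1⟩) (f'.basis ⟨w.1.1, w.1.2.2⟩) k l).symm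

/-- Here the frames over one cell suffice: near a triple the inverse is the corresponding tensor
chart applied to the flag and `tripleCoord`, both of which are regular. -/
theorem isMorphism_tensorEquiv_symm (h : 2 * m ≤ n) :
    IsMorphism (tripleVariety h) (tensorBundle (taut h) (dualQuot h)) (tensorEquiv h).symm := by
  refine isMorphism_iff.2 fun (z : tripleSet n m) => ?_
  obtain ⟨A, hA, hz⟩ := exists_mem_cell z
  have hU : IsOpen (tripleToFlag h ⁻¹' cell n m (n - m) A) :=
    (isOpen_cell _ _ A).preimage (isMorphism_tripleToFlag h).1
  refine morphAt_of_sub hU hz ?_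
  have hS := (regMat_cellSection (show m ≤ n - m by omega) (Nat.sub_le n m) hz).comp
    ((isMorphism_tripleToFlag h).morphAt z)
  have hc := ((hS.inv (isUnit_cellSection (by omega) hA hz)).mul (regMat_tripleMatrix h z)).mul hS
  have hval := (isMorphism_val (tripleVariety h) (tripleToFlag h ⁻¹' cell n m (n - m) A)).morphAt
    ⟨z, hz⟩
  have key : MorphAt ((tripleVariety h).sub (tripleToFlag h ⁻¹' cell n m (n - m) A))
      (((flagBase h).sub ((tautFrame h hA).dom ∩ (dualQuotFrame h hA).dom)).prod
        (vectorSpace (Fin m × Fin (n - (n - m)) → ℂ)))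
      (fun y : (tripleToFlag h ⁻¹' cell n m (n - m) A : Set (tripleVariety h)) =>
        (⟨tripleToFlag h y.1, y.2, y.2⟩, tripleCoord h A y.1)) ⟨z, hz⟩ := by
    refine MorphAt.prodMk (morphAt_sub_iff.2
      (((isMorphism_tripleToFlag h).morphAt z).comp hval)) (morphAt_pi_iff.2 fun p => ?_)
    exact hval.2 _ (hc _ _)
  refine MorphAt.congr (((isMorphism_final _ _
    (tautFrame h hA, dualQuotFrame h hA)).morphAt _).comp key) (.of_forall fun y => ?_)
  exact ((tensorEquiv h).symm_apply_eq.2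
    (tensorToTriple_tensorChart h hA y.1 y.2).symm).symm

theorem isLinearMap_tripleMatrix_tensorEquiv (h : 2 * m ≤ n) (x : flagBase h) :
    IsLinearMap ℂ (fun t : taut h x ⊗[ℂ] dualQuot h x =>
      tripleMatrix h (tensorEquiv h ⟨x, t⟩)) :=
  (contract (taut h x) (dualQuot h x)).isLinear

end tensor

end TwoColumn

end

open FunSpace TwoColumn in
theorem mainTheorem9 (n m : ℕ) (h : 2 * m ≤ n) :
    -- the variety of triples is isomorphic to the bundle `Taut ⊗ Q^*` over the flag variety
    (∃ Ψ : tensorBundle (taut h) (dualQuot h) ≃ tripleVariety h,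
      IsIso Ψ ∧
      (∀ (x : flagBase h) (t : taut h x ⊗[ℂ] dualQuot h x), tripleToFlag h (Ψ ⟨x, t⟩) = x) ∧
      (∀ x : flagBase h, IsLinearMap ℂ
        (fun t : taut h x ⊗[ℂ] dualQuot h x => tripleMatrix h (Ψ ⟨x, t⟩)))) ∧
    -- `p` is a resolution of singularities
    IsResolution (tripleVariety h) (orbitClosure n m) (tripleProj h) ∧
    -- `p` is not isomorphic, over the orbit closure, to a cotangent bundle resolution
    (0 < m → 2 * m < n → ∀ (k : ℕ) (hk : k ≤ n), k = m ∨ k = n - m →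
      ¬ ∃ e : tripleVariety h ≃ cotangentVariety m hk,
        IsIso e ∧ ∀ z, cotangentProj m hk (e z) = tripleProj h z) :=
  ⟨⟨tensorEquiv h, ⟨isMorphism_tensorToTriple h, isMorphism_tensorEquiv_symm h⟩, fun _ _ => rfl,
    isLinearMap_tripleMatrix_tensorEquiv h⟩, isResolution_tripleProj h,
    fun hm hn _ hk hkm => not_exists_iso_cotangentVariety h hm hn hk hkm⟩
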